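/- **Notation.** Let $\mathbb H_2$ be the set of complex $2\times2$ matrices $W=\begin{pmatrix}w_{11}&w_{12}\\w_{21}&w_{22}\end{pmatrix}$ with $(W-W^\dagger)/2i>0$, and for $a,b\in\frac12\mathbb Z[i]^2$ put $$\Theta\begin{bmatrix}a\\b\end{bmatrix}(W)=\sum_{n\in\mathbb Z[i]^2}\exp\Big(\pi i\big({}^t\overline{(n+a)}\,W(n+a)+2\,\mathrm{Re}({}^t\bar b\,n)\big)\Big).$$ Let $\Theta_1,\dots,\Theta_{10}$ be the functions with ${}^t(a,b)=\frac{1+i}{2}\,{}^t(s_1,s_2,s_3,s_4)$, where $s_1s_2s_3s_4=1111$, $1100$, $1000$, $1001$, $0100$, $0000$, $0001$, $0011$, $0010$, $0110$; they are attached in this order to the splittings $123|456$, $124|356$, $125|346$, $126|345$, $134|256$, $135|246$, $136|245$, $145|236$, $146|235$, $156|234$ of $\{1,\dots,6\}$. For an arbitrary arrangement $i,j,k,l,m,n$ of $1,\dots,6$ let $\Theta\binom{i\,j\,k}{l\,m\,n}^2$ be the square of the theta function attached to the splitting $ijk|lmn$, multiplied by the signs of the two permutations that sort $(i,j,k)$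 and $(l,m,n)$. For $A_0=\begin{pmatrix}1&0&0&a_2&b_1&c_0\\0&1&0&a_0&b_2&c_1\\0&0&1&a_1&b_0&c_2\end{pmatrix}$ with all $a_i,b_i,c_i\ne0$ let $Y_I(A_0)=[ijk][lmn]$ (products of $3\times3$ minors, $I=\{\{i,j,k\},\{l,m,n\}\}$ one of the ten splittings above, written as there), and let $$\tilde z_1=-\frac{a_1c_1}{a_0c_2},\quad \tilde z_2=-\frac{a_2b_2}{a_0b_1},\quad \tilde z_3=\frac{a_0b_1c_2}{a_2b_0c_1},\quad \tilde z_4=\frac{a_0b_1c_2}{a_1b_2c_0}$$ be the affine coordinates at the boundary point $o_1^+$. Then $Y_I(A_0)/(a_0b_0c_0)=Q_I(\tilde z)$ for a polynomial $Q_I$. With $\rho=\binom{1\,2\,3\,4\,5\,6}{1\,4\,5\,3\,6\,2}$, the *master equation* at $W$, in the unknowns $\tilde z=(\tilde z_1,\dots,\tilde z_4)$ and $\omega_0^2$, is the system of ten equations $$Q_I(\tilde z)\,\omega_0^2=\Theta\binom{\rho(i)\,\rho(j)\,\rho(k)}{\rho(l)\,\rho(m)\,\rho(n)}^2(W)\qquad(I=\{\{i,j,k\},\{l,m,n\}\}).$$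 Put $q_1=e^{\pi iw_{11}}$, $q_2=e^{\pi iw_{22}}$, $q_3=e^{\pi i(w_{12}-iw_{21})/(1-i)}$, $q_4=e^{\pi i(w_{12}+iw_{21})/(1+i)}$, and let $\tilde Q_1=-q_4$, $\tilde Q_2=q_3$, $\tilde Q_3=-\frac{q_2}{q_3q_4}$, $\tilde Q_4=-\frac{q_1}{q_3q_4}$. For $\varepsilon>0$ let $U_\varepsilon=\{W\in\mathbb H_2:\max_k|\tilde Q_k(W)|<\varepsilon\}$. Finally, $\widetilde\Theta$ is the holomorphic function on $\mathbb H_2$ with $$\widetilde\Theta^2=\tfrac1{12}\Big\{\Big(\sum_{k=1}^{10}\Theta_k^4\Big)^2-4\sum_{k=1}^{10}\Theta_k^8\Big\}$$ whose sign is fixed by $\widetilde\Theta\,\frac{q_3q_4}{q_1q_2}=-64(q_3-q_4)+o(|q_3|+|q_4|)$ as $\tilde Q\to0$. **Proposition.** The function $\widetilde\Theta$ exists, and the following hold. (1) Let $W\in\mathbb H_2$ with $\Theta_k(W)\neq0$ for $k=1,\dots,10$. Then $(\tilde z,\omega_0^2)\in\mathbb C^4\times\mathbb C$ solves the master equation at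 $W$ if and only if $$\begin{aligned}\tilde z_1&=\frac{\Theta_3^2+\Theta_9^2-\omega_0^2}{\omega_0^2-\Theta_6^2},&\tilde z_2&=\frac{\Theta_4^2+\Theta_9^2-\omega_0^2}{\omega_0^2-\Theta_6^2},\\ \tilde z_3&=\frac{\omega_0^2-\Theta_6^2}{\omega_0^2-\Theta_9^2},&\tilde z_4&=\frac{(\omega_0^2-\Theta_6^2)^2(\omega_0^2-\Theta_9^2)}{\omega_0^2(\Theta_3^2+\Theta_9^2-\omega_0^2)(\Theta_4^2+\Theta_9^2-\omega_0^2)}\end{aligned}\tag{A}$$ and $$\omega_0^2=\frac1{2\Theta_8^2}\Big\{\Theta_7^2\Theta_8^2-\Theta_{10}^2\Theta_5^2+\Theta_6^2\Theta_9^2\mp\widetilde\Theta\Big\}$$ for one of the two signs; for such a solution none of the denominators in (A) vanishes. (2) For all sufficiently small $\varepsilon>0$, no $\Theta_k$ vanishes on $U_\varepsilon$, and the master equation has a unique solution $(\tilde z(W),\omega_0^2(W))$ that is holomorphic on $U_\varepsilon$ and has the boundary behaviour of the mirror map at $o_1^+$, that is, $$\frac{\tilde z_1}{\tilde Q_1}\to4,\quad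 \frac{\tilde z_2}{\tilde Q_2}\to4,\quad\frac{\tilde z_3}{\tilde Q_3}\to1,\quad\frac{\tilde z_4}{\tilde Q_4}\to1\qquad(\tilde Q\to0).$$ It is given by (A) with $$\omega_0^2=\frac1{2\Theta_8^2}\Big\{\Theta_7^2\Theta_8^2-\Theta_{10}^2\Theta_5^2+\Theta_6^2\Theta_9^2-\widetilde\Theta\Big\}.$$ -/

import Mathlib

open scoped Matrix Topology ComplexOrder

namespace LambdaK3

/-! ### The domain and the theta functions -/

/-- Complex `2 × 2` matrices `W = (w₁₁ w₁₂; w₂₁ w₂₂)`. -/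
abbrev Mat := Matrix (Fin 2) (Fin 2) ℂ

/-- The Hermitian upper half space `ℍ₂`: the matrices `W` with `(W - W†) / 2i` positive definite. -/
def upperHalf : Set Mat :=
  {W | ((2 * Complex.I)⁻¹ • (W - Wᴴ)).PosDef}

/-- The theta function with characteristics `a, b`:
`∑ exp (π i ((n + a)† W (n + a) + 2 Re (b† n)))`, the sum being over `n ∈ ℤ[i]²`. -/
noncomputable def hermTheta (a b : Fin 2 → ℂ) (W : Mat) : ℂ :=
  ∑' n : Fin 2 → GaussianInt,
    let m : Fin 2 → ℂ := fun r => GaussianInt.toComplex (n r)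
    Complex.exp (Real.pi * Complex.I *
      (star (m + a) ⬝ᵥ (W *ᵥ (m + a)) + 2 * ((star b ⬝ᵥ m).re : ℂ)))

/-- The ten splittings `{{i,j,k},{l,m,n}}` of the six labels, in lexicographic order:
`123|456, 124|356, 125|346, 126|345, 134|256, 135|246, 136|245, 145|236, 146|235, 156|234`.
The labels `1, …, 6` are `0, …, 5` here. -/
def word : Fin 10 → Fin 6 → Fin 6 :=
  ![![0, 1, 2, 3, 4, 5], ![0, 1, 3, 2, 4, 5], ![0, 1, 4, 2, 3, 5], ![0, 1, 5, 2, 3, 4],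
    ![0, 2, 3, 1, 4, 5], ![0, 2, 4, 1, 3, 5], ![0, 2, 5, 1, 3, 4], ![0, 3, 4, 1, 2, 5],
    ![0, 3, 5, 1, 2, 4], ![0, 4, 5, 1, 2, 3]]

/-- The vectors `(s₁, s₂, s₃, s₄)` with `a = (1+i)/2 (s₁, s₂)`, `b = (1+i)/2 (s₃, s₄)` that
correspond to the ten splittings. -/
def charVec : Fin 10 → Fin 4 → ℂ :=
  ![![1, 1, 1, 1], ![1, 1, 0, 0], ![1, 0, 0, 0], ![1, 0, 0, 1], ![0, 1, 0, 0],
    ![0, 0, 0, 0], ![0, 0, 0, 1], ![0, 0, 1, 1], ![0, 0, 1, 0], ![0, 1, 1, 0]]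

/-- The ten even theta functions; `theta s` is the function written `Θ_{s+1}`, so that
`theta 0, …, theta 9` are `Θ₁, …, Θ₁₀`. -/
noncomputable def theta (s : Fin 10) (W : Mat) : ℂ :=
  hermTheta ![(1 + Complex.I) / 2 * charVec s 0, (1 + Complex.I) / 2 * charVec s 1]
    ![(1 + Complex.I) / 2 * charVec s 2, (1 + Complex.I) / 2 * charVec s 3] W

/-- The sign of the permutation that sorts a triple of distinct labels. -/
def tripleSign (i j k : Fin 6) : ℤ :=
  Int.sign (((j : ℤ) - i) * ((k : ℤ) - i) * ((k : ℤ) - j))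

/-- The symbol `Θ(i j k; l m n)²` for any arrangement `u = (i, j, k, l, m, n)` of the six labels:
up to the signs of the permutations that sort `(i, j, k)` and `(l, m, n)`, it is the square of the
theta function of the splitting `{{i,j,k},{l,m,n}}`. -/
noncomputable def bracketThetaSq (u : Fin 6 → Fin 6) (W : Mat) : ℂ :=
  ((tripleSign (u 0) (u 1) (u 2) * tripleSign (u 3) (u 4) (u 5) : ℤ) : ℂ) *
    ∑ s : Fin 10,
      if ({u 0, u 1, u 2} : Finset (Fin 6)) = {word s 0, word s 1, word s 2} ∨
          ({u 0, u 1, u 2} : Finset (Fin 6)) = {word s 3, word s 4, word s 5} then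
        theta s W ^ 2
      else 0

/-! ### The polynomials `Q_I` and the master equation -/

/-- The polynomial `Q_I` of the splitting `I = word s`, in the coordinates
`z̃₁, …, z̃₄ = z 0, …, z 3`; see `Q_spec`. -/
def Q (s : Fin 10) (z : Fin 4 → ℂ) : ℂ :=
  (![1 - z 0 * z 1 * (z 2 + z 3 + z 2 * z 3) - (z 0 + z 1) * z 0 * z 1 * z 2 * z 3,
    -(z 0 * z 1 * z 2 * (1 + z 0 * z 3)),
    -1 + z 0 * z 1 * z 3,
    -((1 + z 1) * z 0 * z 1 * z 2 * z 3),
    -1 + z 0 * z 1 * z 2 * z 3,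
    -(z 0 * z 1 * z 2 * (1 + z 1 * z 3)),
    z 0 * z 1 * z 3 * (1 + z 0 * z 2),
    1 - z 0 * z 1 * z 2,
    (1 + z 0) * z 0 * z 1 * z 2 * z 3,
    -(z 0 * z 1 * z 3 * (1 + z 1 * z 2))] : Fin 10 → ℂ) s

/-- The matrix `A₀ = (E₃ a b c)`. -/
def normalMatrix (a b c : Fin 3 → ℂ) : Matrix (Fin 3) (Fin 6) ℂ :=
  !![1, 0, 0, a 2, b 1, c 0;
     0, 1, 0, a 0, b 2, c 1;
     0, 0, 1, a 1, b 0, c 2]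

/-- The semi-invariant `Y_I(A) = [i j k] [l m n]` of the splitting `I = word s`. -/
def semiInvariant (s : Fin 10) (A : Matrix (Fin 3) (Fin 6) ℂ) : ℂ :=
  (A.submatrix id ![word s 0, word s 1, word s 2]).det *
    (A.submatrix id ![word s 3, word s 4, word s 5]).det

/-- The affine coordinates `z̃₁, …, z̃₄` of `A₀` at the boundary point `o₁⁺`. -/
noncomputable def coordPlus (a b c : Fin 3 → ℂ) : Fin 4 → ℂ :=
  ![-(a 1 * c 1) / (a 0 * c 2), -(a 2 * b 2) / (a 0 * b 1),
    (a 0 * b 1 * c 2) / (a 2 * b 0 * c 1), (a 0 * b 1 * c 2) / (a 1 * b 2 * c 0)]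

/-- `Q_I(z̃) = Y_I(A₀) / (a₀ b₀ c₀)`, which is the definition of `Q_I`. -/
theorem Q_spec (a b c : Fin 3 → ℂ) (ha : ∀ i, a i ≠ 0) (hb : ∀ i, b i ≠ 0) (hc : ∀ i, c i ≠ 0)
    (s : Fin 10) :
    Q s (coordPlus a b c) = semiInvariant s (normalMatrix a b c) / (a 0 * b 0 * c 0) := by
  have h1 := ha 0
  have h2 := ha 1
  have h3 := ha 2
  have h4 := hb 0
  have h5 := hb 1
  have h6 := hb 2
  have h7 := hc 0
  have h8 := hc 1
  have h9 := hc 2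
  fin_cases s <;>
    simp [Q, coordPlus, semiInvariant, normalMatrix, word, Matrix.det_fin_three] <;>
    field_simp <;> ring

/-- The permutation `ρ = (1 2 3 4 5 6 ↦ 1 4 5 3 6 2)`. -/
def rho : Fin 6 → Fin 6 := ![0, 3, 4, 2, 5, 1]

/-- The master equation at the point `W`, in the unknowns `z = (z̃₁, …, z̃₄)` and `w = ω₀²`:
`Q_I(z̃) ω₀² = Θ(ρ(i) ρ(j) ρ(k); ρ(l) ρ(m) ρ(n))²` for all ten `I = {{i,j,k},{l,m,n}}`. -/
def MasterEq (W : Mat) (z : Fin 4 → ℂ) (w : ℂ) : Prop :=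
  ∀ s : Fin 10, Q s z * w = bracketThetaSq (fun r => rho (word s r)) W

/-! ### The boundary point `o₁⁺` -/

/-- `q₁ = exp (π i w₁₁)`. -/
noncomputable def q1 (W : Mat) : ℂ := Complex.exp (Real.pi * Complex.I * W 0 0)

/-- `q₂ = exp (π i w₂₂)`. -/
noncomputable def q2 (W : Mat) : ℂ := Complex.exp (Real.pi * Complex.I * W 1 1)

/-- `q₃ = exp (π i (w₁₂ - i w₂₁) / (1 - i))`. -/
noncomputable def q3 (W : Mat) : ℂ :=
  Complex.exp (Real.pi * Complex.I * ((W 0 1 - Complex.I * W 1 0) / (1 - Complex.I)))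

/-- `q₄ = exp (π i (w₁₂ + i w₂₁) / (1 + i))`. -/
noncomputable def q4 (W : Mat) : ℂ :=
  Complex.exp (Real.pi * Complex.I * ((W 0 1 + Complex.I * W 1 0) / (1 + Complex.I)))

/-- The exponentiated flat coordinates `Q̃₁, …, Q̃₄` at `o₁⁺`, for which
`q₁ = Q̃₁ Q̃₂ Q̃₄`, `q₂ = Q̃₁ Q̃₂ Q̃₃`, `q₃ = Q̃₂`, `q₄ = -Q̃₁`. -/
noncomputable def flatCoord (W : Mat) : Fin 4 → ℂ :=
  ![-q4 W, q3 W, -(q2 W / (q3 W * q4 W)), -(q1 W / (q3 W * q4 W))]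

/-- The filter of the matrices `W` with `Q̃(W) → 0`. -/
noncomputable def cusp : Filter Mat := Filter.comap flatCoord (𝓝 0)

/-- The neighbourhood `max |Q̃ₖ| < ε` of `o₁⁺`, in `ℍ₂`. -/
def cuspNhd (ε : ℝ) : Set Mat := {W | W ∈ upperHalf ∧ ∀ k, ‖flatCoord W k‖ < ε}

/-- `F` is holomorphic on the set `U` of matrices, as a function of the four entries. -/
def HolomorphicOn {E : Type*} [NormedAddCommGroup E] [NormedSpace ℂ E] (F : Mat → E)
    (U : Set Mat) : Prop :=
  DifferentiableOn ℂ (fun v : Fin 2 → Fin 2 → ℂ => F (Matrix.of v)) {v | Matrix.of v ∈ U}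

/-- The leading coefficients of the mirror map at `o₁⁺`: `z̃ₖ = cₖ Q̃ₖ + ⋯`. -/
def leadCoeff : Fin 4 → ℂ := ![4, 4, 1, 1]

/-- `z, w` are a solution `z̃(W), ω₀²(W)` of the master equation on a neighbourhood of `o₁⁺` with
the boundary behaviour of the mirror map: `z̃ₖ / Q̃ₖ → cₖ` at `o₁⁺`. -/
def IsMirrorSolution (ε : ℝ) (z : Mat → Fin 4 → ℂ) (w : Mat → ℂ) : Prop :=
  HolomorphicOn z (cuspNhd ε) ∧ HolomorphicOn w (cuspNhd ε) ∧
    (∀ W ∈ cuspNhd ε, MasterEq W (z W) (w W)) ∧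
    ∀ k, Filter.Tendsto (fun W => z W k / flatCoord W k) cusp (𝓝 (leadCoeff k))

/-! ### The explicit formulas -/

/-- `Th` is the function `Θ̃` (`4/15` times the weight four form `Θ`): a holomorphic function on
`ℍ₂` with `12 Θ̃² = (∑ Θₖ⁴)² - 4 ∑ Θₖ⁸`, its sign being fixed by
`Θ̃ = -64 (q₁ q₂ / (q₃ q₄)) (q₃ - q₄ + ⋯)`. -/
def IsThetaTilde (Th : Mat → ℂ) : Prop :=
  HolomorphicOn Th upperHalf ∧
    (∀ W ∈ upperHalf,
      Th W ^ 2 = 1 / 12 * ((∑ s, theta s W ^ 4) ^ 2 - 4 * ∑ s, theta s W ^ 8)) ∧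
    Asymptotics.IsLittleO cusp
      (fun W => Th W / (q1 W * q2 W / (q3 W * q4 W)) + 64 * (q3 W - q4 W))
      (fun W => ‖q3 W‖ + ‖q4 W‖)

/-- `z̃₁, …, z̃₄` in terms of `Θ₃², Θ₄², Θ₆², Θ₉²` and `w = ω₀²`. -/
noncomputable def zFormula (W : Mat) (w : ℂ) : Fin 4 → ℂ :=
  let t3 := theta 2 W ^ 2
  let t4 := theta 3 W ^ 2
  let t6 := theta 5 W ^ 2
  let t9 := theta 8 W ^ 2
  ![(t3 + t9 - w) / (w - t6),
    (t4 + t9 - w) / (w - t6),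
    (w - t6) / (w - t9),
    (w - t6) ^ 2 * (w - t9) / (w * (t3 + t9 - w) * (t4 + t9 - w))]

/-- `(Θ₇² Θ₈² - Θ₁₀² Θ₅² + Θ₆² Θ₉² - x) / (2 Θ₈²)`. -/
noncomputable def wFormula (W : Mat) (x : ℂ) : ℂ :=
  1 / (2 * theta 7 W ^ 2) *
    (theta 6 W ^ 2 * theta 7 W ^ 2 - theta 9 W ^ 2 * theta 4 W ^ 2
      + theta 5 W ^ 2 * theta 8 W ^ 2 - x)

/-- None of the denominators in `zFormula W w` vanishes. -/
def DenomsNeZero (W : Mat) (w : ℂ) : Prop :=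
  w ≠ 0 ∧ w - theta 5 W ^ 2 ≠ 0 ∧ w - theta 8 W ^ 2 ≠ 0 ∧
    theta 2 W ^ 2 + theta 8 W ^ 2 - w ≠ 0 ∧ theta 3 W ^ 2 + theta 8 W ^ 2 - w ≠ 0

end LambdaK3

namespace LambdaK3

/-! Write t₀, …, t₉ for the squares of the ten theta functions, numbered as in the code. In the
master equation w - t₅, w - t₆, w - t₈ are w times monomials in z, and w - t₅ + t₀, w - t₅ + t₁ are
-z₀, -z₁ times w - t₅. Given the five linear relations among the t's, z is therefore a rational
function of w. Eliminating z leaves w (w - t₅ + t₀)(w - t₅ + t₁) = (w - t₅)(w - t₆)(w - t₈), whose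
cubic terms cancel. The resulting quadratic equation has discriminant Θ̃² (`masterSystem_iff`,
`SquareRelations.quadratic_iff`).

The linear relations come from an addition formula (`four_mul_hermTheta_sq`): a pair of lattice
vectors is replaced by its sum and difference, both divided by 1 + i. For characteristics in (1 +
i)/2 · {0, 1}² it expresses each square linearly in all the squares (`squareRelations`). For
characteristics with entries 1/2 and i/2 it gives squares that are signed sums of X = Θ₆Θ₁, Y =
Θ₂Θ₈, Z = Θ₄Θ₁₀. The discriminant is (Z² - X² - Y²)² - 4X²Y², which splits as in Heron's formula
into four such sums. Hence four times a product of four theta series is a holomorphic square root of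
it (`thetaTilde_sq`).

Near the boundary point every theta series is a sum of monomials in four small quantities, the
fourth roots of q₃, q₄, q₁/(q₃q₄), q₂/(q₃q₄), and its leading terms come from finitely many minimal
vectors (`hermTheta_expansion`). The expansions determine the numerators of z̃₁ and z̃₂ only up to
o(|q₃| + |q₄|), which does not see the smaller of q₃ and q₄. What saves the argument is that the
product of a numerator with its counterpart for the other square root is exactly a product of theta
squares, with known asymptotics (`tendsto_div_of_mul`, `solutionLimits`).

Changing the sign of Θ̃ exchanges q₃ and q₄ in these limits, so only one sign has the required
behaviour. On the convex open neighbourhood a holomorphic solution cannot switch between the two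
signs (`eqOn_zero_or_eqOn_zero_of_mul`), which gives uniqueness. -/

/-! ### Algebra of the master equation: reduction to a quadratic equation -/

/-- The linear relations between the squares of the ten theta functions. -/
structure SquareRelations (t : Fin 10 → ℂ) : Prop where
  r0 : t 0 = t 7 - t 8 + t 9
  r1 : t 1 = t 5 - t 6 - t 9
  r2 : t 2 = t 5 - t 7 - t 9
  r3 : t 3 = t 6 - t 8 + t 9
  r4 : t 4 = t 5 - t 6 - t 7 + t 8 - t 9

/-- `Θ̃²` is the discriminant of the quadratic equation for `ω₀² - Θ₆²`. -/
theorem SquareRelations.discriminant {t : Fin 10 → ℂ} (h : SquareRelations t) :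
    1 / 12 * ((∑ s, t s ^ 2) ^ 2 - 4 * ∑ s, t s ^ 4) =
      (t 6 * t 7 - t 9 * t 4 + t 5 * t 8 - 2 * t 5 * t 7) ^ 2 - 4 * t 7 * t 5 * t 0 * t 1 := by
  simp only [Fin.sum_univ_succ, Fin.sum_univ_zero, Fin.succ_zero_eq_one, Fin.succ_one_eq_two]
  change 1 / 12 * ((t 0 ^ 2 + (t 1 ^ 2 + (t 2 ^ 2 + (t 3 ^ 2 + (t 4 ^ 2 + (t 5 ^ 2 + (t 6 ^ 2 +
    (t 7 ^ 2 + (t 8 ^ 2 + (t 9 ^ 2 + 0)))))))))) ^ 2 - 4 * (t 0 ^ 4 + (t 1 ^ 4 + (t 2 ^ 4 +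
    (t 3 ^ 4 + (t 4 ^ 4 + (t 5 ^ 4 + (t 6 ^ 4 + (t 7 ^ 4 + (t 8 ^ 4 + (t 9 ^ 4 + 0))))))))))) = _
  rw [h.r0, h.r1, h.r2, h.r3, h.r4]
  ring

/-- The quadratic polynomial in `x = ω₀² - Θ₆²` that comes out of the master equation. -/
theorem SquareRelations.quadratic {t : Fin 10 → ℂ} (h : SquareRelations t) (x : ℂ) :
    t 7 * x ^ 2 - (t 6 * t 7 - t 9 * t 4 + t 5 * t 8 - 2 * t 5 * t 7) * x + t 5 * t 0 * t 1 =
      (x + t 5) * (x + t 0) * (x + t 1) - x * (x + t 5 - t 6) * (x + t 5 - t 8) := by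
  rw [h.r0, h.r1, h.r4]
  ring

/-- The system of the ten master equations with the theta squares written out. -/
structure MasterSystem (t : Fin 10 → ℂ) (z : Fin 4 → ℂ) (w : ℂ) : Prop where
  e0 : (1 - z 0 * z 1 * (z 2 + z 3 + z 2 * z 3) - (z 0 + z 1) * z 0 * z 1 * z 2 * z 3) * w = t 7
  e1 : z 0 * z 1 * z 2 * (1 + z 0 * z 3) * w = t 4
  e2 : (1 - z 0 * z 1 * z 3) * w = t 8
  e3 : (1 + z 1) * z 0 * z 1 * z 2 * z 3 * w = -t 1
  e4 : (1 - z 0 * z 1 * z 2 * z 3) * w = t 5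
  e5 : z 0 * z 1 * z 2 * (1 + z 1 * z 3) * w = t 9
  e6 : z 0 * z 1 * z 3 * (1 + z 0 * z 2) * w = t 2
  e7 : (1 - z 0 * z 1 * z 2) * w = t 6
  e8 : (1 + z 0) * z 0 * z 1 * z 2 * z 3 * w = -t 0
  e9 : z 0 * z 1 * z 3 * (1 + z 1 * z 2) * w = t 3

/-- The nonvanishing of the denominators in the formulas for a solution. -/
theorem SquareRelations.denominators {t : Fin 10 → ℂ} (h : SquareRelations t) (ht : ∀ s, t s ≠ 0)
    {w : ℂ} (hq : w * (w - t 5 + t 0) * (w - t 5 + t 1) = (w - t 5) * (w - t 6) * (w - t 8)) :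
    w ≠ 0 ∧ w - t 5 ≠ 0 ∧ w - t 8 ≠ 0 ∧ t 2 + t 8 - w ≠ 0 ∧ t 3 + t 8 - w ≠ 0 := by
  have h0 := h.r0
  have h1 := h.r1
  have h2 := h.r2
  have h3 := h.r3
  have h4 := h.r4
  -- In each case one side of `hq` vanishes, and the linear relations turn the other side into a
  -- product of three theta squares, up to sign.
  refine ⟨fun H => ?_, fun H => ?_, fun H => ?_, fun H => ?_, fun H => ?_⟩
  · refine mul_ne_zero (mul_ne_zero (ht 5) (ht 6)) (ht 8) ?_
    rw [H] at hq
    linear_combination hq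
  · refine mul_ne_zero (mul_ne_zero (ht 5) (ht 0)) (ht 1) ?_
    obtain rfl : w = t 5 := by linear_combination H
    linear_combination hq
  · refine mul_ne_zero (mul_ne_zero (ht 8) (ht 2)) (ht 3) ?_
    obtain rfl : w = t 8 := by linear_combination H
    have e1 : t 8 - t 5 + t 0 = -t 2 := by linear_combination h0 + h2
    have e2 : t 8 - t 5 + t 1 = -t 3 := by linear_combination h1 + h3
    rw [e1, e2] at hq
    linear_combination hq
  · refine mul_ne_zero (mul_ne_zero (ht 0) (ht 2)) (ht 4) ?_
    have hw : w = t 5 - t 0 := by linear_combination -H + h0 + h2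
    have e1 : w - t 6 = t 4 := by linear_combination hw - h0 - h4
    have e2 : w - t 8 = t 2 := by linear_combination -H
    rw [e1, e2, hw] at hq
    linear_combination hq
  · refine mul_ne_zero (mul_ne_zero (ht 1) (ht 9)) (ht 3) ?_
    have hw : w = t 5 - t 1 := by linear_combination -H + h1 + h3
    have e1 : w - t 6 = t 9 := by linear_combination hw - h1
    have e2 : w - t 8 = t 3 := by linear_combination -H
    rw [e1, e2, hw] at hq
    linear_combination hq

/-- Every factor is a monomial in z and w, up to sign; both sides equal z₀³ z₁³ z₂² z₃² w³. -/
theorem MasterSystem.quadratic {t : Fin 10 → ℂ} {z : Fin 4 → ℂ} {w : ℂ} (m : MasterSystem t z w) :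
    w * (w - t 5 + t 0) * (w - t 5 + t 1) = (w - t 5) * (w - t 6) * (w - t 8) := by
  have e5 : w - t 5 = z 0 * z 1 * z 2 * z 3 * w := by linear_combination m.e4
  have e6 : w - t 6 = z 0 * z 1 * z 2 * w := by linear_combination m.e7
  have e8 : w - t 8 = z 0 * z 1 * z 3 * w := by linear_combination m.e2
  have e0 : w - t 5 + t 0 = -z 0 * (z 0 * z 1 * z 2 * z 3 * w) := by
    linear_combination e5 + m.e8
  have e1 : w - t 5 + t 1 = -z 1 * (z 0 * z 1 * z 2 * z 3 * w) := by
    linear_combination e5 + m.e3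
  rw [e0, e1, e5, e6, e8]
  ring

/-- The solutions of the master equations with nonvanishing theta squares. -/
theorem masterSystem_iff {t : Fin 10 → ℂ} (h : SquareRelations t) (ht : ∀ s, t s ≠ 0)
    (z : Fin 4 → ℂ) (w : ℂ) :
    MasterSystem t z w ↔
      z = ![(t 2 + t 8 - w) / (w - t 5), (t 3 + t 8 - w) / (w - t 5), (w - t 5) / (w - t 8),
        (w - t 5) ^ 2 * (w - t 8) / (w * (t 2 + t 8 - w) * (t 3 + t 8 - w))] ∧
      w * (w - t 5 + t 0) * (w - t 5 + t 1) = (w - t 5) * (w - t 6) * (w - t 8) := by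
  constructor
  · intro m
    have hq := m.quadratic
    refine ⟨?_, hq⟩
    obtain ⟨d1, d2, d3, d4, d5⟩ := h.denominators ht hq
    have e5 : w - t 5 = z 0 * z 1 * z 2 * z 3 * w := by linear_combination m.e4
    have e8 : w - t 8 = z 0 * z 1 * z 3 * w := by linear_combination m.e2
    have e0 : t 2 + t 8 - w = z 0 * (w - t 5) := by
      rw [e5]; linear_combination -m.e8 - e5 + h.r2 + h.r0
    have e1 : t 3 + t 8 - w = z 1 * (w - t 5) := by
      rw [e5]; linear_combination -m.e3 - e5 + h.r1 + h.r3
    have hz0 : z 0 ≠ 0 := left_ne_zero_of_mul (e0 ▸ d4)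
    have hz1 : z 1 ≠ 0 := left_ne_zero_of_mul (e1 ▸ d5)
    funext k
    fin_cases k
    · change z 0 = (t 2 + t 8 - w) / (w - t 5)
      rw [eq_div_iff d2, e0]
    · change z 1 = (t 3 + t 8 - w) / (w - t 5)
      rw [eq_div_iff d2, e1]
    · change z 2 = (w - t 5) / (w - t 8)
      rw [eq_div_iff d3, e5, e8]
      ring
    · change z 3 = (w - t 5) ^ 2 * (w - t 8) / (w * (t 2 + t 8 - w) * (t 3 + t 8 - w))
      rw [eq_div_iff (mul_ne_zero (mul_ne_zero d1 d4) d5), e0, e1, e8]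
      ring
  · rintro ⟨hz, hq⟩
    obtain ⟨d1, d2, d3, d4, d5⟩ := h.denominators ht hq
    have z0 : z 0 * (w - t 5) = t 2 + t 8 - w := by
      rw [hz]; exact div_mul_cancel₀ _ d2
    have z1 : z 1 * (w - t 5) = t 3 + t 8 - w := by
      rw [hz]; exact div_mul_cancel₀ _ d2
    have z2 : z 2 * (w - t 8) = w - t 5 := by
      rw [hz]; exact div_mul_cancel₀ _ d3
    have z3 : z 3 * (w * (t 2 + t 8 - w) * (t 3 + t 8 - w)) = (w - t 5) ^ 2 * (w - t 8) := by
      rw [hz]; exact div_mul_cancel₀ _ (mul_ne_zero (mul_ne_zero d1 d4) d5)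
    have k3 : z 0 * z 1 * z 3 * w = w - t 8 := by
      refine mul_left_cancel₀ (pow_ne_zero 2 d2) ?_
      rw [← z3, ← z0, ← z1]
      ring
    have k23 : z 0 * z 1 * z 2 * z 3 * w = w - t 5 := by
      linear_combination z 2 * k3 + z2
    -- Apart from the nonvanishing of denominators, the quadratic equation is needed only here: `k3`
    -- and `k23` follow from the formulas for z alone.
    have k2 : z 0 * z 1 * z 2 * w = w - t 6 := by
      refine mul_left_cancel₀ (mul_ne_zero d2 d3) ?_
      have hq' : w * (t 2 + t 8 - w) * (t 3 + t 8 - w) = (w - t 5) * (w - t 6) * (w - t 8) := by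
        rw [← hq, h.r0, h.r1, h.r2, h.r3]; ring
      rw [← z0, ← z1] at hq'
      refine mul_left_cancel₀ d2 ?_
      linear_combination (z 2 * (w - t 8)) * hq' +  ((w - t 5) * (w - t 6) * (w - t 8)) * z2
    constructor
    · linear_combination -k2 - k3 - k23 - (z 0 + z 1) * k23 - z0 - z1 - h.r2 - h.r3
    · linear_combination k2 + z 0 * k23 + z0 + h.r2 - h.r4
    · linear_combination -k3
    · linear_combination (1 + z 1) * k23 + z1 + h.r3 + h.r1
    · linear_combination -k23
    · linear_combination k2 + z 1 * k23 + z1 + h.r3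
    · linear_combination k3 + z 0 * k23 + z0
    · linear_combination -k2
    · linear_combination (1 + z 0) * k23 + z0 + h.r2 + h.r0
    · linear_combination k3 + z 1 * k23 + z1

/-- The quadratic equation for `ω₀²`, solved by a square root of its discriminant. -/
theorem SquareRelations.quadratic_iff {t : Fin 10 → ℂ} (h : SquareRelations t) (ht : t 7 ≠ 0)
    {r : ℂ} (hr : r ^ 2 = 1 / 12 * ((∑ s, t s ^ 2) ^ 2 - 4 * ∑ s, t s ^ 4)) (w : ℂ) :
    w * (w - t 5 + t 0) * (w - t 5 + t 1) = (w - t 5) * (w - t 6) * (w - t 8) ↔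
      w = 1 / (2 * t 7) * (t 6 * t 7 - t 9 * t 4 + t 5 * t 8 - r) ∨
      w = 1 / (2 * t 7) * (t 6 * t 7 - t 9 * t 4 + t 5 * t 8 - -r) := by
  have key := h.quadratic (w - t 5)
  rw [h.discriminant] at hr
  have e : ∀ y : ℂ, w = 1 / (2 * t 7) * y ↔ 2 * t 7 * w - y = 0 := by
    intro y
    rw [one_div, eq_inv_mul_iff_mul_eq₀ (mul_ne_zero two_ne_zero ht), sub_eq_zero]
  rw [e, e, ← mul_eq_zero, ← sub_eq_zero]
  have : (2 * t 7 * w - (t 6 * t 7 - t 9 * t 4 + t 5 * t 8 - r)) *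
      (2 * t 7 * w - (t 6 * t 7 - t 9 * t 4 + t 5 * t 8 - -r)) =
      4 * t 7 * (w * (w - t 5 + t 0) * (w - t 5 + t 1) - (w - t 5) * (w - t 6) * (w - t 8)) := by
    linear_combination -hr + 4 * t 7 * key
  rw [this, mul_eq_zero]
  exact ⟨fun H => Or.inr H, fun H => H.resolve_left (mul_ne_zero four_ne_zero ht)⟩

/-! ### The right-hand sides as signed theta squares -/

/-- The splitting that `rho` sends a splitting to. -/
def rhoIndex : Fin 10 → Fin 10 := ![7, 4, 8, 1, 5, 9, 2, 6, 0, 3]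

/-- The sign by which the bracket of the splitting moved by `rho` differs from a theta square. -/
def rhoSign : Fin 10 → ℤ := ![1, -1, -1, 1, -1, -1, 1, 1, -1, -1]

theorem bracketThetaSq_rho (s : Fin 10) (W : Mat) :
    bracketThetaSq (fun r => rho (word s r)) W = rhoSign s * theta (rhoIndex s) W ^ 2 := by
  have hsign : ∀ s : Fin 10, tripleSign (rho (word s 0)) (rho (word s 1)) (rho (word s 2)) *
      tripleSign (rho (word s 3)) (rho (word s 4)) (rho (word s 5)) = rhoSign s := by
    decide
  have hidx : ∀ s k : Fin 10,
      ((({rho (word s 0), rho (word s 1), rho (word s 2)} : Finset (Fin 6)) =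
          {word k 0, word k 1, word k 2} ∨
        ({rho (word s 0), rho (word s 1), rho (word s 2)} : Finset (Fin 6)) =
          {word k 3, word k 4, word k 5}) ↔ k = rhoIndex s) := by
    decide
  simp only [bracketThetaSq, hsign, hidx, Finset.sum_ite_eq', Finset.mem_univ, if_true]

theorem masterEq_iff (W : Mat) (z : Fin 4 → ℂ) (w : ℂ) :
    MasterEq W z w ↔ MasterSystem (fun s => theta s W ^ 2) z w := by
  unfold MasterEq
  simp only [bracketThetaSq_rho]
  constructor
  · intro h
    have h0 := h 0
    have h1 := h 1
    have h2 := h 2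
    have h3 := h 3
    have h4 := h 4
    have h5 := h 5
    have h6 := h 6
    have h7 := h 7
    have h8 := h 8
    have h9 := h 9
    simp only [Q, rhoSign, rhoIndex, Matrix.cons_val, Int.cast_one, Int.cast_neg, one_mul]
      at h0 h1 h2 h3 h4 h5 h6 h7 h8 h9
    constructor
    · linear_combination h0
    · linear_combination -h1
    · linear_combination -h2
    · linear_combination -h3
    · linear_combination -h4
    · linear_combination -h5
    · linear_combination h6
    · linear_combination h7
    · linear_combination h8
    · linear_combination -h9
  · intro m s
    fin_cases s <;> simp only [Q, rhoSign, rhoIndex, Matrix.cons_val, Int.cast_one, Int.cast_neg,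
      one_mul, Fin.reduceFinMk, Fin.zero_eta, Fin.isValue, Fin.mk_one]
    · linear_combination m.e0
    · linear_combination -m.e1
    · linear_combination -m.e2
    · linear_combination -m.e3
    · linear_combination -m.e4
    · linear_combination -m.e5
    · linear_combination m.e6
    · linear_combination m.e7
    · linear_combination m.e8
    · linear_combination -m.e9

/-- The solutions of the master equation at a point where no theta function vanishes. -/
theorem masterEq_solutions {W : Mat} (h : SquareRelations fun s => theta s W ^ 2)
    (ht : ∀ s, theta s W ≠ 0) {r : ℂ}
    (hr : r ^ 2 = 1 / 12 * ((∑ s, theta s W ^ 4) ^ 2 - 4 * ∑ s, theta s W ^ 8))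
    (z : Fin 4 → ℂ) (w : ℂ) :
    (MasterEq W z w ↔ z = zFormula W w ∧ (w = wFormula W r ∨ w = wFormula W (-r))) ∧
      ((w = wFormula W r ∨ w = wFormula W (-r)) → DenomsNeZero W w) := by
  have ht' : ∀ s, theta s W ^ 2 ≠ 0 := fun s => pow_ne_zero 2 (ht s)
  have hr' : r ^ 2 = 1 / 12 * ((∑ s, (theta s W ^ 2) ^ 2) ^ 2 - 4 * ∑ s, (theta s W ^ 2) ^ 4) := by
    simpa only [← pow_mul] using hr
  have hw := h.quadratic_iff (ht' 7) hr' w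
  refine ⟨?_, fun H => h.denominators ht' (hw.2 H)⟩
  rw [masterEq_iff, masterSystem_iff h ht']
  exact and_congr_right fun _ => hw

open Complex

/-! ### Terms of the theta series -/

/-- The lattice `ℤ[i]²`. -/
abbrev Lat : Type := Fin 2 → GaussianInt

/-- The embedding of `ℤ[i]²` into `ℂ²`. -/
noncomputable def Lat.toVec (n : Lat) : Fin 2 → ℂ := fun r => GaussianInt.toComplex (n r)

theorem Lat.toVec_add (m n : Lat) : (m + n).toVec = m.toVec + n.toVec := by
  funext r; simp [Lat.toVec]

theorem Lat.toVec_smul (c : GaussianInt) (m : Lat) :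
    (c • m).toVec = GaussianInt.toComplex c • m.toVec := by
  funext r; simp [Lat.toVec]

/-- The quadratic form `x† W x`. -/
noncomputable def qform (W : Mat) (x : Fin 2 → ℂ) : ℂ := star x ⬝ᵥ (W *ᵥ x)

/-- The character `exp (2 π i Re (b† x))`. -/
noncomputable def phase (b x : Fin 2 → ℂ) : ℂ := exp (Real.pi * I * (2 * ((star b ⬝ᵥ x).re : ℂ)))

/-- The terms of the theta series. -/
noncomputable def thetaTerm (a b : Fin 2 → ℂ) (W : Mat) (n : Lat) : ℂ :=
  exp (Real.pi * I * qform W (n.toVec + a)) * phase b n.toVec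

theorem hermTheta_eq_tsum (a b : Fin 2 → ℂ) (W : Mat) :
    hermTheta a b W = ∑' n : Lat, thetaTerm a b W n := by
  refine tsum_congr fun n => ?_
  rw [thetaTerm, phase, ← Complex.exp_add, ← mul_add]
  rfl

theorem phase_add_right (b x y : Fin 2 → ℂ) : phase b (x + y) = phase b x * phase b y := by
  rw [phase, phase, phase, ← Complex.exp_add, dotProduct_add, Complex.add_re]
  congr 1; push_cast; ring

theorem phase_add_left (b c x : Fin 2 → ℂ) : phase (b + c) x = phase b x * phase c x := by
  rw [phase, phase, phase, ← Complex.exp_add, star_add, add_dotProduct, Complex.add_re]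
  congr 1; push_cast; ring

theorem phase_smul_left (c : ℂ) (b x : Fin 2 → ℂ) : phase (c • b) x = phase b (star c • x) := by
  rw [phase, phase, star_smul, smul_dotProduct, dotProduct_smul]

theorem norm_phase (b x : Fin 2 → ℂ) : ‖phase b x‖ = 1 := by
  rw [phase, Complex.norm_exp]; simp

/-- The real part of a Gaussian integer is an integer, so the exponent lies in 2πiℤ. -/
theorem phase_lat (l n : Lat) : phase l.toVec n.toVec = 1 := by
  rw [phase, Complex.exp_eq_one_iff]
  refine ⟨(star (l 0) * n 0 + star (l 1) * n 1).re, ?_⟩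
  have : star l.toVec ⬝ᵥ n.toVec = GaussianInt.toComplex (star (l 0) * n 0 + star (l 1) * n 1) := by
    simp [dotProduct, Fin.sum_univ_two, Lat.toVec, GaussianInt.toComplex_star]
  rw [this, ← GaussianInt.intCast_re]
  push_cast
  ring

/-- The parallelogram law: scaling by (1 + i)/2 multiplies a Hermitian form by 1/2, which cancels
the usual factor 2. -/
theorem qform_parallelogram (W : Mat) {p q u v : Fin 2 → ℂ} (hu : p + q = (1 + I) • u)
    (hv : p - q = (1 + I) • v) : qform W p + qform W q = qform W u + qform W v := by
  have hp : p = ((1 + I) / 2) • (u + v) := by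
    funext r
    have h1 := congrFun hu r
    have h2 := congrFun hv r
    simp only [Pi.add_apply, Pi.sub_apply, Pi.smul_apply, smul_eq_mul] at h1 h2 ⊢
    linear_combination (h1 + h2) / 2
  have hq : q = ((1 + I) / 2) • (u - v) := by
    funext r
    have h1 := congrFun hu r
    have h2 := congrFun hv r
    simp only [Pi.add_apply, Pi.sub_apply, Pi.smul_apply, smul_eq_mul] at h1 h2 ⊢
    linear_combination (h1 - h2) / 2
  have hc : star ((1 + I) / 2) * ((1 + I) / 2) = 1 / 2 := by
    simp only [star_div₀, star_add, star_one, RCLike.star_def, Complex.conj_I, map_ofNat]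
    linear_combination (-1 / 4) * Complex.I_sq
  have hs : ∀ x : Fin 2 → ℂ, qform W (((1 + I) / 2) • x) = 1 / 2 * qform W x := by
    intro x
    rw [qform, qform, star_smul, smul_dotProduct, Matrix.mulVec_smul, dotProduct_smul,
      smul_eq_mul, smul_eq_mul, ← mul_assoc, hc]
  rw [hp, hq, hs, hs]
  simp only [qform, star_add, star_sub, Matrix.mulVec_add, Matrix.mulVec_sub, add_dotProduct,
    sub_dotProduct, dotProduct_add, dotProduct_sub]
  ring

/-! ### Transformations of the characteristics -/

theorem hermTheta_shift_right (a b : Fin 2 → ℂ) (l : Lat) (W : Mat) :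
    hermTheta a (b + l.toVec) W = hermTheta a b W := by
  rw [hermTheta_eq_tsum, hermTheta_eq_tsum]
  refine tsum_congr fun n => ?_
  rw [thetaTerm, phase_add_left, phase_lat, mul_one, thetaTerm]

theorem hermTheta_shift_left (a b : Fin 2 → ℂ) (l : Lat) (W : Mat) :
    phase b l.toVec * hermTheta (a + l.toVec) b W = hermTheta a b W := by
  rw [hermTheta_eq_tsum, hermTheta_eq_tsum, ← tsum_mul_left,
    ← (Equiv.addRight l).tsum_eq (thetaTerm a b W)]
  refine tsum_congr fun n => ?_
  rw [thetaTerm, thetaTerm, Equiv.coe_addRight, Lat.toVec_add, phase_add_right, add_right_comm,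
    ← add_assoc]
  ring

/-- Multiplication by `i` as a permutation of `ℤ[i]²`. -/
def Lat.mulI : Lat ≃ Lat where
  toFun n := (⟨0, 1⟩ : GaussianInt) • n
  invFun n := (⟨0, -1⟩ : GaussianInt) • n
  left_inv n := by
    dsimp only
    rw [smul_smul]; convert one_smul GaussianInt n using 2; decide
  right_inv n := by
    dsimp only
    rw [smul_smul]; convert one_smul GaussianInt n using 2; decide

theorem toComplex_I : GaussianInt.toComplex ⟨0, 1⟩ = I := by
  simp [GaussianInt.toComplex_def]

/-- The unit i permutes the lattice and preserves the form x† W x and the pairing b† x. -/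
theorem hermTheta_smul_I (a b : Fin 2 → ℂ) (W : Mat) :
    hermTheta (I • a) (I • b) W = hermTheta a b W := by
  rw [hermTheta_eq_tsum, hermTheta_eq_tsum, ← Lat.mulI.tsum_eq]
  refine tsum_congr fun n => ?_
  have hI : star I * I = 1 := by simp
  have h1 : (Lat.mulI n).toVec = I • n.toVec := by
    rw [← toComplex_I, ← Lat.toVec_smul]; rfl
  rw [thetaTerm, thetaTerm, h1, phase_smul_left, smul_smul, hI, one_smul, ← smul_add]
  congr 3
  rw [qform, star_smul, smul_dotProduct, Matrix.mulVec_smul, dotProduct_smul, smul_smul, hI,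
    one_smul, qform]

/-! ### The addition formula -/

/-- Every Gaussian integer is `i c + (1 + i) ν` for a unique digit `c ∈ {0, 1}`. -/
def gaussDigit : Fin 2 × GaussianInt ≃ GaussianInt where
  toFun p := (⟨0, (p.1 : ℕ)⟩ : GaussianInt) + ⟨1, 1⟩ * p.2
  invFun x := (Fin.ofNat 2 ((x.re + x.im) % 2).toNat,
    ⟨(x.re + x.im - (x.re + x.im) % 2) / 2, (x.im - x.re - (x.re + x.im) % 2) / 2⟩)
  left_inv := by
    rintro ⟨c, x, y⟩
    have hc : (c : ℕ) < 2 := c.2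
    refine Prod.ext (Fin.ext ?_) (Zsqrtd.ext ?_ ?_) <;> simp <;> omega
  right_inv := by
    rintro ⟨x, y⟩
    refine Zsqrtd.ext ?_ ?_ <;> simp <;> omega

/-- Every vector of `ℤ[i]²` is `i C + (1 + i) ν` for a unique `C ∈ {0, 1}²`. -/
def latDigit : (Fin 2 → Fin 2) × Lat ≃ Lat :=
  (Equiv.arrowProdEquivProdArrow (Fin 2) (fun _ => Fin 2) (fun _ => GaussianInt)).symm.trans
    (Equiv.piCongrRight fun _ => gaussDigit)

/-- The vector `(1 + i) / 2 · C`. -/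
noncomputable def halfVec (C : Fin 2 → Fin 2) : Fin 2 → ℂ := fun r => (1 + I) / 2 * ((C r : ℕ) : ℂ)

theorem toVec_latDigit (C : Fin 2 → Fin 2) (n : Lat) :
    (latDigit (C, n)).toVec = (1 + I) • halfVec C + (1 + I) • n.toVec := by
  funext r
  change GaussianInt.toComplex ((⟨0, ((C r : ℕ) : ℤ)⟩ : GaussianInt) + ⟨1, 1⟩ * n r) = _
  rw [map_add, map_mul, GaussianInt.toComplex_def₂, GaussianInt.toComplex_def₂ ⟨1, 1⟩]
  simp only [halfVec, Lat.toVec, Pi.add_apply, Pi.smul_apply, smul_eq_mul]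
  apply Complex.ext <;> simp <;> ring

/-- Each entry contributes exp (πi D (re + im)), and the parity of re + im is the class modulo 1 +
i. These phases are thus the characters of ℤ[i]² / (1 + i). -/
theorem phase_halfVec (D : Fin 2 → Fin 2) (m : Lat) :
    phase (halfVec D) m.toVec =
      ∏ r, if D r = 0 then 1 else if Even ((m r).re + (m r).im) then 1 else -1 := by
  have key : ∀ (d : Fin 2) (x : GaussianInt), exp (Real.pi * I * (2 *
      ((star ((1 + I) / 2 * ((d : ℕ) : ℂ)) * GaussianInt.toComplex x).re : ℂ))) =
      if d = 0 then 1 else if Even (x.re + x.im) then 1 else -1 := by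
    intro d x
    have h2 : ((star ((1 + I) / 2 * ((d : ℕ) : ℂ)) * GaussianInt.toComplex x).re) =
        ((d : ℕ) : ℝ) * (x.re + x.im) / 2 := by
      have : star ((1 + I) / 2 * ((d : ℕ) : ℂ)) = ((((d : ℕ) : ℝ) / 2 : ℝ) : ℂ) * (1 - I) := by
        simp only [star_mul', star_div₀, star_add, star_one, RCLike.star_def, Complex.conj_I,
          map_ofNat, map_natCast]
        push_cast
        ring
      rw [this, mul_assoc, Complex.re_ofReal_mul, GaussianInt.toComplex_def₂]
      simp
      ring
    rw [h2]
    have h3 : exp (Real.pi * I * ((x.re + x.im : ℤ) : ℂ)) = (-1) ^ (x.re + x.im) := by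
      rw [mul_comm, Complex.exp_int_mul, Complex.exp_pi_mul_I]
    fin_cases d
    · simp
    · simp only [Fin.mk_one, Fin.isValue, one_ne_zero, if_false]
      split_ifs with he
      · rw [he.neg_one_zpow] at h3
        rw [← h3]; congr 1; push_cast; ring
      · rw [(Int.not_even_iff_odd.1 he).neg_one_zpow] at h3
        rw [← h3]; congr 1; push_cast; ring
  rw [Fin.prod_univ_two, ← key, ← key, ← Complex.exp_add, phase]
  congr 1
  simp only [dotProduct, Fin.sum_univ_two, Complex.add_re, halfVec, Lat.toVec, Pi.star_apply]
  push_cast; ring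

/-- Orthogonality of characters on a group of order four: the sum detects divisibility by 1 + i. -/
theorem sum_phase_halfVec (m : Lat) :
    ∑ D, phase (halfVec D) m.toVec = if ∀ r, Even ((m r).re + (m r).im) then 4 else 0 := by
  simp only [phase_halfVec]
  have := Finset.prod_univ_sum (fun _ : Fin 2 => (Finset.univ : Finset (Fin 2)))
    (fun r d => if d = 0 then (1 : ℂ) else if Even ((m r).re + (m r).im) then 1 else -1)
  rw [Fintype.piFinset_univ] at this
  rw [← this]
  clear this
  simp only [Fin.sum_univ_two, Fin.prod_univ_two, Fin.forall_fin_two]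
  split_ifs <;> simp_all <;> norm_num

/-- For p = iC + (1 + i)n + k and q = k, the identity 2 = (1 + i)(1 - i) makes p + q, and not only p
- q, divisible by 1 + i up to a fixed shift. The quotients are the two new summation vectors. -/
theorem thetaTerm_mul_thetaTerm (a b : Fin 2 → ℂ) (W : Mat) (C : Fin 2 → Fin 2) (n k : Lat) :
    thetaTerm a b W (latDigit (C, n) + k) * thetaTerm a b W k =
      phase ((1 - I) • b) (halfVec C) *
        (thetaTerm ((1 - I) • a + halfVec C) ((1 - I) • b) W (n + (⟨1, -1⟩ : GaussianInt) • k) *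
          thetaTerm (halfVec C) 0 W n) := by
  have hs : star (1 - I) = 1 + I := by simp
  have hk : GaussianInt.toComplex ⟨1, -1⟩ = 1 - I := by simp [GaussianInt.toComplex_def, sub_eq_add_neg]
  have h2 : (1 + I) * (1 - I) = 2 := by linear_combination -Complex.I_sq
  have hq := qform_parallelogram W (p := (latDigit (C, n) + k).toVec + a) (q := k.toVec + a)
    (u := (n + (⟨1, -1⟩ : GaussianInt) • k).toVec + ((1 - I) • a + halfVec C))
    (v := n.toVec + halfVec C) (by
      rw [Lat.toVec_add, Lat.toVec_add, Lat.toVec_smul, toVec_latDigit, hk]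
      simp only [smul_add, smul_smul, h2]
      module) (by
      rw [Lat.toVec_add, toVec_latDigit]
      module)
  have hp : phase b (latDigit (C, n) + k).toVec * phase b k.toVec =
      phase ((1 - I) • b) (halfVec C) *
        phase ((1 - I) • b) (n + (⟨1, -1⟩ : GaussianInt) • k).toVec := by
    rw [phase_smul_left, phase_smul_left, hs, ← phase_add_right, ← phase_add_right]
    congr 1
    rw [Lat.toVec_add, Lat.toVec_add, Lat.toVec_smul, toVec_latDigit, hk]
    simp only [smul_add, smul_smul, h2]
    module
  have h0 : phase 0 n.toVec = 1 := by rw [phase]; simp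
  rw [thetaTerm, thetaTerm, thetaTerm, thetaTerm, h0, mul_one, mul_mul_mul_comm, hp,
    ← Complex.exp_add, ← mul_add, hq, mul_add, Complex.exp_add]
  ring

/-- The lattice vectors divisible by `1 + i`. -/
theorem even_iff_exists (x : GaussianInt) :
    Even (x.re + x.im) ↔ ∃ k : GaussianInt, x = (⟨1, -1⟩ : GaussianInt) * k := by
  constructor
  · rintro ⟨c, hc⟩
    refine ⟨⟨c - x.im, c⟩, Zsqrtd.ext ?_ ?_⟩ <;> simp <;> omega
  · rintro ⟨k, rfl⟩
    refine ⟨k.im, ?_⟩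
    simp
    ring

/-- The pairs `(latDigit (C, n) + k, k)` run through all pairs of lattice vectors. -/
def latPair : (Fin 2 → Fin 2) × (Lat × Lat) ≃ Lat × Lat where
  toFun p := (latDigit (p.1, p.2.1) + p.2.2, p.2.2)
  invFun p := ((latDigit.symm (p.1 - p.2)).1, ((latDigit.symm (p.1 - p.2)).2, p.2))
  left_inv := by
    rintro ⟨C, n, k⟩
    simp
  right_inv := by
    rintro ⟨p, q⟩
    simp

/-- The pairs (n + (1 - i)k, n) are exactly the pairs of lattice vectors congruent modulo 1 + i. The
sum over D selects them from the full double series of a product of two theta functions. -/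
theorem tsum_digit_class (a b : Fin 2 → ℂ) (W : Mat) (C : Fin 2 → Fin 2)
    (hsum : ∀ a b : Fin 2 → ℂ, Summable fun n => ‖thetaTerm a b W n‖) :
    4 * ∑' p : Lat × Lat, thetaTerm a b W (p.1 + (⟨1, -1⟩ : GaussianInt) • p.2) *
        thetaTerm (halfVec C) 0 W p.1 =
      ∑ D, hermTheta a (b + halfVec D) W * hermTheta (halfVec C) (halfVec D) W := by
  have hD : ∀ D, hermTheta a (b + halfVec D) W * hermTheta (halfVec C) (halfVec D) W =
      ∑' p : Lat × Lat, thetaTerm a (b + halfVec D) W p.1 *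
        thetaTerm (halfVec C) (halfVec D) W p.2 := fun D => by
    rw [hermTheta_eq_tsum, hermTheta_eq_tsum]
    exact tsum_mul_tsum_of_summable_norm (hsum _ _) (hsum _ _)
  simp only [hD]
  rw [← Summable.tsum_finsetSum fun D _ => summable_mul_of_summable_norm (hsum _ _) (hsum _ _)]
  have hterm : ∀ p : Lat × Lat, ∑ D, thetaTerm a (b + halfVec D) W p.1 *
      thetaTerm (halfVec C) (halfVec D) W p.2 =
      if ∀ r, Even (((p.1 + p.2) r).re + ((p.1 + p.2) r).im) then
        4 * (thetaTerm a b W p.1 * thetaTerm (halfVec C) 0 W p.2) else 0 := fun p => by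
    have h0 : phase 0 p.2.toVec = 1 := by rw [phase]; simp
    have : ∀ D, thetaTerm a (b + halfVec D) W p.1 * thetaTerm (halfVec C) (halfVec D) W p.2 =
        thetaTerm a b W p.1 * thetaTerm (halfVec C) 0 W p.2 *
          phase (halfVec D) (p.1 + p.2).toVec := fun D => by
      rw [thetaTerm, thetaTerm, thetaTerm, thetaTerm, h0, phase_add_left, Lat.toVec_add,
        phase_add_right]
      ring
    simp only [this]
    rw [← Finset.mul_sum, sum_phase_halfVec, mul_ite, mul_zero, mul_comm]
  simp only [hterm]
  have hinj : Function.Injective fun p : Lat × Lat =>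
      (p.1 + (⟨1, -1⟩ : GaussianInt) • p.2, p.1) := by
    rintro ⟨n, k⟩ ⟨n', k'⟩ h
    obtain ⟨h1, rfl⟩ := Prod.ext_iff.1 h
    have h2 := add_left_cancel h1
    refine Prod.ext rfl (funext fun r => ?_)
    have h3 := congrFun h2 r
    exact mul_left_cancel₀ (by decide) h3
  rw [← tsum_mul_left]
  refine Eq.trans (tsum_congr fun p => ?_) (hinj.tsum_eq ?_)
  · dsimp only
    rw [if_pos]
    intro r
    have : Even (((⟨1, -1⟩ : GaussianInt) * p.2 r).re + ((⟨1, -1⟩ : GaussianInt) * p.2 r).im) :=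
      (even_iff_exists _).2 ⟨_, rfl⟩
    simp only [Pi.add_apply, Pi.smul_apply, smul_eq_mul, Zsqrtd.re_add, Zsqrtd.im_add]
    obtain ⟨c, hc⟩ := this
    exact ⟨(p.1 r).re + (p.1 r).im + c, by linear_combination hc⟩
  · rintro ⟨m, n⟩ h
    rw [Function.mem_support] at h
    have hE : ∀ r, Even (((m + n) r).re + ((m + n) r).im) := by
      by_contra hc
      exact h (if_neg hc)
    have hk : ∀ r, ∃ k : GaussianInt, m r - n r = (⟨1, -1⟩ : GaussianInt) * k := fun r => by
      rw [← even_iff_exists]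
      obtain ⟨c, hc⟩ := hE r
      simp only [Pi.add_apply, Zsqrtd.re_add, Zsqrtd.im_add] at hc
      exact ⟨c - (n r).re - (n r).im, by
        simp only [Zsqrtd.re_sub, Zsqrtd.im_sub]; linear_combination hc⟩
    choose k hk using hk
    refine ⟨(n, k), Prod.ext (funext fun r => ?_) rfl⟩
    change n r + (⟨1, -1⟩ : GaussianInt) * k r = m r
    rw [← hk]; ring

/-- The addition formula for the square of a theta function. -/
theorem four_mul_hermTheta_sq (a b : Fin 2 → ℂ) (W : Mat)
    (hsum : ∀ a b : Fin 2 → ℂ, Summable fun n => ‖thetaTerm a b W n‖) :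
    4 * hermTheta a b W ^ 2 = ∑ C, phase ((1 - I) • b) (halfVec C) * ∑ D,
      hermTheta ((1 - I) • a + halfVec C) ((1 - I) • b + halfVec D) W *
        hermTheta (halfVec C) (halfVec D) W := by
  have h1 : hermTheta a b W ^ 2 = ∑' p : Lat × Lat, thetaTerm a b W p.1 * thetaTerm a b W p.2 := by
    rw [hermTheta_eq_tsum, sq]
    exact tsum_mul_tsum_of_summable_norm (hsum a b) (hsum a b)
  have hs : Summable fun p => thetaTerm a b W (latPair p).1 * thetaTerm a b W (latPair p).2 :=
    latPair.summable_iff.2 (summable_mul_of_summable_norm (hsum a b) (hsum a b))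
  have hl : ∀ C p, latPair (C, p) = (latDigit (C, p.1) + p.2, p.2) := fun _ _ => rfl
  rw [h1, ← latPair.tsum_eq, hs.tsum_prod, tsum_fintype, Finset.mul_sum]
  refine Finset.sum_congr rfl fun C _ => ?_
  rw [← tsum_digit_class _ _ W C hsum, mul_left_comm, ← tsum_mul_left]
  simp only [hl, thetaTerm_mul_thetaTerm, tsum_mul_left]

/-! ### Positivity and convergence -/

/-- The squared length of a vector of `ℂ²`. -/
noncomputable def sqLen (x : Fin 2 → ℂ) : ℝ := normSq (x 0) + normSq (x 1)

theorem sqLen_nonneg (x : Fin 2 → ℂ) : 0 ≤ sqLen x := add_nonneg (normSq_nonneg _) (normSq_nonneg _)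

theorem sqLen_pos {x : Fin 2 → ℂ} (hx : x ≠ 0) : 0 < sqLen x := by
  by_contra h
  have h0 := normSq_nonneg (x 0)
  have h1 := normSq_nonneg (x 1)
  rw [sqLen] at h
  have h2 : normSq (x 0) = 0 := by linarith
  have h3 : normSq (x 1) = 0 := by linarith
  refine hx (funext fun r => ?_)
  fin_cases r
  · exact normSq_eq_zero.1 h2
  · exact normSq_eq_zero.1 h3

theorem qform_eq (W : Mat) (x : Fin 2 → ℂ) : qform W x =
    W 0 0 * (star (x 0) * x 0) + W 0 1 * (star (x 0) * x 1) + W 1 0 * (star (x 1) * x 0) +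
      W 1 1 * (star (x 1) * x 1) := by
  simp only [qform, dotProduct, Matrix.mulVec, Fin.sum_univ_two, Pi.star_apply]
  ring

theorem imaginaryPart_isHermitian (W : Mat) : ((2 * I)⁻¹ • (W - Wᴴ)).IsHermitian := by
  rw [Matrix.IsHermitian, Matrix.conjTranspose_smul, Matrix.conjTranspose_sub,
    Matrix.conjTranspose_conjTranspose, ← neg_sub W, smul_neg, ← neg_smul]
  congr 1
  simp

theorem imaginaryPart_form (W : Mat) (x : Fin 2 → ℂ) :
    star x ⬝ᵥ (((2 * I)⁻¹ • (W - Wᴴ)) *ᵥ x) = ((qform W x).im : ℂ) := by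
  have h : star x ⬝ᵥ (Wᴴ *ᵥ x) = star (qform W x) := by
    rw [qform, Matrix.star_dotProduct, Matrix.star_mulVec, ← Matrix.dotProduct_mulVec,
      Matrix.conjTranspose_conjTranspose]
  rw [Matrix.smul_mulVec, dotProduct_smul, Matrix.sub_mulVec, dotProduct_sub, h, ← qform,
    smul_eq_mul, RCLike.star_def, Complex.sub_conj]
  push_cast
  field_simp

theorem mem_upperHalf_of_coercive {W : Mat} {δ : ℝ} (hδ : 0 < δ)
    (h : ∀ x, δ * sqLen x ≤ (qform W x).im) : W ∈ upperHalf := by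
  refine Matrix.posDef_iff_dotProduct_mulVec.2 ⟨imaginaryPart_isHermitian W, fun {x} hx => ?_⟩
  rw [imaginaryPart_form, ← Complex.ofReal_zero, Complex.real_lt_real]
  exact (mul_pos hδ (sqLen_pos hx)).trans_le (h x)

theorem qform_im (W : Mat) (x : Fin 2 → ℂ) : (qform W x).im =
    (W 0 0).im * normSq (x 0) + (W 1 1).im * normSq (x 1) +
      ((W 0 1 - star (W 1 0)) * (star (x 0) * x 1)).im := by
  rw [qform_eq]
  simp [normSq_apply, Complex.mul_im, Complex.mul_re]
  ring

/-- A binary Hermitian form with positive diagonal and positive determinant is coercive. -/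
theorem coercive_of_det_pos {W : Mat} (h0 : 0 < (W 0 0).im)
    (h1 : normSq (W 0 1 - star (W 1 0)) < 4 * ((W 0 0).im * (W 1 1).im)) :
    ∃ δ : ℝ, 0 < δ ∧ ∀ x, δ * sqLen x ≤ (qform W x).im := by
  set y := (W 0 0).im with hy
  set y' := (W 1 1).im with hy'
  set g := W 0 1 - star (W 1 0) with hg
  have hy0 : 0 < y' := by
    have := (normSq_nonneg g).trans_lt h1
    exact pos_of_mul_pos_right (by linarith : 0 < y * y') h0.le
  have hs : 0 < y + y' := add_pos h0 hy0
  -- With this δ one has 4(y - δ)(y' - δ) = |g|² + 4δ², so the form stays positive semidefinite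
  -- after subtracting δ from the diagonal.
  set δ := (4 * (y * y') - normSq g) / (4 * (y + y')) with hδ
  have hδ' : δ * (4 * (y + y')) = 4 * (y * y') - normSq g := div_mul_cancel₀ _ (by positivity)
  have hδ0 : 0 < δ := div_pos (by linarith) (by positivity)
  have hN := normSq_nonneg g
  have hA : 0 ≤ y - δ := by
    by_contra! h
    nlinarith [mul_pos (sub_pos.2 (sub_neg.1 h)) hs, mul_pos h0 h0]
  have hB : 0 ≤ y' - δ := by
    by_contra! h
    nlinarith [mul_pos (sub_pos.2 (sub_neg.1 h)) hs, mul_pos hy0 hy0]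
  have hAB : normSq g ≤ 4 * ((y - δ) * (y' - δ)) := by nlinarith [sq_nonneg δ]
  refine ⟨δ, hδ0, fun x => ?_⟩
  have him : |(g * (star (x 0) * x 1)).im| ≤
      (y - δ) * normSq (x 0) + (y' - δ) * normSq (x 1) := by
    refine (Complex.abs_im_le_norm _).trans ?_
    refine abs_le_of_sq_le_sq' ?_ (add_nonneg (mul_nonneg hA (normSq_nonneg _))
      (mul_nonneg hB (normSq_nonneg _))) |>.2
    have hsq : ‖g * (star (x 0) * x 1)‖ ^ 2 = normSq g * (normSq (x 0) * normSq (x 1)) := by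
      rw [← normSq_eq_norm_sq, map_mul, map_mul, RCLike.star_def, normSq_conj]
    rw [hsq]
    have := mul_le_mul_of_nonneg_right hAB (mul_nonneg (normSq_nonneg (x 0)) (normSq_nonneg (x 1)))
    nlinarith [sq_nonneg ((y - δ) * normSq (x 0) - (y' - δ) * normSq (x 1))]
  rw [qform_im, sqLen, ← hg, ← hy, ← hy']
  have := (abs_le.1 him).1
  linarith

theorem qform_im_pos {W : Mat} (hW : W ∈ upperHalf) {x : Fin 2 → ℂ} (hx : x ≠ 0) :
    0 < (qform W x).im := by
  have h := (Matrix.posDef_iff_dotProduct_mulVec.1 hW).2 hx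
  rwa [imaginaryPart_form, ← Complex.ofReal_zero, Complex.real_lt_real] at h

theorem exists_coercive {W : Mat} (hW : W ∈ upperHalf) :
    ∃ δ : ℝ, 0 < δ ∧ ∀ x, δ * sqLen x ≤ (qform W x).im := by
  have h0 : 0 < (W 0 0).im := by
    have h := qform_im_pos hW (x := ![1, 0]) fun h => one_ne_zero (congrFun h 0)
    simpa [qform_im] using h
  refine coercive_of_det_pos h0 ?_
  set g := W 0 1 - star (W 1 0) with hg
  -- At this vector the form takes the value y (4yy' - |g|²), with y, y' the imaginary parts of the
  -- diagonal entries; its positivity is the determinant condition.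
  have h := qform_im_pos hW (x := ![I * g, ((2 * (W 0 0).im : ℝ) : ℂ)]) fun h =>
    h0.ne' (by simpa using congrFun h 1)
  have hc : g * (star (I * g) * ((2 * (W 0 0).im : ℝ) : ℂ)) =
      ((-(2 * (W 0 0).im * normSq g) : ℝ) : ℂ) * I := by
    rw [star_mul', RCLike.star_def, Complex.conj_I]
    push_cast
    rw [Complex.normSq_eq_conj_mul_self]
    ring
  rw [qform_im, ← hg] at h
  simp only [Matrix.cons_val_zero, Matrix.cons_val_one, hc,
    Complex.im_ofReal_mul, Complex.I_im, mul_one, map_mul, Complex.normSq_I, one_mul,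
    Complex.normSq_ofReal] at h
  have : 0 < (W 0 0).im * (4 * ((W 0 0).im * (W 1 1).im) - normSq g) := by linarith
  linarith [pos_of_mul_pos_right this h0.le]

/-- Expanding the square bounds each term by exp(-cn² + 2c|s||n|), the majorant of the Jacobi theta
series. -/
theorem summable_int_gauss {c : ℝ} (hc : 0 < c) (s : ℝ) :
    Summable fun n : ℤ => Real.exp (-c * (n + s) ^ 2) := by
  have hp := Real.pi_pos
  refine (summable_pow_mul_jacobiTheta₂_term_bound (c * |s| / Real.pi)
    (div_pos hc hp) 0).of_nonneg_of_le (fun n => (Real.exp_pos _).le) fun n => ?_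
  rw [pow_zero, one_mul, Real.exp_le_exp]
  have h1 : -Real.pi * (c / Real.pi * (n : ℝ) ^ 2 - 2 * (c * |s| / Real.pi) * |(n : ℝ)|) =
      -c * (n : ℝ) ^ 2 + 2 * c * (|s| * |(n : ℝ)|) := by
    field_simp
    ring
  have h2 : -(|s| * |(n : ℝ)|) ≤ s * n := by rw [← abs_mul]; exact neg_abs_le _
  push_cast
  rw [h1]
  nlinarith [mul_nonneg hc.le (sq_nonneg s), mul_le_mul_of_nonneg_left h2 hc.le]

theorem summable_gaussianInt_gauss {c : ℝ} (hc : 0 < c) (s : ℂ) :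
    Summable fun x : GaussianInt => Real.exp (-c * normSq (GaussianInt.toComplex x + s)) := by
  let e : ℤ × ℤ ≃ GaussianInt := ⟨fun p => ⟨p.1, p.2⟩, fun x => (x.re, x.im), fun _ => rfl, fun _ => rfl⟩
  rw [← e.summable_iff]
  refine ((summable_int_gauss hc s.re).mul_of_nonneg (summable_int_gauss hc s.im)
    (fun _ => (Real.exp_pos _).le) (fun _ => (Real.exp_pos _).le)).congr fun p => ?_
  change _ = Real.exp (-c * normSq (GaussianInt.toComplex ⟨p.1, p.2⟩ + s))
  rw [← Real.exp_add, normSq_apply]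
  congr 1
  simp
  ring

theorem summable_lat_gauss {c : ℝ} (hc : 0 < c) (a : Fin 2 → ℂ) :
    Summable fun n : Lat => Real.exp (-c * sqLen (n.toVec + a)) := by
  rw [← (finTwoArrowEquiv GaussianInt).symm.summable_iff]
  refine ((summable_gaussianInt_gauss hc (a 0)).mul_of_nonneg (summable_gaussianInt_gauss hc (a 1))
    (fun _ => (Real.exp_pos _).le) (fun _ => (Real.exp_pos _).le)).congr fun p => ?_
  rw [← Real.exp_add, ← mul_add]
  rfl

theorem norm_thetaTerm (a b : Fin 2 → ℂ) (W : Mat) (n : Lat) :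
    ‖thetaTerm a b W n‖ = Real.exp (-Real.pi * (qform W (n.toVec + a)).im) := by
  rw [thetaTerm, norm_mul, norm_phase, mul_one, Complex.norm_exp]
  congr 1
  simp [Complex.mul_re]

theorem summable_thetaTerm {W : Mat} (hW : W ∈ upperHalf) (a b : Fin 2 → ℂ) :
    Summable fun n => ‖thetaTerm a b W n‖ := by
  obtain ⟨δ, hδ, h⟩ := exists_coercive hW
  refine (summable_lat_gauss (mul_pos Real.pi_pos hδ) a).of_nonneg_of_le
    (fun _ => norm_nonneg _) fun n => ?_
  rw [norm_thetaTerm, Real.exp_le_exp]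
  have := mul_le_mul_of_nonneg_left (h (n.toVec + a)) Real.pi_pos.le
  linarith

/-! ### Holomorphy -/

/-- `2 x 2` tables of entries, with the sup norm. -/
abbrev Tab : Type := Fin 2 → Fin 2 → ℂ

theorem norm_qform_le (v : Tab) (x : Fin 2 → ℂ) : ‖qform (Matrix.of v) x‖ ≤ 2 * sqLen x * ‖v‖ := by
  have hv : ∀ i j, ‖v i j‖ ≤ ‖v‖ := fun i j => (norm_le_pi_norm (v i) j).trans (norm_le_pi_norm v i)
  have ht : ∀ i j, ‖v i j * (star (x i) * x j)‖ ≤ ‖v‖ * (‖x i‖ * ‖x j‖) := fun i j => by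
    rw [norm_mul, norm_mul, norm_star]
    exact mul_le_mul_of_nonneg_right (hv i j) (by positivity)
  have hn : ‖qform (Matrix.of v) x‖ ≤ ‖v 0 0 * (star (x 0) * x 0)‖ + ‖v 0 1 * (star (x 0) * x 1)‖ +
      ‖v 1 0 * (star (x 1) * x 0)‖ + ‖v 1 1 * (star (x 1) * x 1)‖ := by
    rw [qform_eq]
    exact norm_add₄_le
  have h2 : sqLen x = ‖x 0‖ ^ 2 + ‖x 1‖ ^ 2 := by rw [sqLen, normSq_eq_norm_sq, normSq_eq_norm_sq]
  rw [h2]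
  nlinarith [ht 0 0, ht 0 1, ht 1 0, ht 1 1, mul_nonneg (norm_nonneg v) (sq_nonneg (‖x 0‖ - ‖x 1‖))]

/-- `v ↦ x† v x` as a continuous linear map. -/
noncomputable def qformCLM (x : Fin 2 → ℂ) : Tab →L[ℂ] ℂ :=
  LinearMap.mkContinuous
    { toFun := fun v => qform (Matrix.of v) x
      map_add' := fun v w => by
        simp only [qform_eq, Matrix.of_apply, Pi.add_apply]; ring
      map_smul' := fun c v => by
        simp only [qform_eq, Matrix.of_apply, Pi.smul_apply, smul_eq_mul, RingHom.id_apply]; ring }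
    (2 * sqLen x) (fun v => norm_qform_le v x)

theorem norm_qformCLM_le (x : Fin 2 → ℂ) : ‖qformCLM x‖ ≤ 2 * sqLen x :=
  LinearMap.mkContinuous_norm_le _ (mul_nonneg zero_le_two (sqLen_nonneg x)) _

theorem coercive_near {W : Mat} {δ : ℝ} (h : ∀ x, δ * sqLen x ≤ (qform W x).im) {v : Tab}
    (hv : ‖v - Matrix.of.symm W‖ ≤ δ / 4) (x : Fin 2 → ℂ) :
    δ / 2 * sqLen x ≤ (qform (Matrix.of v) x).im := by
  have h1 : qform (Matrix.of v) x = qform W x + qform (Matrix.of (v - Matrix.of.symm W)) x := by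
    simp only [qform_eq, Matrix.of_apply, Pi.sub_apply, Matrix.of_symm_apply]; ring
  have h2 := (Complex.abs_im_le_norm _).trans (norm_qform_le (v - Matrix.of.symm W) x)
  have h3 := mul_le_mul_of_nonneg_left hv (mul_nonneg zero_le_two (sqLen_nonneg x))
  rw [h1, Complex.add_im]
  have h4 := (abs_le.1 h2).1
  have h5 := h x
  linarith

/-- The coercivity constant survives on a small ball, so the series may be differentiated term by
term against a Gaussian majorant. -/
theorem differentiableOn_hermTheta (a b : Fin 2 → ℂ) :
    HolomorphicOn (hermTheta a b) upperHalf := by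
  intro v₀ hv₀
  obtain ⟨δ, hδ, h⟩ := exists_coercive hv₀
  have hp := Real.pi_pos
  have hball : ∀ v ∈ Metric.ball v₀ (δ / 4), ∀ x, δ / 2 * sqLen x ≤ (qform (Matrix.of v) x).im :=
    fun v hv x => by
      rw [Metric.mem_ball, dist_eq_norm] at hv
      exact coercive_near h hv.le x
  have hterm : ∀ n : Lat, ∀ v ∈ Metric.ball v₀ (δ / 4),
      ‖thetaTerm a b (Matrix.of v) n‖ ≤
        Real.exp (-(Real.pi * (δ / 2)) * sqLen (n.toVec + a)) := fun n v hv => by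
    rw [norm_thetaTerm, Real.exp_le_exp]
    have := mul_le_mul_of_nonneg_left (hball v hv (n.toVec + a)) hp.le
    linarith
  have hderiv : ∀ n : Lat, ∀ v ∈ Metric.ball v₀ (δ / 4),
      HasFDerivAt (fun v => thetaTerm a b (Matrix.of v) n)
        (thetaTerm a b (Matrix.of v) n • ((Real.pi * I : ℂ) • qformCLM (n.toVec + a))) v :=
    fun n v _ => by
      have h1 : HasFDerivAt (fun v : Tab => Real.pi * I * qform (Matrix.of v) (n.toVec + a))
          ((Real.pi * I : ℂ) • qformCLM (n.toVec + a)) v :=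
        ((Real.pi * I : ℂ) • qformCLM (n.toVec + a)).hasFDerivAt
      have h2 := h1.cexp.mul_const (phase b n.toVec)
      refine h2.congr_fderiv ?_
      rw [smul_smul, thetaTerm, mul_comm]
  have hc : 0 < Real.pi * (δ / 4) := by positivity
  have hbound : ∀ n : Lat, ∀ v ∈ Metric.ball v₀ (δ / 4),
      ‖thetaTerm a b (Matrix.of v) n • ((Real.pi * I : ℂ) • qformCLM (n.toVec + a))‖ ≤
        (8 / δ) * Real.exp (-(Real.pi * (δ / 4)) * sqLen (n.toVec + a)) := fun n v hv => by
    set s := sqLen (n.toVec + a) with hs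
    have hs0 : 0 ≤ s := sqLen_nonneg _
    rw [norm_smul, norm_smul]
    have hpi : ‖(Real.pi * I : ℂ)‖ = Real.pi := by simp [abs_of_pos hp]
    rw [hpi]
    have h1 : Real.pi * ‖qformCLM (n.toVec + a)‖ ≤ Real.pi * (2 * s) :=
      mul_le_mul_of_nonneg_left (norm_qformCLM_le _) hp.le
    have h2 : Real.pi * (δ / 4) * s ≤ Real.exp (Real.pi * (δ / 4) * s) := by
      linarith [Real.add_one_le_exp (Real.pi * (δ / 4) * s)]
    -- The factor linear in s that differentiation produces is absorbed by giving up half of the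
    -- decay exp(-πδs/2).
    have h3 : Real.pi * (2 * s) ≤ 8 / δ * Real.exp (Real.pi * (δ / 4) * s) := by
      calc Real.pi * (2 * s) = 8 / δ * (Real.pi * (δ / 4) * s) := by field_simp; ring
        _ ≤ _ := mul_le_mul_of_nonneg_left h2 (by positivity)
    calc _ ≤ Real.exp (-(Real.pi * (δ / 2)) * s) * (8 / δ * Real.exp (Real.pi * (δ / 4) * s)) :=
          mul_le_mul (hterm n v hv) (h1.trans h3) (by positivity) (Real.exp_pos _).le
      _ = 8 / δ * Real.exp (-(Real.pi * (δ / 4)) * s) := by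
          rw [mul_left_comm, ← Real.exp_add]
          congr 2
          ring
  have hv : v₀ ∈ Metric.ball v₀ (δ / 4) := Metric.mem_ball_self (by positivity)
  have hfd := hasFDerivAt_tsum_of_isPreconnected ((summable_lat_gauss hc a).mul_left (8 / δ))
    Metric.isOpen_ball (convex_ball v₀ (δ / 4)).isPreconnected hderiv hbound hv
    (summable_thetaTerm hv₀ a b).of_norm hv
  have he : (fun v : Tab => hermTheta a b (Matrix.of v)) =
      fun v => ∑' n : Lat, thetaTerm a b (Matrix.of v) n := funext fun v => hermTheta_eq_tsum a b _
  rw [he]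
  exact hfd.differentiableAt.differentiableWithinAt

/-! ### Relations between the theta functions -/

/-- The theta function with characteristics `(1 + i) / 2 · A` and `(1 + i) / 2 · B`. -/
noncomputable def bitTheta (A B : Fin 2 → Fin 2) (W : Mat) : ℂ :=
  hermTheta (halfVec A) (halfVec B) W

/-- A vector of digits as a lattice vector. -/
def bitLat (A : Fin 2 → Fin 2) : Lat := fun r => ⟨(A r : ℕ), 0⟩

theorem exp_pi_two_re {z : ℂ} {k : ℕ} (h : 2 * z.re = k) :
    exp (Real.pi * I * (2 * (z.re : ℂ))) = (-1) ^ k := by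
  rw [← Complex.ofReal_ofNat, ← Complex.ofReal_mul, h, Complex.ofReal_natCast, mul_comm,
    Complex.exp_nat_mul, Complex.exp_pi_mul_I]

theorem phase_halfVec_bitLat (A B : Fin 2 → Fin 2) :
    phase (halfVec B) (bitLat A).toVec = (-1) ^ ((B 0 : ℕ) * A 0 + B 1 * A 1) := by
  refine exp_pi_two_re ?_
  simp [dotProduct, Fin.sum_univ_two, halfVec, bitLat, Lat.toVec, GaussianInt.toComplex_def,
    Complex.mul_re]
  ring

theorem phase_bitLat_halfVec (A B : Fin 2 → Fin 2) :
    phase (bitLat B).toVec (halfVec A) = (-1) ^ ((B 0 : ℕ) * A 0 + B 1 * A 1) := by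
  refine exp_pi_two_re ?_
  simp [dotProduct, Fin.sum_univ_two, halfVec, bitLat, Lat.toVec, GaussianInt.toComplex_def,
    Complex.mul_re]
  ring

theorem hermTheta_shift_bit (A B D : Fin 2 → Fin 2) (W : Mat) :
    hermTheta ((bitLat A).toVec + halfVec B) (halfVec D) W =
      (-1) ^ ((D 0 : ℕ) * A 0 + D 1 * A 1) * bitTheta B D W := by
  have h := hermTheta_shift_left (halfVec B) (halfVec D) (bitLat A) W
  rw [phase_halfVec_bitLat] at h
  rw [bitTheta, ← h, ← mul_assoc, ← pow_add, Even.neg_one_pow ⟨_, rfl⟩, one_mul, add_comm]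

/-- Multiplying (1 + i)/2 · C by i changes it by the lattice vector C. Invariance under i then says
that the function equals itself times (-1)^(A·B), which is -1. -/
theorem bitTheta_eq_zero {A B : Fin 2 → Fin 2} (h : Odd ((B 0 : ℕ) * A 0 + B 1 * A 1)) (W : Mat) :
    bitTheta A B W = 0 := by
  have hI : ∀ C : Fin 2 → Fin 2, halfVec C = I • halfVec C + (bitLat C).toVec := fun C => by
    funext r
    simp only [halfVec, bitLat, Lat.toVec, Pi.add_apply, Pi.smul_apply, smul_eq_mul,
      GaussianInt.toComplex_def']
    push_cast
    linear_combination (-((C r : ℕ) : ℂ) / 2) * Complex.I_sq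
  have h1 := hermTheta_smul_I (halfVec A) (halfVec B) W
  have h2 := hermTheta_shift_right (I • halfVec A) (I • halfVec B) (bitLat B) W
  have h3 := hermTheta_shift_left (I • halfVec A) (halfVec B) (bitLat A) W
  rw [← hI] at h2
  rw [← hI, phase_halfVec_bitLat, h.neg_one_pow, h2, h1] at h3
  rw [bitTheta]
  linear_combination (-1 / 2) * h3

theorem one_sub_I_smul_halfVec (A : Fin 2 → Fin 2) :
    (1 - I) • halfVec A = (bitLat A).toVec := by
  funext r
  simp only [halfVec, bitLat, Lat.toVec, Pi.smul_apply, smul_eq_mul, GaussianInt.toComplex_def']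
  push_cast
  linear_combination (-((A r : ℕ) : ℂ) / 2) * Complex.I_sq

/-- Multiplication by 1 - i makes the characteristics integral, so in the addition formula both
factors of each product are the same theta function up to sign. -/
theorem four_mul_bitTheta_sq {W : Mat} (hW : W ∈ upperHalf) (A B : Fin 2 → Fin 2) :
    4 * bitTheta A B W ^ 2 = ∑ C : Fin 2 → Fin 2, ∑ D : Fin 2 → Fin 2,
      (-1) ^ ((B 0 : ℕ) * C 0 + B 1 * C 1 + (D 0 * A 0 + D 1 * A 1)) * bitTheta C D W ^ 2 := by
  rw [bitTheta, four_mul_hermTheta_sq _ _ _ (summable_thetaTerm hW)]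
  refine Finset.sum_congr rfl fun C _ => ?_
  rw [Finset.mul_sum]
  refine Finset.sum_congr rfl fun D _ => ?_
  rw [one_sub_I_smul_halfVec, one_sub_I_smul_halfVec, phase_bitLat_halfVec,
    add_comm (bitLat B).toVec, hermTheta_shift_right, hermTheta_shift_bit, pow_add, ← bitTheta]
  ring

/-- The vector with entries `1 / 2` and `i / 2` at the digits `1` and `0`. -/
noncomputable def quartVec (f : Fin 2 → Fin 2) : Fin 2 → ℂ := fun r => if f r = 0 then I / 2 else 1 / 2

/-- Both (1 - i)/2 and (1 - i)i/2 are congruent to (1 + i)/2 modulo ℤ[i], so adding them flips every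
digit of C. The choice `f` affects only the lattice vector, hence the sign. -/
theorem one_sub_I_smul_quartVec (f C : Fin 2 → Fin 2) : ∃ l : Lat,
    (1 - I) • quartVec f + halfVec C = halfVec (1 - C) + l.toVec ∧
      ∀ D, phase (halfVec D) l.toVec = (-1) ^ ((D 0 : ℕ) * f 0 + D 1 * f 1) := by
  refine ⟨fun r => ⟨(C r : ℕ), (C r : ℕ) - (f r : ℕ)⟩, ?_, fun D => ?_⟩
  · have key : ∀ f c : Fin 2, (1 - I) * (if f = 0 then I / 2 else 1 / 2) +
        (1 + I) / 2 * ((c : ℕ) : ℂ) = (1 + I) / 2 * ((1 - c : Fin 2) : ℕ) +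
        (((c : ℕ) : ℂ) + (((c : ℕ) : ℂ) - ((f : ℕ) : ℂ)) * I) := by
      intro f c
      fin_cases f <;> fin_cases c <;> simp <;> ring_nf <;> simp <;> ring
    funext r
    have := key (f r) (C r)
    simp only [Pi.add_apply, Pi.smul_apply, smul_eq_mul, quartVec, halfVec, Lat.toVec,
      GaussianInt.toComplex_def', Pi.sub_apply, Pi.one_apply]
    push_cast
    exact this
  · rw [phase]
    have h : 2 * (star (halfVec D) ⬝ᵥ Lat.toVec
        (fun r => (⟨(C r : ℕ), (C r : ℕ) - (f r : ℕ)⟩ : GaussianInt))).re =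
        ((2 * (((D 0 : ℕ) : ℤ) * (C 0 : ℕ) + (D 1 : ℕ) * (C 1 : ℕ)) -
          (((D 0 : ℕ) * f 0 + D 1 * f 1 : ℕ) : ℤ) : ℤ) : ℝ) := by
      simp [dotProduct, Fin.sum_univ_two, halfVec, Lat.toVec, GaussianInt.toComplex_def,
        Complex.mul_re]
      ring
    rw [← Complex.ofReal_ofNat, ← Complex.ofReal_mul, h, Complex.ofReal_intCast, mul_comm,
      Complex.exp_int_mul, Complex.exp_pi_mul_I, zpow_sub₀ (by norm_num), zpow_mul, zpow_natCast]
    rcases neg_one_pow_eq_or ℂ ((D 0 : ℕ) * f 0 + D 1 * f 1) with h | h <;> rw [h] <;> simp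

theorem phase_quartVec (g C : Fin 2 → Fin 2) : phase ((1 - I) • quartVec g) (halfVec C) =
    (-1) ^ ((C 0 : ℕ) * (1 - g) 0 + C 1 * (1 - g) 1) := by
  refine exp_pi_two_re ?_
  have key : ∀ g c : Fin 2, 2 * (star ((1 - I) * (if g = 0 then I / 2 else 1 / 2)) *
      ((1 + I) / 2 * ((c : ℕ) : ℂ))).re = ((c : ℕ) * (1 - g : Fin 2) : ℕ) := by
    intro g c
    fin_cases g <;> fin_cases c <;> norm_num [Complex.mul_re]
  rw [dotProduct, Fin.sum_univ_two, Complex.add_re, mul_add]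
  push_cast
  have h0 := key (g 0) (C 0)
  have h1 := key (g 1) (C 1)
  push_cast at h0 h1
  exact congrArg₂ (· + ·) h0 h1

/-- The theta functions whose squares are sums of products of two of the ten. -/
theorem four_mul_quartTheta_sq {W : Mat} (hW : W ∈ upperHalf) (f g : Fin 2 → Fin 2) :
    4 * hermTheta (quartVec f) (quartVec g) W ^ 2 = ∑ C : Fin 2 → Fin 2, ∑ D : Fin 2 → Fin 2,
      (-1) ^ ((C 0 : ℕ) * (1 - g) 0 + C 1 * (1 - g) 1 + ((1 - D) 0 * f 0 + (1 - D) 1 * f 1)) *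
        (bitTheta (1 - C) (1 - D) W * bitTheta C D W) := by
  rw [four_mul_hermTheta_sq _ _ _ (summable_thetaTerm hW)]
  refine Finset.sum_congr rfl fun C _ => ?_
  rw [Finset.mul_sum]
  refine Finset.sum_congr rfl fun D _ => ?_
  obtain ⟨l, hl, hl'⟩ := one_sub_I_smul_quartVec f C
  obtain ⟨l', hl2, -⟩ := one_sub_I_smul_quartVec g D
  have h := hermTheta_shift_left (halfVec (1 - C)) (halfVec (1 - D)) l W
  rw [hl'] at h
  rw [hl, hl2, hermTheta_shift_right, phase_quartVec, pow_add, bitTheta, ← h, bitTheta]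
  have h2 : ∀ k : ℕ, ((-1 : ℂ) ^ k) * (-1) ^ k = 1 := fun k => by
    rw [← pow_add, Even.neg_one_pow ⟨_, rfl⟩]
  linear_combination (-(-1) ^ ((C 0 : ℕ) * (1 - g) 0 + C 1 * (1 - g) 1) *
    hermTheta (halfVec (1 - C) + l.toVec) (halfVec (1 - D)) W *
    hermTheta (halfVec C) (halfVec D) W) * h2 (((1 - D) 0 : ℕ) * f 0 + (1 - D) 1 * f 1)

theorem sum_digits (F : (Fin 2 → Fin 2) → ℂ) :
    ∑ C, F C = F ![0, 0] + F ![0, 1] + F ![1, 0] + F ![1, 1] := by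
  rw [← (finTwoArrowEquiv (Fin 2)).symm.sum_comp, Fintype.sum_prod_type, Fin.sum_univ_two,
    Fin.sum_univ_two, Fin.sum_univ_two]
  simp only [finTwoArrowEquiv_symm_apply]
  ring

/-- The digits of the characteristic of the ten theta functions. -/
def charBits : Fin 10 → (Fin 2 → Fin 2) × (Fin 2 → Fin 2) :=
  ![(![1, 1], ![1, 1]), (![1, 1], ![0, 0]), (![1, 0], ![0, 0]), (![1, 0], ![0, 1]),
    (![0, 1], ![0, 0]), (![0, 0], ![0, 0]), (![0, 0], ![0, 1]), (![0, 0], ![1, 1]),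
    (![0, 0], ![1, 0]), (![0, 1], ![1, 0])]

theorem theta_eq_bitTheta (s : Fin 10) (W : Mat) :
    theta s W = bitTheta (charBits s).1 (charBits s).2 W := by
  rw [theta, bitTheta]
  congr 1 <;> funext r <;> fin_cases s <;> fin_cases r <;> simp [charVec, charBits, halfVec]

/-- Once the six odd functions are dropped, the addition formula reads 4t = Nt with a symmetric 10 ×
10 sign matrix N. Each relation is c·t = 0 for an eigenvector c of N with eigenvalue -2, since then
4c·t = -2c·t; this is the origin of the division by 6. -/
theorem squareRelations {W : Mat} (hW : W ∈ upperHalf) :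
    SquareRelations fun s => theta s W ^ 2 := by
  have h := fun s : Fin 10 => four_mul_bitTheta_sq hW (charBits s).1 (charBits s).2
  have h0 := h 0
  have h1 := h 1
  have h2 := h 2
  have h3 := h 3
  have h4 := h 4
  have h5 := h 5
  have h6 := h 6
  have h7 := h 7
  have h8 := h 8
  have h9 := h 9
  have z1 : bitTheta ![0, 1] ![0, 1] W = 0 := bitTheta_eq_zero (by decide) W
  have z2 : bitTheta ![0, 1] ![1, 1] W = 0 := bitTheta_eq_zero (by decide) W
  have z3 : bitTheta ![1, 0] ![1, 0] W = 0 := bitTheta_eq_zero (by decide) W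
  have z4 : bitTheta ![1, 0] ![1, 1] W = 0 := bitTheta_eq_zero (by decide) W
  have z5 : bitTheta ![1, 1] ![0, 1] W = 0 := bitTheta_eq_zero (by decide) W
  have z6 : bitTheta ![1, 1] ![1, 0] W = 0 := bitTheta_eq_zero (by decide) W
  simp only [sum_digits, charBits, Matrix.cons_val, z1, z2, z3, z4, z5, z6, Fin.val_zero,
    Fin.val_one, Fin.isValue] at h0 h1 h2 h3 h4 h5 h6 h7 h8 h9
  norm_num at h0 h1 h2 h3 h4 h5 h6 h7 h8 h9
  constructor <;> simp only [theta_eq_bitTheta, charBits, Matrix.cons_val]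
  · linear_combination (h0 - h7 + h8 - h9) / 6
  · linear_combination (h1 - h5 + h6 + h9) / 6
  · linear_combination (h2 - h5 + h7 + h9) / 6
  · linear_combination (h3 - h6 + h8 - h9) / 6
  · linear_combination (h4 - h5 + h6 + h7 - h8 + h9) / 6

/-- The product of two of the ten theta functions with complementary characteristics. -/
theorem two_mul_quartTheta_sq {W : Mat} (hW : W ∈ upperHalf) :
    2 * hermTheta (quartVec ![1, 1]) (quartVec ![0, 0]) W ^ 2 =
        theta 5 W * theta 0 W + theta 1 W * theta 7 W + theta 3 W * theta 9 W ∧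
      2 * hermTheta (quartVec ![1, 1]) (quartVec ![1, 1]) W ^ 2 =
        theta 5 W * theta 0 W + theta 1 W * theta 7 W - theta 3 W * theta 9 W ∧
      2 * hermTheta (quartVec ![1, 0]) (quartVec ![1, 0]) W ^ 2 =
        -(theta 5 W * theta 0 W) + theta 1 W * theta 7 W - theta 3 W * theta 9 W ∧
      2 * hermTheta (quartVec ![1, 0]) (quartVec ![0, 1]) W ^ 2 =
        -(theta 5 W * theta 0 W) + theta 1 W * theta 7 W + theta 3 W * theta 9 W := by
  have h0 := four_mul_quartTheta_sq hW ![1, 1] ![0, 0]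
  have h1 := four_mul_quartTheta_sq hW ![1, 1] ![1, 1]
  have h2 := four_mul_quartTheta_sq hW ![1, 0] ![1, 0]
  have h3 := four_mul_quartTheta_sq hW ![1, 0] ![0, 1]
  have z1 : bitTheta ![0, 1] ![0, 1] W = 0 := bitTheta_eq_zero (by decide) W
  have z2 : bitTheta ![0, 1] ![1, 1] W = 0 := bitTheta_eq_zero (by decide) W
  have z3 : bitTheta ![1, 0] ![1, 0] W = 0 := bitTheta_eq_zero (by decide) W
  have z4 : bitTheta ![1, 0] ![1, 1] W = 0 := bitTheta_eq_zero (by decide) W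
  have z5 : bitTheta ![1, 1] ![0, 1] W = 0 := bitTheta_eq_zero (by decide) W
  have z6 : bitTheta ![1, 1] ![1, 0] W = 0 := bitTheta_eq_zero (by decide) W
  have c0 : (1 - ![0, 0] : Fin 2 → Fin 2) = ![1, 1] := by decide
  have c1 : (1 - ![0, 1] : Fin 2 → Fin 2) = ![1, 0] := by decide
  have c2 : (1 - ![1, 0] : Fin 2 → Fin 2) = ![0, 1] := by decide
  have c3 : (1 - ![1, 1] : Fin 2 → Fin 2) = ![0, 0] := by decide
  simp only [sum_digits, c0, c1, c2, c3, Matrix.cons_val, z1, z2, z3, z4, z5, z6, Fin.val_zero,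
    Fin.val_one, Fin.isValue] at h0 h1 h2 h3
  norm_num at h0 h1 h2 h3
  simp only [theta_eq_bitTheta, charBits, Matrix.cons_val]
  refine ⟨?_, ?_, ?_, ?_⟩
  · linear_combination h0 / 2
  · linear_combination h1 / 2
  · linear_combination h2 / 2
  · linear_combination h3 / 2

/-- The product of four theta functions that is a square root of the discriminant. -/
noncomputable def thetaTilde (W : Mat) : ℂ :=
  4 * (hermTheta (quartVec ![1, 1]) (quartVec ![0, 0]) W *
    hermTheta (quartVec ![1, 1]) (quartVec ![1, 1]) W *
    hermTheta (quartVec ![1, 0]) (quartVec ![1, 0]) W *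
    hermTheta (quartVec ![1, 0]) (quartVec ![0, 1]) W)

/-- This makes the linear coefficient of the quadratic equation symmetric in the three complementary
pairs: it is Z² - X² - Y² with X² = t₅t₀, Y² = t₁t₇, Z² = t₃t₉. -/
theorem SquareRelations.trace {t : Fin 10 → ℂ} (h : SquareRelations t) :
    t 6 * t 7 - t 9 * t 4 + t 5 * t 8 - 2 * t 5 * t 7 = t 3 * t 9 - t 5 * t 0 - t 1 * t 7 := by
  rw [h.r0, h.r1, h.r3, h.r4]
  ring

/-- Heron's factorisation: (Z² - X² - Y²)² - 4X²Y² is the product of X + Y + Z, X + Y - Z, -X + Y -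
Z and -X + Y + Z, each of which is twice the square of a theta series. -/
theorem thetaTilde_sq {W : Mat} (hW : W ∈ upperHalf) :
    thetaTilde W ^ 2 = 1 / 12 * ((∑ s, theta s W ^ 4) ^ 2 - 4 * ∑ s, theta s W ^ 8) := by
  have h := squareRelations hW
  have hd := h.discriminant
  rw [h.trace] at hd
  simp only [← pow_mul] at hd
  obtain ⟨h0, h1, h2, h3⟩ := two_mul_quartTheta_sq hW
  rw [hd]
  have : thetaTilde W ^ 2 = (2 * hermTheta (quartVec ![1, 1]) (quartVec ![0, 0]) W ^ 2) *
    (2 * hermTheta (quartVec ![1, 1]) (quartVec ![1, 1]) W ^ 2) *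
    (2 * hermTheta (quartVec ![1, 0]) (quartVec ![1, 0]) W ^ 2) *
    (2 * hermTheta (quartVec ![1, 0]) (quartVec ![0, 1]) W ^ 2) := by
    rw [thetaTilde]; ring
  rw [this, h0, h1, h2, h3]
  ring

/-! ### Coordinates at the cusp and expansions of the theta functions -/

/-- Linear coordinates on the matrices, adapted to the cusp. -/
noncomputable def cuspLin (W : Mat) : Fin 4 → ℂ :=
  ![(W 0 1 - I * W 1 0) / (1 - I), (W 0 1 + I * W 1 0) / (1 + I),
    W 0 0 - (W 0 1 - I * W 1 0) / (1 - I) - (W 0 1 + I * W 1 0) / (1 + I),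
    W 1 1 - (W 0 1 - I * W 1 0) / (1 - I) - (W 0 1 + I * W 1 0) / (1 + I)]

/-- Fourth roots of the coordinates `q₃`, `q₄`, `-Q̃₄`, `-Q̃₃`. -/
noncomputable def root (k : Fin 4) (W : Mat) : ℂ := exp (Real.pi * I / 4 * cuspLin W k)

theorem root_ne_zero (k : Fin 4) (W : Mat) : root k W ≠ 0 := Complex.exp_ne_zero _

theorem root_pow_four (k : Fin 4) (W : Mat) : root k W ^ 4 = exp (Real.pi * I * cuspLin W k) := by
  rw [root, ← Complex.exp_nat_mul]
  congr 1
  push_cast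
  ring

theorem root_zero_pow (W : Mat) : root 0 W ^ 4 = q3 W := root_pow_four 0 W

theorem root_one_pow (W : Mat) : root 1 W ^ 4 = q4 W := root_pow_four 1 W

theorem root_two_pow (W : Mat) : root 2 W ^ 4 = q1 W / (q3 W * q4 W) := by
  rw [root_pow_four, q1, q3, q4, ← Complex.exp_add, ← Complex.exp_sub]
  congr 1
  simp only [cuspLin, Matrix.cons_val]
  ring

theorem root_three_pow (W : Mat) : root 3 W ^ 4 = q2 W / (q3 W * q4 W) := by
  rw [root_pow_four, q2, q3, q4, ← Complex.exp_add, ← Complex.exp_sub]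
  congr 1
  simp only [cuspLin, Matrix.cons_val]
  ring

/-- The exponents of the four roots in the term of a theta series at the vector `z / 2`. -/
def expo (z : Fin 4 → ℤ) : Fin 4 → ℤ :=
  ![z 0 ^ 2 + z 1 ^ 2 + z 2 ^ 2 + z 3 ^ 2 + (z 0 * z 2 + z 1 * z 3) + (z 0 * z 3 - z 1 * z 2),
    z 0 ^ 2 + z 1 ^ 2 + z 2 ^ 2 + z 3 ^ 2 + (z 0 * z 2 + z 1 * z 3) - (z 0 * z 3 - z 1 * z 2),
    z 0 ^ 2 + z 1 ^ 2, z 2 ^ 2 + z 3 ^ 2]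

/-- Half of an integral vector, as an element of `ℂ²`. -/
noncomputable def halfInt (z : Fin 4 → ℤ) : Fin 2 → ℂ := ![(z 0 + z 1 * I) / 2, (z 2 + z 3 * I) / 2]

theorem one_add_I_ne_zero : (1 + I : ℂ) ≠ 0 := fun h => by simpa using congrArg Complex.re h

theorem one_sub_I_ne_zero : (1 - I : ℂ) ≠ 0 := fun h => by simpa using congrArg Complex.re h

theorem cuspLin_zero (W : Mat) : cuspLin W 0 = (1 + I) / 2 * (W 0 1 - I * W 1 0) := by
  change (W 0 1 - I * W 1 0) / (1 - I) = _
  rw [div_eq_iff one_sub_I_ne_zero]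
  linear_combination (W 0 1 - I * W 1 0) / 2 * Complex.I_sq

theorem cuspLin_one (W : Mat) : cuspLin W 1 = (1 - I) / 2 * (W 0 1 + I * W 1 0) := by
  change (W 0 1 + I * W 1 0) / (1 + I) = _
  rw [div_eq_iff one_add_I_ne_zero]
  linear_combination (W 0 1 + I * W 1 0) / 2 * Complex.I_sq

theorem cuspLin_two (W : Mat) : cuspLin W 2 = W 0 0 - cuspLin W 0 - cuspLin W 1 := rfl

theorem cuspLin_three (W : Mat) : cuspLin W 3 = W 1 1 - cuspLin W 0 - cuspLin W 1 := rfl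

/-- Because of this diagonal form every term of the series is a monomial with integral exponents in
the four roots. -/
theorem qform_halfInt (W : Mat) (z : Fin 4 → ℤ) :
    qform W (halfInt z) = 1 / 4 * ∑ k, expo z k * cuspLin W k := by
  have hs : ∀ a b : ℤ, star (((a : ℂ) + b * I) / 2) = (a - b * I) / 2 := fun a b => by
    simp [sub_eq_add_neg]
  rw [qform_eq, Fin.sum_univ_four, cuspLin_two, cuspLin_three, cuspLin_zero, cuspLin_one]
  simp only [halfInt, Matrix.cons_val_zero, Matrix.cons_val_one, hs, expo, Matrix.cons_val]
  push_cast
  linear_combination (-(W 0 0 * z 1 ^ 2) + z 0 * z 2 * W 1 0 - z 1 * z 3 * W 0 1 -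
    z 3 ^ 2 * W 1 1) / 4 * Complex.I_sq

/-! ### The theta series as sums of monomials -/

/-- Quadruples of integers. -/
abbrev Quad : Type := (ℤ × ℤ) × (ℤ × ℤ)

/-- Quadruples of integers as lattice vectors. -/
def quadLat : Quad ≃ Lat where
  toFun p := ![⟨p.1.1, p.1.2⟩, ⟨p.2.1, p.2.2⟩]
  invFun n := (((n 0).re, (n 0).im), ((n 1).re, (n 1).im))
  left_inv _ := rfl
  right_inv n := by
    funext r; fin_cases r <;> rfl

theorem toVec_quadLat (p : Quad) :
    (quadLat p).toVec = ![p.1.1 + p.1.2 * I, p.2.1 + p.2.2 * I] := by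
  funext r
  fin_cases r
  · exact GaussianInt.toComplex_def' _ _
  · exact GaussianInt.toComplex_def' _ _

/-- The vector `2 p + α`. -/
def dbl (α : Fin 4 → ℤ) (p : Quad) : Fin 4 → ℤ :=
  ![2 * p.1.1 + α 0, 2 * p.1.2 + α 1, 2 * p.2.1 + α 2, 2 * p.2.2 + α 3]

theorem toVec_add_halfInt (α : Fin 4 → ℤ) (p : Quad) :
    (quadLat p).toVec + halfInt α = halfInt (dbl α p) := by
  rw [toVec_quadLat]
  funext r
  fin_cases r <;> simp [halfInt, dbl] <;> ring

/-- The monomial with given integral exponents in the four roots. -/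
noncomputable def monom (e : Fin 4 → ℤ) (W : Mat) : ℂ := ∏ k, root k W ^ e k

/-- The exponent of the sign of a term of a theta series. -/
def signExp (β : Fin 4 → ℤ) (p : Quad) : ℤ :=
  β 0 * p.1.1 + β 1 * p.1.2 + β 2 * p.2.1 + β 3 * p.2.2

theorem thetaTerm_halfInt (α β : Fin 4 → ℤ) (W : Mat) (p : Quad) :
    thetaTerm (halfInt α) (halfInt β) W (quadLat p) =
      (-1) ^ signExp β p * monom (expo (dbl α p)) W := by
  have h2 : phase (halfInt β) (quadLat p).toVec = (-1) ^ signExp β p := by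
    have h : 2 * (star (halfInt β) ⬝ᵥ (quadLat p).toVec).re = (signExp β p : ℤ) := by
      have hs : ∀ a b : ℤ, star (((a : ℂ) + b * I) / 2) = ⟨(a : ℝ) / 2, -((b : ℝ) / 2)⟩ := fun a b => by
        apply Complex.ext <;> simp [neg_div]
      rw [dotProduct, Fin.sum_univ_two, toVec_quadLat]
      simp only [Pi.star_apply, halfInt, Matrix.cons_val_zero, Matrix.cons_val_one, hs, signExp]
      simp [Complex.mul_re]
      ring
    rw [phase, ← Complex.ofReal_ofNat, ← Complex.ofReal_mul, h, Complex.ofReal_intCast, mul_comm,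
      Complex.exp_int_mul, Complex.exp_pi_mul_I]
  rw [thetaTerm, toVec_add_halfInt, h2, qform_halfInt, mul_comm, monom]
  congr 1
  simp only [root, ← Complex.exp_int_mul]
  rw [← Complex.exp_sum, Finset.mul_sum, Finset.mul_sum]
  congr 1
  refine Finset.sum_congr rfl fun k _ => ?_
  ring

theorem norm_monom (e : Fin 4 → ℤ) (W : Mat) : ‖monom e W‖ = ∏ k, ‖root k W‖ ^ e k := by
  simp only [monom, norm_prod, norm_zpow]

/-- The exponents of the last two roots alone already give a Gaussian majorant, so nothing is lost
by forgetting the extra powers of the first two. -/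
theorem expo_two_add_three (z : Fin 4 → ℤ) :
    ((expo z 2 + expo z 3 : ℤ) : ℝ) = 4 * sqLen (halfInt z) := by
  simp [expo, sqLen, halfInt, normSq_apply]
  ring

theorem summable_half_zpow (α : Fin 4 → ℤ) : Summable fun p : Quad =>
    ((1 / 2 : ℝ)) ^ (expo (dbl α p) 2 + expo (dbl α p) 3) := by
  have hl : 0 < 4 * Real.log 2 := by positivity
  refine ((quadLat.summable_iff).2 (summable_lat_gauss hl (halfInt α))).congr fun p => ?_
  rw [Function.comp_apply, toVec_add_halfInt, ← Real.rpow_intCast, expo_two_add_three, Real.rpow_def_of_pos (by norm_num),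
    one_div, Real.log_inv]
  congr 1
  ring

/-- A matrix whose coordinates at the cusp are small lies in the upper half space. -/
theorem mem_upperHalf_of_norm_root_lt {W : Mat} (h : ∀ k, ‖root k W‖ < 1) : W ∈ upperHalf := by
  have hp := Real.pi_pos
  have hpos : ∀ k, 0 < (cuspLin W k).im := fun k => by
    have h1 := h k
    have h2 : (Real.pi * I / 4 * cuspLin W k).re = -(Real.pi / 4 * (cuspLin W k).im) := by
      rw [show (Real.pi * I / 4 : ℂ) = ((Real.pi / 4 : ℝ) : ℂ) * I by push_cast; ring]
      rw [mul_assoc, Complex.re_ofReal_mul, Complex.I_mul_re]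
      ring
    rw [root, Complex.norm_exp, Real.exp_lt_one_iff, h2, neg_lt_zero] at h1
    exact pos_of_mul_pos_right h1 (by positivity)
  have hA : (cuspLin W 0).im = ((W 0 1 - star (W 1 0)).re + (W 0 1 - star (W 1 0)).im) / 2 := by
    rw [cuspLin_zero, show ((1 + I) / 2 : ℂ) = ⟨1 / 2, 1 / 2⟩ by apply Complex.ext <;> simp]
    simp [Complex.mul_im]
    ring
  have hB : (cuspLin W 1).im = ((W 0 1 - star (W 1 0)).im - (W 0 1 - star (W 1 0)).re) / 2 := by
    rw [cuspLin_one, show ((1 - I) / 2 : ℂ) = ⟨1 / 2, -(1 / 2)⟩ by apply Complex.ext <;> simp [neg_div]]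
    simp [Complex.mul_im]
    ring
  have hN : normSq (W 0 1 - star (W 1 0)) = 2 * ((cuspLin W 0).im ^ 2 + (cuspLin W 1).im ^ 2) := by
    rw [hA, hB, normSq_apply]
    ring
  have hC : (W 0 0).im = (cuspLin W 0).im + (cuspLin W 1).im + (cuspLin W 2).im := by
    rw [cuspLin_two, Complex.sub_im, Complex.sub_im]; ring
  have hD : (W 1 1).im = (cuspLin W 0).im + (cuspLin W 1).im + (cuspLin W 3).im := by
    rw [cuspLin_three, Complex.sub_im, Complex.sub_im]; ring
  have h0 := hpos 0
  have h1 := hpos 1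
  have h2 := hpos 2
  have h3 := hpos 3
  -- With a, b, c, d > 0 the imaginary parts of the four coordinates, the determinant condition is
  -- 2(a² + b²) < 4(a + b + c)(a + b + d).
  obtain ⟨δ, hδ, hc⟩ := coercive_of_det_pos (W := W) (by rw [hC]; positivity) (by
    rw [hN, hC, hD]
    nlinarith [mul_pos h0 h1, mul_pos h0 h2, mul_pos h0 h3, mul_pos h1 h2, mul_pos h1 h3,
      mul_pos h2 h3, mul_pos h0 h0, mul_pos h1 h1])
  exact mem_upperHalf_of_coercive hδ hc

/-- The monomial of exponent `e` is split off to measure the size of the remainder, while the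
surplus exponents of the last two roots, at base 1/2, keep the sum convergent uniformly in W. -/
theorem norm_monom_le {W : Mat} (hW : ∀ k, ‖root k W‖ ≤ 1 / 2) {e N : Fin 4 → ℤ}
    (h : ∀ k, e k ≤ N k) :
    ‖monom N W‖ ≤ (1 / 2 : ℝ) ^ (-e 2 - e 3) * ‖monom e W‖ * (1 / 2 : ℝ) ^ (N 2 + N 3) := by
  have hr : ∀ k, 0 < ‖root k W‖ := fun k => norm_pos_iff.2 (root_ne_zero k W)
  have hle : ∀ k, ‖root k W‖ ^ N k ≤ ‖root k W‖ ^ e k * (1 / 2 : ℝ) ^ (N k - e k) := fun k => by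
    obtain ⟨m, hm⟩ := Int.le.dest (h k)
    rw [← hm, zpow_add₀ (hr k).ne', add_sub_cancel_left, zpow_natCast, zpow_natCast]
    exact mul_le_mul_of_nonneg_left (pow_le_pow_left₀ (hr k).le (hW k) m) (zpow_pos (hr k) _).le
  have hle' : ∀ k, ‖root k W‖ ^ N k ≤ ‖root k W‖ ^ e k := fun k => by
    exact zpow_le_zpow_right_of_le_one₀ (hr k) ((hW k).trans (by norm_num)) (h k)
  rw [norm_monom, norm_monom, Fin.prod_univ_four, Fin.prod_univ_four]
  have h0 : ∀ k j, 0 < ‖root k W‖ ^ (j : ℤ) := fun k j => zpow_pos (hr k) j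
  calc _ ≤ ‖root 0 W‖ ^ e 0 * ‖root 1 W‖ ^ e 1 * (‖root 2 W‖ ^ e 2 * (1 / 2 : ℝ) ^ (N 2 - e 2)) *
        (‖root 3 W‖ ^ e 3 * (1 / 2 : ℝ) ^ (N 3 - e 3)) := by
        have p2 : (0 : ℝ) < (1 / 2 : ℝ) ^ (N 2 - e 2) := by positivity
        exact mul_le_mul (mul_le_mul (mul_le_mul (hle' 0) (hle' 1) (h0 _ _).le (h0 _ _).le) (hle 2)
          (h0 _ _).le (mul_pos (h0 _ _) (h0 _ _)).le) (hle 3) (h0 _ _).le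
          (mul_pos (mul_pos (h0 _ _) (h0 _ _)) (mul_pos (h0 _ _) p2)).le
    _ = _ := by
        rw [sub_eq_add_neg, sub_eq_add_neg, zpow_add₀ (by norm_num), zpow_add₀ (by norm_num),
          zpow_add₀ (by norm_num), sub_eq_add_neg, zpow_add₀ (by norm_num)]
        ring

/-- The minimal coordinates of a vector of a given parity. -/
def minCoord (a : ℤ) : Finset ℤ := if a = 0 then {0} else {-1, 0}

/-- The quadruples for which `2 p + α` has all its entries in `{-1, 0, 1}`. -/
def minQuad (α : Fin 4 → ℤ) : Finset Quad :=
  (minCoord (α 0) ×ˢ minCoord (α 1)) ×ˢ (minCoord (α 2) ×ˢ minCoord (α 3))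

/-- A theta series differs from the sum of its terms with minimal vectors by a multiple of the
monomials that divide all other terms. -/
theorem hermTheta_expansion (α β : Fin 4 → ℤ) (e e' : Fin 4 → ℤ)
    (h : ∀ p, p ∉ minQuad α → (∀ k, e k ≤ expo (dbl α p) k) ∨ ∀ k, e' k ≤ expo (dbl α p) k) :
    ∃ K : ℝ, ∀ W, (∀ k, ‖root k W‖ ≤ 1 / 2) →
      ‖hermTheta (halfInt α) (halfInt β) W -
        ∑ p ∈ minQuad α, (-1) ^ signExp β p * monom (expo (dbl α p)) W‖ ≤
          K * (‖monom e W‖ + ‖monom e' W‖) := by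
  set g : Quad → ℝ := fun p => (1 / 2 : ℝ) ^ (expo (dbl α p) 2 + expo (dbl α p) 3) with hg
  have hgs : Summable g := summable_half_zpow α
  have hg0 : ∀ p, 0 ≤ g p := fun p => by positivity
  set C : ℝ := (1 / 2 : ℝ) ^ (-e 2 - e 3) + (1 / 2 : ℝ) ^ (-e' 2 - e' 3) with hC
  refine ⟨C * ∑' p, g p, fun W hW => ?_⟩
  have hU : W ∈ upperHalf := mem_upperHalf_of_norm_root_lt fun k => (hW k).trans_lt (by norm_num)
  set f : Quad → ℂ := fun p => (-1) ^ signExp β p * monom (expo (dbl α p)) W with hf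
  have hfs : Summable f := by
    have := quadLat.summable_iff.2 (summable_thetaTerm hU (halfInt α) (halfInt β)).of_norm
    exact this.congr fun p => thetaTerm_halfInt α β W p
  have hsum : hermTheta (halfInt α) (halfInt β) W = ∑' p, f p := by
    rw [hermTheta_eq_tsum, ← quadLat.tsum_eq]
    exact tsum_congr fun p => thetaTerm_halfInt α β W p
  rw [hsum, ← hfs.sum_add_tsum_subtype_compl (minQuad α), add_sub_cancel_left]
  have hb : ∀ p : {p // p ∉ minQuad α}, ‖f p‖ ≤ C * (‖monom e W‖ + ‖monom e' W‖) * g p := fun p => by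
    have hn : ‖f p‖ = ‖monom (expo (dbl α p)) W‖ := by
      rw [hf, norm_mul, norm_zpow, norm_neg, norm_one, one_zpow, one_mul]
    have c1 : 0 ≤ (1 / 2 : ℝ) ^ (-e 2 - e 3) := by positivity
    have c2 : 0 ≤ (1 / 2 : ℝ) ^ (-e' 2 - e' 3) := by positivity
    have m1 := norm_nonneg (monom e W)
    have m2 := norm_nonneg (monom e' W)
    rw [hn]
    rcases h p p.2 with H | H
    · refine (norm_monom_le hW H).trans (mul_le_mul_of_nonneg_right ?_ (hg0 p))
      nlinarith [mul_nonneg c1 m2, mul_nonneg c2 m1, mul_nonneg c2 m2]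
    · refine (norm_monom_le hW H).trans (mul_le_mul_of_nonneg_right ?_ (hg0 p))
      nlinarith [mul_nonneg c1 m2, mul_nonneg c2 m1, mul_nonneg c1 m1]
  have hs : Summable fun p : {p // p ∉ minQuad α} => C * (‖monom e W‖ + ‖monom e' W‖) * g p :=
    (hgs.subtype _).mul_left _
  refine (tsum_of_norm_bounded hs.hasSum hb).trans ?_
  rw [tsum_mul_left]
  have hle : ∑' p : {p // p ∉ minQuad α}, g p ≤ ∑' p, g p := hgs.tsum_subtype_le _ _ hg0
  calc _ ≤ C * (‖monom e W‖ + ‖monom e' W‖) * ∑' p, g p :=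
        mul_le_mul_of_nonneg_left hle (by positivity)
    _ = _ := by ring

/-! ### Exponents of the terms with non-minimal vectors -/

/-- Each difference is half a sum of two squares. A large coordinate thus forces large exponents of
the first two roots as well. -/
theorem expo_le (z : Fin 4 → ℤ) : expo z 2 ≤ 2 * expo z 0 ∧ expo z 3 ≤ 2 * expo z 0 ∧
    expo z 2 ≤ 2 * expo z 1 ∧ expo z 3 ≤ 2 * expo z 1 := by
  simp only [expo, Matrix.cons_val]
  refine ⟨?_, ?_, ?_, ?_⟩
  · nlinarith [sq_nonneg (2 * z 2 + z 0 - z 1), sq_nonneg (2 * z 3 + z 0 + z 1)]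
  · nlinarith [sq_nonneg (2 * z 0 + z 2 + z 3), sq_nonneg (2 * z 1 + z 3 - z 2)]
  · nlinarith [sq_nonneg (2 * z 2 + z 0 + z 1), sq_nonneg (2 * z 3 - z 0 + z 1)]
  · nlinarith [sq_nonneg (2 * z 0 + z 2 - z 3), sq_nonneg (2 * z 1 + z 3 + z 2)]

theorem mem_minCoord {a n : ℤ} (ha : a = 0 ∨ a = 1) : n ∈ minCoord a ↔ ¬ 4 ≤ (2 * n + a) ^ 2 := by
  rcases ha with rfl | rfl
  · simp only [minCoord, if_true, Finset.mem_singleton, not_le]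
    constructor
    · rintro rfl; norm_num
    · intro h; by_contra hn
      rcases lt_or_gt_of_ne hn with h1 | h1 <;> nlinarith
  · simp only [minCoord, one_ne_zero, if_false, Finset.mem_insert, Finset.mem_singleton, not_le]
    constructor
    · rintro (rfl | rfl) <;> norm_num
    · intro h
      have h1 : -2 < n := by by_contra! hn; nlinarith
      have h2 : n < 1 := by by_contra! hn; nlinarith
      omega

theorem exists_four_le {α : Fin 4 → ℤ} (hα : ∀ i, α i = 0 ∨ α i = 1) {p : Quad}
    (hp : p ∉ minQuad α) : ∃ i, 4 ≤ dbl α p i ^ 2 := by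
  by_contra! h
  refine hp ?_
  simp only [minQuad, Finset.mem_product, mem_minCoord (hα _), not_le]
  exact ⟨⟨h 0, h 1⟩, ⟨h 2, h 3⟩⟩

theorem one_le_odd_sq (n : ℤ) : 1 ≤ (2 * n + 1) ^ 2 :=
  Int.add_one_le_iff.2 (sq_pos_of_ne_zero (by omega))

theorem nine_le_odd_sq {n : ℤ} (h : 4 ≤ (2 * n + 1) ^ 2) : 9 ≤ (2 * n + 1) ^ 2 := by
  rcases lt_or_ge n 1 with h1 | h1
  · have : n ≤ -2 := by by_contra! h2; nlinarith
    nlinarith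
  · nlinarith

/-- The bounds on the exponents of the terms with nonminimal vectors. -/
theorem le_expo_zero {p : Quad} (hp : p ∉ minQuad 0) (k : Fin 4) :
    (![4, 4, 0, 0] : Fin 4 → ℤ) k ≤ expo (dbl 0 p) k := by
  obtain ⟨b0, b1, b2, b3⟩ := expo_le (dbl 0 p)
  -- `expo_le` gives only the bound 2 for the first two exponents; divisibility by 4 raises it to 4.
  have h4 : ∀ k, ∃ m, expo (dbl 0 p) k = 4 * m := fun k =>
    ⟨expo ![p.1.1, p.1.2, p.2.1, p.2.2] k, by
      fin_cases k <;> simp [expo, dbl] <;> ring⟩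
  obtain ⟨m0, e0⟩ := h4 0
  obtain ⟨m1, e1⟩ := h4 1
  have hC : expo (dbl 0 p) 2 = dbl 0 p 0 ^ 2 + dbl 0 p 1 ^ 2 := rfl
  have hD : expo (dbl 0 p) 3 = dbl 0 p 2 ^ 2 + dbl 0 p 3 ^ 2 := rfl
  have n0 := sq_nonneg (dbl 0 p 0)
  have n1 := sq_nonneg (dbl 0 p 1)
  have n2 := sq_nonneg (dbl 0 p 2)
  have n3 := sq_nonneg (dbl 0 p 3)
  obtain ⟨i, hi⟩ := exists_four_le (fun _ => Or.inl rfl) hp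
  have hi' : 4 ≤ expo (dbl 0 p) 2 ∨ 4 ≤ expo (dbl 0 p) 3 := by
    fin_cases i
    · exact Or.inl (by rw [hC]; exact hi.trans (le_add_of_nonneg_right n1))
    · exact Or.inl (by rw [hC]; exact hi.trans (le_add_of_nonneg_left n0))
    · exact Or.inr (by rw [hD]; exact hi.trans (le_add_of_nonneg_right n3))
    · exact Or.inr (by rw [hD]; exact hi.trans (le_add_of_nonneg_left n2))
  have c0 : 0 ≤ expo (dbl 0 p) 2 := by rw [hC]; exact add_nonneg n0 n1
  have c1 : 0 ≤ expo (dbl 0 p) 3 := by rw [hD]; exact add_nonneg n2 n3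
  fin_cases k
  · change 4 ≤ expo (dbl 0 p) 0; omega
  · change 4 ≤ expo (dbl 0 p) 1; omega
  · exact c0
  · exact c1

/-- There are two alternatives because a non-minimal vector either has an odd coordinate of absolute
value at least 3 or a nonzero even one; these raise different exponents above the minimum (2, 2, 2,
0). -/
theorem le_expo_first {p : Quad} (hp : p ∉ minQuad ![1, 1, 0, 0]) :
    (∀ k, (![2, 2, 2, 4] : Fin 4 → ℤ) k ≤ expo (dbl ![1, 1, 0, 0] p) k) ∨
      ∀ k, (![2, 2, 6, 0] : Fin 4 → ℤ) k ≤ expo (dbl ![1, 1, 0, 0] p) k := by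
  set z := dbl ![1, 1, 0, 0] p with hz
  obtain ⟨b0, b1, b2, b3⟩ := expo_le z
  have hC : expo z 2 = z 0 ^ 2 + z 1 ^ 2 := rfl
  have hD : expo z 3 = z 2 ^ 2 + z 3 ^ 2 := rfl
  have n0 : 1 ≤ z 0 ^ 2 := one_le_odd_sq p.1.1
  have n1 : 1 ≤ z 1 ^ 2 := one_le_odd_sq p.1.2
  have n2 := sq_nonneg (z 2)
  have n3 := sq_nonneg (z 3)
  obtain ⟨i, hi⟩ := exists_four_le (by decide) hp
  rw [← hz] at hi
  have hi' : 10 ≤ expo z 2 ∨ 4 ≤ expo z 3 := by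
    fin_cases i
    · left; have := nine_le_odd_sq (n := p.1.1) hi; change 9 ≤ z 0 ^ 2 at this; linarith
    · left; have := nine_le_odd_sq (n := p.1.2) hi; change 9 ≤ z 1 ^ 2 at this; linarith
    · right; change 4 ≤ z 2 ^ 2 at hi; linarith
    · right; change 4 ≤ z 3 ^ 2 at hi; linarith
  rcases hi' with h | h
  · right
    intro k
    fin_cases k
    · change 2 ≤ expo z 0; linarith
    · change 2 ≤ expo z 1; linarith
    · change 6 ≤ expo z 2; linarith
    · change 0 ≤ expo z 3; linarith
  · left
    intro k
    fin_cases k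
    · change 2 ≤ expo z 0; linarith
    · change 2 ≤ expo z 1; linarith
    · change 2 ≤ expo z 2; linarith
    · exact h

theorem le_expo_second {p : Quad} (hp : p ∉ minQuad ![0, 0, 1, 1]) :
    (∀ k, (![2, 2, 4, 2] : Fin 4 → ℤ) k ≤ expo (dbl ![0, 0, 1, 1] p) k) ∨
      ∀ k, (![2, 2, 0, 6] : Fin 4 → ℤ) k ≤ expo (dbl ![0, 0, 1, 1] p) k := by
  set z := dbl ![0, 0, 1, 1] p with hz
  obtain ⟨b0, b1, b2, b3⟩ := expo_le z
  have hC : expo z 2 = z 0 ^ 2 + z 1 ^ 2 := rfl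
  have hD : expo z 3 = z 2 ^ 2 + z 3 ^ 2 := rfl
  have n2 : 1 ≤ z 2 ^ 2 := one_le_odd_sq p.2.1
  have n3 : 1 ≤ z 3 ^ 2 := one_le_odd_sq p.2.2
  have n0 := sq_nonneg (z 0)
  have n1 := sq_nonneg (z 1)
  obtain ⟨i, hi⟩ := exists_four_le (by decide) hp
  rw [← hz] at hi
  have hi' : 4 ≤ expo z 2 ∨ 10 ≤ expo z 3 := by
    fin_cases i
    · left; change 4 ≤ z 0 ^ 2 at hi; linarith
    · left; change 4 ≤ z 1 ^ 2 at hi; linarith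
    · right; have := nine_le_odd_sq (n := p.2.1) hi; change 9 ≤ z 2 ^ 2 at this; linarith
    · right; have := nine_le_odd_sq (n := p.2.2) hi; change 9 ≤ z 3 ^ 2 at this; linarith
  rcases hi' with h | h
  · left
    intro k
    fin_cases k
    · change 2 ≤ expo z 0; linarith
    · change 2 ≤ expo z 1; linarith
    · exact h
    · change 2 ≤ expo z 3; linarith
  · right
    intro k
    fin_cases k
    · change 2 ≤ expo z 0; linarith
    · change 2 ≤ expo z 1; linarith
    · change 0 ≤ expo z 2; linarith
    · change 6 ≤ expo z 3; linarith

/-- A coordinate of absolute value at least 3 gives 10 in one of the last two exponents, hence 5 in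
each of the first two, and these are even. -/
theorem le_expo_ones {p : Quad} (hp : p ∉ minQuad 1) (k : Fin 4) :
    (![6, 6, 2, 2] : Fin 4 → ℤ) k ≤ expo (dbl 1 p) k := by
  have h0 : ∃ m, expo (dbl 1 p) 0 = 2 * m :=
    ⟨2 * (p.1.1 ^ 2 + p.1.2 ^ 2 + p.2.1 ^ 2 + p.2.2 ^ 2 + p.1.1 + p.1.2 + p.2.1 + p.2.2 +
      (p.1.1 * p.2.1 + p.1.2 * p.2.2 + p.1.1 * p.2.2 - p.1.2 * p.2.1) + p.1.1 + p.2.2) + 3, by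
      simp only [expo, dbl, Matrix.cons_val, Pi.one_apply]; ring⟩
  have h1 : ∃ m, expo (dbl 1 p) 1 = 2 * m :=
    ⟨2 * (p.1.1 ^ 2 + p.1.2 ^ 2 + p.2.1 ^ 2 + p.2.2 ^ 2 + p.1.1 + p.1.2 + p.2.1 + p.2.2 +
      (p.1.1 * p.2.1 + p.1.2 * p.2.2 - p.1.1 * p.2.2 + p.1.2 * p.2.1) + p.1.2 + p.2.1) + 3, by
      simp only [expo, dbl, Matrix.cons_val, Pi.one_apply]; ring⟩
  set z := dbl 1 p with hz
  obtain ⟨b0, b1, b2, b3⟩ := expo_le z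
  obtain ⟨m0, e0⟩ := h0
  obtain ⟨m1, e1⟩ := h1
  have hC : expo z 2 = z 0 ^ 2 + z 1 ^ 2 := rfl
  have hD : expo z 3 = z 2 ^ 2 + z 3 ^ 2 := rfl
  have n0 : 1 ≤ z 0 ^ 2 := one_le_odd_sq p.1.1
  have n1 : 1 ≤ z 1 ^ 2 := one_le_odd_sq p.1.2
  have n2 : 1 ≤ z 2 ^ 2 := one_le_odd_sq p.2.1
  have n3 : 1 ≤ z 3 ^ 2 := one_le_odd_sq p.2.2
  obtain ⟨i, hi⟩ := exists_four_le (α := 1) (fun _ => Or.inr rfl) hp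
  rw [← hz] at hi
  have hi' : 10 ≤ expo z 2 ∨ 10 ≤ expo z 3 := by
    fin_cases i
    · left; have := nine_le_odd_sq (n := p.1.1) hi; change 9 ≤ z 0 ^ 2 at this; linarith
    · left; have := nine_le_odd_sq (n := p.1.2) hi; change 9 ≤ z 1 ^ 2 at this; linarith
    · right; have := nine_le_odd_sq (n := p.2.1) hi; change 9 ≤ z 2 ^ 2 at this; linarith
    · right; have := nine_le_odd_sq (n := p.2.2) hi; change 9 ≤ z 3 ^ 2 at this; linarith
  fin_cases k
  · change 6 ≤ expo z 0; omega
  · change 6 ≤ expo z 1; omega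
  · change 2 ≤ expo z 2; linarith
  · change 2 ≤ expo z 3; linarith

/-- A non-minimal coordinate gives 5 in one of the last two exponents; 3 is 5/2 rounded up. -/
theorem le_expo_real {p : Quad} (hp : p ∉ minQuad ![1, 0, 1, 0]) (k : Fin 4) :
    (![3, 3, 1, 1] : Fin 4 → ℤ) k ≤ expo (dbl ![1, 0, 1, 0] p) k := by
  set z := dbl ![1, 0, 1, 0] p with hz
  obtain ⟨b0, b1, b2, b3⟩ := expo_le z
  have hC : expo z 2 = z 0 ^ 2 + z 1 ^ 2 := rfl
  have hD : expo z 3 = z 2 ^ 2 + z 3 ^ 2 := rfl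
  have n0 : 1 ≤ z 0 ^ 2 := one_le_odd_sq p.1.1
  have n1 := sq_nonneg (z 1)
  have n2 : 1 ≤ z 2 ^ 2 := one_le_odd_sq p.2.1
  have n3 := sq_nonneg (z 3)
  obtain ⟨i, hi⟩ := exists_four_le (by decide) hp
  rw [← hz] at hi
  have hi' : 5 ≤ expo z 2 ∨ 5 ≤ expo z 3 := by
    fin_cases i
    · left; have := nine_le_odd_sq (n := p.1.1) hi; change 9 ≤ z 0 ^ 2 at this; linarith
    · left; change 4 ≤ z 1 ^ 2 at hi; linarith
    · right; have := nine_le_odd_sq (n := p.2.1) hi; change 9 ≤ z 2 ^ 2 at this; linarith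
    · right; change 4 ≤ z 3 ^ 2 at hi; linarith
  fin_cases k
  · change 3 ≤ expo z 0; omega
  · change 3 ≤ expo z 1; omega
  · change 1 ≤ expo z 2; linarith
  · change 1 ≤ expo z 3; linarith

theorem le_expo_mixed {p : Quad} (hp : p ∉ minQuad ![1, 0, 0, 1]) (k : Fin 4) :
    (![3, 3, 1, 1] : Fin 4 → ℤ) k ≤ expo (dbl ![1, 0, 0, 1] p) k := by
  set z := dbl ![1, 0, 0, 1] p with hz
  obtain ⟨b0, b1, b2, b3⟩ := expo_le z
  have hC : expo z 2 = z 0 ^ 2 + z 1 ^ 2 := rfl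
  have hD : expo z 3 = z 2 ^ 2 + z 3 ^ 2 := rfl
  have n0 : 1 ≤ z 0 ^ 2 := one_le_odd_sq p.1.1
  have n1 := sq_nonneg (z 1)
  have n2 := sq_nonneg (z 2)
  have n3 : 1 ≤ z 3 ^ 2 := one_le_odd_sq p.2.2
  obtain ⟨i, hi⟩ := exists_four_le (by decide) hp
  rw [← hz] at hi
  have hi' : 5 ≤ expo z 2 ∨ 5 ≤ expo z 3 := by
    fin_cases i
    · left; have := nine_le_odd_sq (n := p.1.1) hi; change 9 ≤ z 0 ^ 2 at this; linarith
    · left; change 4 ≤ z 1 ^ 2 at hi; linarith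
    · right; change 4 ≤ z 2 ^ 2 at hi; linarith
    · right; have := nine_le_odd_sq (n := p.2.2) hi; change 9 ≤ z 3 ^ 2 at this; linarith
  fin_cases k
  · change 3 ≤ expo z 0; omega
  · change 3 ≤ expo z 1; omega
  · change 1 ≤ expo z 2; linarith
  · change 1 ≤ expo z 3; linarith

/-! ### The minimal terms in closed form -/

/-- The sum of the terms of a theta series with minimal vectors. -/
noncomputable def leadSum (α β : Fin 4 → ℤ) (W : Mat) : ℂ :=
  ∑ p ∈ minQuad α, (-1) ^ signExp β p * monom (expo (dbl α p)) W

theorem leadSum_zero (β : Fin 4 → ℤ) (W : Mat) : leadSum 0 β W = 1 := by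
  simp [leadSum, minQuad, minCoord, monom, Fin.prod_univ_four, expo, dbl, signExp]

/-- The sixteen minimal vectors have all entries ±1 and fall into four groups of four, according to
the first two exponents, each of which is 2 or 6. -/
theorem leadSum_ones_zero (W : Mat) : leadSum 1 0 W =
    4 * (root 0 W * root 1 W * root 2 W * root 3 W) ^ 2 *
      (1 + root 0 W ^ 4 + root 1 W ^ 4 + root 0 W ^ 4 * root 1 W ^ 4) := by
  simp [leadSum, minQuad, minCoord, Finset.sum_product, monom, Fin.prod_univ_four, expo, dbl, signExp]
  ring

theorem leadSum_ones_ones (W : Mat) : leadSum 1 1 W =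
    4 * (root 0 W * root 1 W * root 2 W * root 3 W) ^ 2 *
      (1 - root 0 W ^ 4 - root 1 W ^ 4 + root 0 W ^ 4 * root 1 W ^ 4) := by
  simp [leadSum, minQuad, minCoord, Finset.sum_product, monom, Fin.prod_univ_four, expo, dbl, signExp]
  norm_num [zpow_ofNat]
  ring

theorem leadSum_first (W : Mat) : leadSum ![1, 1, 0, 0] 0 W =
    4 * (root 0 W * root 1 W * root 2 W) ^ 2 := by
  simp [leadSum, minQuad, minCoord, Finset.sum_product, monom, Fin.prod_univ_four, expo, dbl, signExp]
  ring

theorem leadSum_first_second (W : Mat) : leadSum ![1, 1, 0, 0] ![0, 0, 1, 1] W =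
    4 * (root 0 W * root 1 W * root 2 W) ^ 2 := by
  simp [leadSum, minQuad, minCoord, Finset.sum_product, monom, Fin.prod_univ_four, expo, dbl, signExp]
  ring

theorem leadSum_second (W : Mat) : leadSum ![0, 0, 1, 1] 0 W =
    4 * (root 0 W * root 1 W * root 3 W) ^ 2 := by
  simp [leadSum, minQuad, minCoord, Finset.sum_product, monom, Fin.prod_univ_four, expo, dbl, signExp]
  ring

theorem leadSum_second_first (W : Mat) : leadSum ![0, 0, 1, 1] ![1, 1, 0, 0] W =
    4 * (root 0 W * root 1 W * root 3 W) ^ 2 := by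
  simp [leadSum, minQuad, minCoord, Finset.sum_product, monom, Fin.prod_univ_four, expo, dbl, signExp]
  ring

theorem leadSum_real_imaginary (W : Mat) : leadSum ![1, 0, 1, 0] ![0, 1, 0, 1] W =
    2 * (root 0 W * root 1 W * root 2 W * root 3 W) * (1 + root 0 W ^ 2 * root 1 W ^ 2) := by
  simp [leadSum, minQuad, minCoord, Finset.sum_product, monom, Fin.prod_univ_four, expo, dbl, signExp]
  ring

theorem leadSum_real_real (W : Mat) : leadSum ![1, 0, 1, 0] ![1, 0, 1, 0] W =
    -2 * (root 0 W * root 1 W * root 2 W * root 3 W) * (1 - root 0 W ^ 2 * root 1 W ^ 2) := by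
  simp [leadSum, minQuad, minCoord, Finset.sum_product, monom, Fin.prod_univ_four, expo, dbl, signExp]
  ring

/-- The minimal vectors are (±1, 0, 0, ±1), and the character is the product of the two signs, which
also decides which of the first two roots has exponent 3. Together with the sum in
`leadSum_mixed_swap` this produces the factor q₃ - q₄ of Θ̃. -/
theorem leadSum_mixed (W : Mat) : leadSum ![1, 0, 0, 1] ![1, 0, 0, 1] W =
    2 * (root 0 W * root 1 W * root 2 W * root 3 W) * (root 0 W ^ 2 - root 1 W ^ 2) := by
  simp [leadSum, minQuad, minCoord, Finset.sum_product, monom, Fin.prod_univ_four, expo, dbl, signExp]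
  ring

theorem leadSum_mixed_swap (W : Mat) : leadSum ![1, 0, 0, 1] ![0, 1, 1, 0] W =
    2 * (root 0 W * root 1 W * root 2 W * root 3 W) * (root 0 W ^ 2 + root 1 W ^ 2) := by
  simp [leadSum, minQuad, minCoord, Finset.sum_product, monom, Fin.prod_univ_four, expo, dbl, signExp]
  ring

/-- Twice the characteristics of the ten theta functions, as integral vectors. -/
def charInt : Fin 10 → (Fin 4 → ℤ) × (Fin 4 → ℤ) :=
  ![(1, 1), (1, 0), (![1, 1, 0, 0], 0), (![1, 1, 0, 0], ![0, 0, 1, 1]), (![0, 0, 1, 1], 0), (0, 0),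
    (0, ![0, 0, 1, 1]), (0, 1), (0, ![1, 1, 0, 0]), (![0, 0, 1, 1], ![1, 1, 0, 0])]

theorem theta_eq_halfInt (s : Fin 10) (W : Mat) :
    theta s W = hermTheta (halfInt (charInt s).1) (halfInt (charInt s).2) W := by
  rw [theta]
  congr 1 <;> funext r <;> fin_cases s <;> fin_cases r <;> simp [charVec, charInt, halfInt]

theorem quartVec_eq_halfInt : quartVec ![1, 1] = halfInt ![1, 0, 1, 0] ∧
    quartVec ![0, 0] = halfInt ![0, 1, 0, 1] ∧ quartVec ![1, 0] = halfInt ![1, 0, 0, 1] ∧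
    quartVec ![0, 1] = halfInt ![0, 1, 1, 0] := by
  refine ⟨?_, ?_, ?_, ?_⟩ <;> funext r <;> fin_cases r <;> simp [quartVec, halfInt]

open Filter Asymptotics

/-! ### Asymptotics at the cusp -/

theorem norm_flatCoord (W : Mat) : ‖flatCoord W 0‖ = ‖root 1 W‖ ^ 4 ∧
    ‖flatCoord W 1‖ = ‖root 0 W‖ ^ 4 ∧ ‖flatCoord W 2‖ = ‖root 3 W‖ ^ 4 ∧
    ‖flatCoord W 3‖ = ‖root 2 W‖ ^ 4 := by
  simp only [← norm_pow, root_zero_pow, root_one_pow, root_two_pow, root_three_pow, flatCoord,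
    Matrix.cons_val, norm_neg, and_self]

theorem tendsto_flatCoord : Tendsto flatCoord cusp (𝓝 0) := tendsto_comap

theorem tendsto_root (k : Fin 4) : Tendsto (root k) cusp (𝓝 0) := by
  have h : ∀ j, Tendsto (fun W => ‖flatCoord W j‖) cusp (𝓝 0) := fun j =>
    tendsto_zero_iff_norm_tendsto_zero.1 ((continuous_apply j).tendsto' 0 0 rfl |>.comp tendsto_flatCoord)
  have h4 : Tendsto (fun W => ‖root k W‖ ^ 4) cusp (𝓝 0) := by
    fin_cases k
    · exact (h 1).congr fun W => (norm_flatCoord W).2.1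
    · exact (h 0).congr fun W => (norm_flatCoord W).1
    · exact (h 3).congr fun W => (norm_flatCoord W).2.2.2
    · exact (h 2).congr fun W => (norm_flatCoord W).2.2.1
  rw [tendsto_zero_iff_norm_tendsto_zero]
  have := h4.sqrt.sqrt
  rw [Real.sqrt_zero, Real.sqrt_zero] at this
  refine this.congr fun W => ?_
  rw [show ‖root k W‖ ^ 4 = (‖root k W‖ ^ 2) ^ 2 by ring, Real.sqrt_sq (by positivity),
    Real.sqrt_sq (norm_nonneg _)]

theorem eventually_norm_root_le : ∀ᶠ W in cusp, ∀ k, ‖root k W‖ ≤ 1 / 2 := by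
  rw [eventually_all]
  intro k
  have := (tendsto_root k).norm
  rw [norm_zero] at this
  exact this.eventually_le_const (by norm_num)

/-- The size of the coordinates `q₃, q₄`. -/
noncomputable def cuspSize (W : Mat) : ℝ := ‖q3 W‖ + ‖q4 W‖

theorem tendsto_q3 : Tendsto q3 cusp (𝓝 0) := by
  have := (tendsto_root 0).pow 4
  rw [zero_pow (by norm_num)] at this
  exact this.congr root_zero_pow

theorem tendsto_q4 : Tendsto q4 cusp (𝓝 0) := by
  have := (tendsto_root 1).pow 4
  rw [zero_pow (by norm_num)] at this
  exact this.congr root_one_pow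

theorem q3_isBigO : q3 =O[cusp] cuspSize :=
  .of_norm_le fun _ => le_add_of_nonneg_right (norm_nonneg _)

theorem q4_isBigO : q4 =O[cusp] cuspSize :=
  .of_norm_le fun _ => le_add_of_nonneg_left (norm_nonneg _)

/-- A function that tends to zero, times one of the order of `q₃, q₄`. -/
theorem isLittleO_mul {f g : Mat → ℂ} (hf : Tendsto f cusp (𝓝 0)) (hg : g =O[cusp] cuspSize) :
    (fun W => f W * g W) =o[cusp] cuspSize := by
  simpa using ((isLittleO_one_iff ℝ).2 hf).mul_isBigO hg

theorem isLittleO_mul_of_tendsto {f g : Mat → ℂ} {c : ℂ} (hf : Tendsto f cusp (𝓝 c))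
    (hg : g =o[cusp] cuspSize) : (fun W => f W * g W) =o[cusp] cuspSize := by
  simpa using (hf.isBigO_one ℝ).mul_isLittleO hg

theorem tendsto_cuspSize : Tendsto cuspSize cusp (𝓝 0) := by
  have := tendsto_q3.norm.add tendsto_q4.norm
  rw [norm_zero, add_zero] at this
  exact this

theorem tendsto_of_sub_isLittleO {f g : Mat → ℂ} {c : ℂ} (hg : Tendsto g cusp (𝓝 c))
    (h : (fun W => f W - g W) =o[cusp] cuspSize) : Tendsto f cusp (𝓝 c) := by
  have := (h.trans_tendsto tendsto_cuspSize).add hg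
  simpa using this

/-- The product of two expansions up to `o(|q₃| + |q₄|)`. -/
theorem mul_sub_mul_isLittleO {f g f₀ g₀ : Mat → ℂ} {c d : ℂ} (hf₀ : Tendsto f₀ cusp (𝓝 c))
    (hg₀ : Tendsto g₀ cusp (𝓝 d)) (hf : (fun W => f W - f₀ W) =o[cusp] cuspSize)
    (hg : (fun W => g W - g₀ W) =o[cusp] cuspSize) :
    (fun W => f W * g W - f₀ W * g₀ W) =o[cusp] cuspSize := by
  have h1 := isLittleO_mul_of_tendsto (tendsto_of_sub_isLittleO hg₀ hg) hf
  have h2 := isLittleO_mul_of_tendsto hf₀ hg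
  exact (h1.add h2).congr_left fun W => by ring

theorem monom_vec (a b c d : ℕ) (W : Mat) : monom ![a, b, c, d] W =
    root 0 W ^ a * root 1 W ^ b * root 2 W ^ c * root 3 W ^ d := by
  simp [monom, Fin.prod_univ_four]

/-- The expansion of a theta series divided by its leading monomial. -/
theorem hermTheta_div_expansion {α β e e' : Fin 4 → ℤ}
    (h : ∀ p, p ∉ minQuad α → (∀ k, e k ≤ expo (dbl α p) k) ∨ ∀ k, e' k ≤ expo (dbl α p) k)
    {D L : Mat → ℂ} {E E' : Mat → ℂ} (hL : ∀ W, leadSum α β W = D W * L W) (hD : ∀ W, D W ≠ 0)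
    (he : ∀ W, monom e W = D W * E W) (he' : ∀ W, monom e' W = D W * E' W) :
    (fun W => hermTheta (halfInt α) (halfInt β) W / D W - L W) =O[cusp]
      fun W => ‖E W‖ + ‖E' W‖ := by
  obtain ⟨K, hK⟩ := hermTheta_expansion α β e e' h
  refine IsBigO.of_bound K ?_
  filter_upwards [eventually_norm_root_le] with W hW
  have h1 := hK W hW
  change ‖_ - leadSum α β W‖ ≤ _ at h1
  have hd : 0 < ‖D W‖ := norm_pos_iff.2 (hD W)
  have h2 : hermTheta (halfInt α) (halfInt β) W / D W - L W =
      (hermTheta (halfInt α) (halfInt β) W - leadSum α β W) / D W := by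
    rw [hL, sub_div, mul_div_cancel_left₀ _ (hD W)]
  rw [h2, norm_div, div_le_iff₀ hd, Real.norm_of_nonneg (by positivity)]
  refine h1.trans (le_of_eq ?_)
  rw [he, he', norm_mul, norm_mul]
  ring

/-- The product of the four roots. -/
noncomputable def rootProd (W : Mat) : ℂ := root 0 W * root 1 W * root 2 W * root 3 W

theorem rootProd_ne_zero (W : Mat) : rootProd W ≠ 0 :=
  mul_ne_zero (mul_ne_zero (mul_ne_zero (root_ne_zero 0 W) (root_ne_zero 1 W)) (root_ne_zero 2 W))
    (root_ne_zero 3 W)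

theorem isLittleO_of_isBigO_mul {f : Mat → ℂ} {c : ℝ}
    (h : f =O[cusp] fun W => ‖q3 W * q4 W‖ * c) : f =o[cusp] cuspSize := by
  refine h.trans_isLittleO ?_
  have := (isLittleO_mul tendsto_q3 q4_isBigO).norm_left
  simpa [mul_comm] using this.const_mul_left c

theorem theta_middle_sub_one {s : Fin 10} (hs : (charInt s).1 = 0) :
    (fun W => theta s W - 1) =o[cusp] cuspSize := by
  have h := hermTheta_div_expansion (α := 0) (β := (charInt s).2) (e := ![(4 : ℕ), (4 : ℕ), (0 : ℕ), (0 : ℕ)])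
    (e' := ![(4 : ℕ), (4 : ℕ), (0 : ℕ), (0 : ℕ)]) (fun p hp => Or.inl (le_expo_zero hp)) (D := fun _ => 1)
    (L := fun _ => 1) (E := fun W => q3 W * q4 W) (E' := fun W => q3 W * q4 W)
    (fun W => by rw [leadSum_zero, one_mul]) (fun _ => one_ne_zero)
    (fun W => by rw [monom_vec, ← root_zero_pow, ← root_one_pow]; ring)
    (fun W => by rw [monom_vec, ← root_zero_pow, ← root_one_pow]; ring)
  refine isLittleO_of_isBigO_mul (c := 2) ?_
  refine (h.congr_left fun W => ?_).congr_right fun W => ?_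
  · rw [theta_eq_halfInt, hs, div_one]
  · ring

/-- The first-order terms are needed, not just the limit: in the numerators of z̃₁ and z̃₂ the
constant terms cancel. -/
theorem theta_one_expansion :
    (fun W => theta 1 W / (4 * rootProd W ^ 2) - (1 + q3 W + q4 W)) =o[cusp] cuspSize := by
  have h := hermTheta_div_expansion (α := 1) (β := 0) (e := ![(6 : ℕ), (6 : ℕ), (2 : ℕ), (2 : ℕ)])
    (e' := ![(6 : ℕ), (6 : ℕ), (2 : ℕ), (2 : ℕ)]) (fun p hp => Or.inl (le_expo_ones hp))
    (D := fun W => 4 * rootProd W ^ 2)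
    (L := fun W => 1 + q3 W + q4 W + q3 W * q4 W) (E := fun W => q3 W * q4 W / 4)
    (E' := fun W => q3 W * q4 W / 4)
    (fun W => by rw [leadSum_ones_zero, ← root_zero_pow, ← root_one_pow, rootProd])
    (fun W => mul_ne_zero four_ne_zero (pow_ne_zero 2 (rootProd_ne_zero W)))
    (fun W => by rw [monom_vec, ← root_zero_pow, ← root_one_pow, rootProd]; ring)
    (fun W => by rw [monom_vec, ← root_zero_pow, ← root_one_pow, rootProd]; ring)
  have h' := isLittleO_of_isBigO_mul (c := 1 / 2) (h.congr_right fun W => by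
    rw [norm_div, show ‖(4 : ℂ)‖ = 4 by norm_num]; ring)
  refine (h'.add (isLittleO_mul tendsto_q3 q4_isBigO)).congr_left fun W => ?_
  rw [theta_eq_halfInt]
  simp only [charInt, Matrix.cons_val]
  ring

theorem theta_zero_expansion :
    (fun W => theta 0 W / (4 * rootProd W ^ 2) - (1 - q3 W - q4 W)) =o[cusp] cuspSize := by
  have h := hermTheta_div_expansion (α := 1) (β := 1) (e := ![(6 : ℕ), (6 : ℕ), (2 : ℕ), (2 : ℕ)])
    (e' := ![(6 : ℕ), (6 : ℕ), (2 : ℕ), (2 : ℕ)]) (fun p hp => Or.inl (le_expo_ones hp))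
    (D := fun W => 4 * rootProd W ^ 2)
    (L := fun W => 1 - q3 W - q4 W + q3 W * q4 W) (E := fun W => q3 W * q4 W / 4)
    (E' := fun W => q3 W * q4 W / 4)
    (fun W => by rw [leadSum_ones_ones, ← root_zero_pow, ← root_one_pow, rootProd])
    (fun W => mul_ne_zero four_ne_zero (pow_ne_zero 2 (rootProd_ne_zero W)))
    (fun W => by rw [monom_vec, ← root_zero_pow, ← root_one_pow, rootProd]; ring)
    (fun W => by rw [monom_vec, ← root_zero_pow, ← root_one_pow, rootProd]; ring)
  have h' := isLittleO_of_isBigO_mul (c := 1 / 2) (h.congr_right fun W => by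
    rw [norm_div, show ‖(4 : ℂ)‖ = 4 by norm_num]; ring)
  refine (h'.add (isLittleO_mul tendsto_q3 q4_isBigO)).congr_left fun W => ?_
  rw [theta_eq_halfInt]
  simp only [charInt, Matrix.cons_val]
  ring

/-- A function is asymptotic to one when its difference to one is small. -/
theorem tendsto_of_sub_isBigO {f E E' : Mat → ℂ} {c : ℂ}
    (h : (fun W => f W - c) =O[cusp] fun W => ‖E W‖ + ‖E' W‖) (hE : Tendsto E cusp (𝓝 0))
    (hE' : Tendsto E' cusp (𝓝 0)) : Tendsto f cusp (𝓝 c) := by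
  have h0 : Tendsto (fun W => ‖E W‖ + ‖E' W‖) cusp (𝓝 0) := by
    simpa using hE.norm.add hE'.norm
  have := (h.trans_tendsto h0).add_const c
  simpa using this

theorem tendsto_root_pow (k : Fin 4) {n : ℕ} (hn : n ≠ 0) (c : ℂ) :
    Tendsto (fun W => root k W ^ n / c) cusp (𝓝 0) := by
  have := ((tendsto_root k).pow n).div_const c
  rwa [zero_pow hn, zero_div] at this

theorem theta_first_tendsto {s : Fin 10} (h1 : (charInt s).1 = ![1, 1, 0, 0])
    (h2 : ∀ W, leadSum ![1, 1, 0, 0] (charInt s).2 W = 4 * (root 0 W * root 1 W * root 2 W) ^ 2) :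
    Tendsto (fun W => theta s W / (4 * (root 0 W * root 1 W * root 2 W) ^ 2)) cusp (𝓝 1) := by
  have h := hermTheta_div_expansion (α := ![1, 1, 0, 0]) (β := (charInt s).2)
    (e := ![(2 : ℕ), (2 : ℕ), (2 : ℕ), (4 : ℕ)])
    (e' := ![(2 : ℕ), (2 : ℕ), (6 : ℕ), (0 : ℕ)]) (fun p hp => le_expo_first hp)
    (D := fun W => 4 * (root 0 W * root 1 W * root 2 W) ^ 2)
    (L := fun W => 1) (E := fun W => root 3 W ^ 4 / 4)
    (E' := fun W => root 2 W ^ 4 / 4)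
    (fun W => by rw [h2, mul_one])
    (fun W => mul_ne_zero four_ne_zero (pow_ne_zero 2 (mul_ne_zero (mul_ne_zero (root_ne_zero 0 W)
      (root_ne_zero 1 W)) (root_ne_zero 2 W))))
    (fun W => by rw [monom_vec]; ring)
    (fun W => by rw [monom_vec]; ring)
  refine (tendsto_of_sub_isBigO h (tendsto_root_pow 3 four_ne_zero 4)
    (tendsto_root_pow 2 four_ne_zero 4)).congr fun W => ?_
  rw [theta_eq_halfInt, h1]

theorem theta_second_tendsto {s : Fin 10} (h1 : (charInt s).1 = ![0, 0, 1, 1])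
    (h2 : ∀ W, leadSum ![0, 0, 1, 1] (charInt s).2 W = 4 * (root 0 W * root 1 W * root 3 W) ^ 2) :
    Tendsto (fun W => theta s W / (4 * (root 0 W * root 1 W * root 3 W) ^ 2)) cusp (𝓝 1) := by
  have h := hermTheta_div_expansion (α := ![0, 0, 1, 1]) (β := (charInt s).2)
    (e := ![(2 : ℕ), (2 : ℕ), (4 : ℕ), (2 : ℕ)])
    (e' := ![(2 : ℕ), (2 : ℕ), (0 : ℕ), (6 : ℕ)]) (fun p hp => le_expo_second hp)
    (D := fun W => 4 * (root 0 W * root 1 W * root 3 W) ^ 2)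
    (L := fun W => 1) (E := fun W => root 2 W ^ 4 / 4)
    (E' := fun W => root 3 W ^ 4 / 4)
    (fun W => by rw [h2, mul_one])
    (fun W => mul_ne_zero four_ne_zero (pow_ne_zero 2 (mul_ne_zero (mul_ne_zero (root_ne_zero 0 W)
      (root_ne_zero 1 W)) (root_ne_zero 3 W))))
    (fun W => by rw [monom_vec]; ring)
    (fun W => by rw [monom_vec]; ring)
  refine (tendsto_of_sub_isBigO h (tendsto_root_pow 2 four_ne_zero 4)
    (tendsto_root_pow 3 four_ne_zero 4)).congr fun W => ?_
  rw [theta_eq_halfInt, h1]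

/-! ### The function `Θ̃` -/

theorem rootProd_pow_four (W : Mat) : rootProd W ^ 4 = q1 W * q2 W / (q3 W * q4 W) := by
  have h3 : q3 W ≠ 0 := Complex.exp_ne_zero _
  have h4 : q4 W ≠ 0 := Complex.exp_ne_zero _
  rw [rootProd, mul_pow, mul_pow, mul_pow, root_zero_pow, root_one_pow, root_two_pow,
    root_three_pow]
  field_simp

/-- The omitted terms are of relative order √|q₃q₄|, which is at most of order |q₃| + |q₄| by the
inequality of means. -/
theorem hermTheta_quart_isBigO {α β : Fin 4 → ℤ}
    (h : ∀ p, p ∉ minQuad α → ∀ k, (![3, 3, 1, 1] : Fin 4 → ℤ) k ≤ expo (dbl α p) k)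
    {L : Mat → ℂ} (hL : ∀ W, leadSum α β W = 2 * rootProd W * L W) :
    (fun W => hermTheta (halfInt α) (halfInt β) W / (2 * rootProd W) - L W) =O[cusp] cuspSize := by
  have he : ∀ W, monom ![(3 : ℕ), (3 : ℕ), (1 : ℕ), (1 : ℕ)] W =
      2 * rootProd W * (root 0 W ^ 2 * root 1 W ^ 2 / 2) := fun W => by
    rw [monom_vec, rootProd]; ring
  refine (hermTheta_div_expansion (D := fun W => 2 * rootProd W)
    (fun p hp => Or.inl (h p hp)) hL
    (fun W => mul_ne_zero two_ne_zero (rootProd_ne_zero W)) he he).trans (IsBigO.of_bound 1 ?_)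
  refine Eventually.of_forall fun W => ?_
  rw [cuspSize, ← root_zero_pow, ← root_one_pow, Real.norm_of_nonneg (by positivity),
    Real.norm_of_nonneg (by positivity), norm_div, norm_mul, norm_pow, norm_pow, norm_pow, norm_pow,
    show ‖(2 : ℂ)‖ = 2 by norm_num]
  nlinarith [sq_nonneg (‖root 0 W‖ ^ 2 - ‖root 1 W‖ ^ 2), sq_nonneg (‖root 0 W‖ ^ 2),
    sq_nonneg (‖root 1 W‖ ^ 2)]

theorem tendsto_of_sub_isBigO_cuspSize {f g : Mat → ℂ} {c : ℂ}
    (h : (fun W => f W - g W) =O[cusp] cuspSize) (hg : Tendsto g cusp (𝓝 c)) :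
    Tendsto f cusp (𝓝 c) := by
  have := (h.trans_tendsto tendsto_cuspSize).add hg
  simpa using this

theorem thetaTilde_expansion :
    (fun W => thetaTilde W / (q1 W * q2 W / (q3 W * q4 W)) + 64 * (q3 W - q4 W)) =o[cusp]
      cuspSize := by
  obtain ⟨hv0, hv1, hv2, hv3⟩ := quartVec_eq_halfInt
  have e0 := hermTheta_quart_isBigO (α := ![1, 0, 1, 0]) (β := ![0, 1, 0, 1])
    (L := fun W => 1 + root 0 W ^ 2 * root 1 W ^ 2) (fun p hp => le_expo_real hp)
    (fun W => leadSum_real_imaginary W)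
  have e1 := hermTheta_quart_isBigO (α := ![1, 0, 1, 0]) (β := ![1, 0, 1, 0])
    (L := fun W => -(1 - root 0 W ^ 2 * root 1 W ^ 2)) (fun p hp => le_expo_real hp)
    (fun W => by rw [leadSum_real_real, rootProd]; ring)
  have e2 := hermTheta_quart_isBigO (α := ![1, 0, 0, 1]) (β := ![1, 0, 0, 1])
    (L := fun W => root 0 W ^ 2 - root 1 W ^ 2) (fun p hp => le_expo_mixed hp)
    (fun W => leadSum_mixed W)
  have e3 := hermTheta_quart_isBigO (α := ![1, 0, 0, 1]) (β := ![0, 1, 1, 0])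
    (L := fun W => root 0 W ^ 2 + root 1 W ^ 2) (fun p hp => le_expo_mixed hp)
    (fun W => leadSum_mixed_swap W)
  have r0 : Tendsto (fun W => root 0 W ^ 2) cusp (𝓝 0) := by
    simpa using (tendsto_root 0).pow 2
  have r1 : Tendsto (fun W => root 1 W ^ 2) cusp (𝓝 0) := by
    simpa using (tendsto_root 1).pow 2
  have l0 : Tendsto (fun W => 1 + root 0 W ^ 2 * root 1 W ^ 2) cusp (𝓝 1) := by
    simpa using (r0.mul r1).const_add 1
  have l1 : Tendsto (fun W => -(1 - root 0 W ^ 2 * root 1 W ^ 2)) cusp (𝓝 (-1)) := by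
    simpa using ((r0.mul r1).const_sub 1).neg
  have l2 : Tendsto (fun W => root 0 W ^ 2 - root 1 W ^ 2) cusp (𝓝 0) := by
    simpa using r0.sub r1
  have l3 : Tendsto (fun W => root 0 W ^ 2 + root 1 W ^ 2) cusp (𝓝 0) := by
    simpa using r0.add r1
  have t01 := (tendsto_of_sub_isBigO_cuspSize e0 l0).mul (tendsto_of_sub_isBigO_cuspSize e1 l1)
  rw [one_mul] at t01
  -- The errors of the last two factors are only O(|q₃| + |q₄|), but each is multiplied by a factor
  -- that tends to zero.
  have h23 := (isLittleO_mul (tendsto_of_sub_isBigO_cuspSize e3 l3) e2).add (isLittleO_mul l2 e3)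
  have hab : (fun W => q3 W - q4 W) =O[cusp] cuspSize := q3_isBigO.sub q4_isBigO
  have h4 := isLittleO_mul_of_tendsto t01 h23
  have h5 := isLittleO_mul (by simpa using t01.add_const 1) hab
  refine ((h4.add h5).const_mul_left 64).congr_left fun W => ?_
  have hr := rootProd_ne_zero W
  rw [← rootProd_pow_four, thetaTilde, hv0, hv1, hv2, hv3, ← root_zero_pow, ← root_one_pow]
  field_simp
  ring

theorem HolomorphicOn.mul {f g : Mat → ℂ} {U : Set Mat} (hf : HolomorphicOn f U)
    (hg : HolomorphicOn g U) : HolomorphicOn (fun W => f W * g W) U :=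
  DifferentiableOn.mul hf hg

theorem isThetaTilde_thetaTilde : IsThetaTilde thetaTilde := by
  refine ⟨?_, fun W hW => thetaTilde_sq hW, thetaTilde_expansion⟩
  have h := differentiableOn_hermTheta
  exact DifferentiableOn.const_mul (((((h _ _).mul (h _ _)).mul (h _ _)).mul (h _ _))) 4

/-! ### Expansions of the theta squares -/

theorem q1_eq_root_pow (W : Mat) : q1 W = (root 0 W * root 1 W * root 2 W) ^ 4 := by
  have h3 : q3 W ≠ 0 := Complex.exp_ne_zero _
  have h4 : q4 W ≠ 0 := Complex.exp_ne_zero _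
  rw [mul_pow, mul_pow, root_zero_pow, root_one_pow, root_two_pow]
  field_simp

theorem q2_eq_root_pow (W : Mat) : q2 W = (root 0 W * root 1 W * root 3 W) ^ 4 := by
  have h3 : q3 W ≠ 0 := Complex.exp_ne_zero _
  have h4 : q4 W ≠ 0 := Complex.exp_ne_zero _
  rw [mul_pow, mul_pow, root_zero_pow, root_one_pow, root_three_pow]
  field_simp

theorem thetaSq_middle_sub_one {s : Fin 10} (hs : (charInt s).1 = 0) :
    (fun W => theta s W ^ 2 - 1) =o[cusp] cuspSize := by
  have h := theta_middle_sub_one hs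
  refine (mul_sub_mul_isLittleO (f₀ := fun _ => 1) (g₀ := fun _ => 1) tendsto_const_nhds
    tendsto_const_nhds h h).congr_left fun W => by ring

theorem thetaSq_expansion {s : Fin 10} {c : ℂ}
    (h : (fun W => theta s W / (4 * rootProd W ^ 2) - (1 + c * (q3 W + q4 W))) =o[cusp] cuspSize) :
    (fun W => theta s W ^ 2 / rootProd W ^ 4 - 16 * (1 + 2 * c * (q3 W + q4 W))) =o[cusp]
      cuspSize := by
  have h0 : Tendsto (fun W => q3 W + q4 W) cusp (𝓝 0) := by
    simpa using tendsto_q3.add tendsto_q4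
  have h1 : Tendsto (fun W => 1 + c * (q3 W + q4 W)) cusp (𝓝 1) := by
    simpa using (h0.const_mul c).const_add 1
  have h2 := (mul_sub_mul_isLittleO h1 h1 h h).add
    ((isLittleO_mul h0 (q3_isBigO.add q4_isBigO)).const_mul_left (c ^ 2))
  refine (h2.const_mul_left 16).congr_left fun W => ?_
  have hr := rootProd_ne_zero W
  field_simp
  ring

theorem thetaSq_zero_expansion :
    (fun W => theta 0 W ^ 2 / rootProd W ^ 4 - 16 * (1 + 2 * (-1) * (q3 W + q4 W))) =o[cusp]
      cuspSize :=
  thetaSq_expansion (theta_zero_expansion.congr_left fun W => by ring)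

theorem thetaSq_one_expansion :
    (fun W => theta 1 W ^ 2 / rootProd W ^ 4 - 16 * (1 + 2 * 1 * (q3 W + q4 W))) =o[cusp]
      cuspSize :=
  thetaSq_expansion (theta_one_expansion.congr_left fun W => by ring)

theorem thetaSq_tendsto_of_expansion {s : Fin 10} {c : ℂ}
    (h : (fun W => theta s W ^ 2 / rootProd W ^ 4 - 16 * (1 + 2 * c * (q3 W + q4 W))) =o[cusp]
      cuspSize) : Tendsto (fun W => theta s W ^ 2 / rootProd W ^ 4) cusp (𝓝 16) := by
  refine tendsto_of_sub_isLittleO ?_ h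
  have := (((tendsto_q3.add tendsto_q4).const_mul (2 * c)).const_add 1).const_mul 16
  simpa using this

theorem thetaSq_middle_tendsto {s : Fin 10} (hs : (charInt s).1 = 0) :
    Tendsto (fun W => theta s W ^ 2) cusp (𝓝 1) :=
  tendsto_of_sub_isLittleO tendsto_const_nhds (thetaSq_middle_sub_one hs)

theorem tendsto_sq_div {f r : Mat → ℂ}
    (h : Tendsto (fun W => f W / (4 * r W ^ 2)) cusp (𝓝 1)) :
    Tendsto (fun W => f W ^ 2 / r W ^ 4) cusp (𝓝 16) := by
  have := (h.pow 2).const_mul 16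
  rw [one_pow, mul_one] at this
  refine this.congr fun W => ?_
  rw [div_pow, mul_pow, ← pow_mul]
  ring

theorem thetaSq_two_tendsto : Tendsto (fun W => theta 2 W ^ 2 / q1 W) cusp (𝓝 16) := by
  simpa only [q1_eq_root_pow] using tendsto_sq_div (theta_first_tendsto (s := 2) rfl leadSum_first)

theorem thetaSq_three_tendsto : Tendsto (fun W => theta 3 W ^ 2 / q1 W) cusp (𝓝 16) := by
  simpa only [q1_eq_root_pow] using tendsto_sq_div (theta_first_tendsto (s := 3) rfl leadSum_first_second)

theorem thetaSq_four_tendsto : Tendsto (fun W => theta 4 W ^ 2 / q2 W) cusp (𝓝 16) := by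
  simpa only [q2_eq_root_pow] using tendsto_sq_div (theta_second_tendsto (s := 4) rfl leadSum_second)

theorem thetaSq_nine_tendsto : Tendsto (fun W => theta 9 W ^ 2 / q2 W) cusp (𝓝 16) := by
  simpa only [q2_eq_root_pow] using tendsto_sq_div (theta_second_tendsto (s := 9) rfl leadSum_second_first)

theorem eventually_theta_ne_zero : ∀ᶠ W in cusp, W ∈ upperHalf ∧ ∀ s, theta s W ≠ 0 := by
  have hU : ∀ᶠ W in cusp, W ∈ upperHalf := eventually_norm_root_le.mono fun W hW =>
    mem_upperHalf_of_norm_root_lt fun k => (hW k).trans_lt (by norm_num)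
  refine hU.and (eventually_all.2 fun s => ?_)
  have key : ∀ {D : Mat → ℂ} {c : ℂ}, c ≠ 0 → Tendsto (fun W => theta s W ^ 2 / D W) cusp (𝓝 c) →
      ∀ᶠ W in cusp, theta s W ≠ 0 := fun hc h => (h.eventually_ne hc).mono fun W hW h0 => by
    simp [h0] at hW
  have mid : (charInt s).1 = 0 → ∀ᶠ W in cusp, theta s W ≠ 0 := fun hs =>
    key (D := fun _ => 1) one_ne_zero (by simpa using thetaSq_middle_tendsto hs)
  have h16 : (16 : ℂ) ≠ 0 := by norm_num
  fin_cases s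
  · exact key h16 (thetaSq_tendsto_of_expansion thetaSq_zero_expansion)
  · exact key h16 (thetaSq_tendsto_of_expansion thetaSq_one_expansion)
  · exact key h16 thetaSq_two_tendsto
  · exact key h16 thetaSq_three_tendsto
  · exact key h16 thetaSq_four_tendsto
  · exact mid rfl
  · exact mid rfl
  · exact mid rfl
  · exact mid rfl
  · exact key h16 thetaSq_nine_tendsto

/-! ### The two solutions near the boundary point -/

/-- Two functions that agree with `b, a` up to a small part of `|a| + |b|`, and whose product is
asymptotic to `a b`, are asymptotic to `b, a`. -/
theorem tendsto_div_of_mul {ι : Type*} {l : Filter ι} {a b f g : ι → ℂ} {m : ι → ℝ}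
    (hm : ∀ x, m x = ‖a x‖ + ‖b x‖)
    (ha : ∀ x, a x ≠ 0) (hb : ∀ x, b x ≠ 0) (hf : (fun x => f x - b x) =o[l] m)
    (hg : (fun x => g x - a x) =o[l] m)
    (hfg : Tendsto (fun x => f x * g x / (a x * b x)) l (𝓝 1)) :
    Tendsto (fun x => f x / b x) l (𝓝 1) := by
  have key : ∀ {a b f : ι → ℂ} {l' : Filter ι}, (∀ x, b x ≠ 0) → l' ≤ l →
      (∀ᶠ x in l', ‖a x‖ ≤ ‖b x‖) → (∀ x, m x = ‖a x‖ + ‖b x‖) →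
      (fun x => f x - b x) =o[l] m → Tendsto (fun x => f x / b x) l' (𝓝 1) := by
    intro a b f l' hb hl hab hm hf
    have h1 : m =O[l'] b := IsBigO.of_bound 2 (hab.mono fun x hx => by
      rw [hm, Real.norm_of_nonneg (by positivity)]; linarith)
    have h2 := ((hf.mono hl).trans_isBigO h1).tendsto_div_nhds_zero
    have h3 := h2.add_const 1
    rw [zero_add] at h3
    refine h3.congr fun x => ?_
    have := hb x
    field_simp
    ring
  -- Where b dominates, the error of f is o(b) and the claim is immediate. Where a dominates, the
  -- same argument gives g ∼ a, and f is recovered by dividing the product by g.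
  have hs : l = l ⊓ 𝓟 {x | ‖a x‖ ≤ ‖b x‖} ⊔ l ⊓ 𝓟 {x | ‖b x‖ ≤ ‖a x‖} := by
    rw [← inf_sup_left, sup_principal, left_eq_inf, le_principal_iff]
    exact univ_mem' fun x => le_total ‖a x‖ ‖b x‖
  rw [hs]
  refine Tendsto.sup (key hb inf_le_left (mem_inf_of_right (mem_principal_self _)) hm hf) ?_
  have h1 := key ha (inf_le_left : l ⊓ 𝓟 {x | ‖b x‖ ≤ ‖a x‖} ≤ l)
    (mem_inf_of_right (mem_principal_self _)) (fun x => (hm x).trans (add_comm _ _)) hg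
  have h2 := (hfg.mono_left (inf_le_left : l ⊓ 𝓟 {x | ‖b x‖ ≤ ‖a x‖} ≤ l)).div h1 one_ne_zero
  rw [div_one] at h2
  refine h2.congr' ((h1.eventually_ne one_ne_zero).mono fun x hx => ?_)
  have hgx : g x ≠ 0 := fun h => hx (by rw [h, zero_div])
  have h3 := ha x
  have h4 := hb x
  rw [Pi.div_apply]
  field_simp

/-- Up to the factor 4t₇ the left side is the value of the quadratic polynomial at x = -t₀. There
the product (x + t₅)(x + t₀)(x + t₁) vanishes and the other product becomes -t₀t₂t₄. -/
theorem SquareRelations.discriminant_first {t : Fin 10 → ℂ} (h : SquareRelations t) {P : ℂ}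
    (hP : P = t 3 * t 9 - t 5 * t 0 - t 1 * t 7) :
    (2 * t 7 * t 0 + P) ^ 2 - (P ^ 2 - 4 * t 7 * t 5 * t 0 * t 1) = 4 * t 7 * t 0 * t 2 * t 4 := by
  rw [hP, h.r0, h.r1, h.r2, h.r3, h.r4]
  ring

/-- The same evaluation at x = -t₁. -/
theorem SquareRelations.discriminant_second {t : Fin 10 → ℂ} (h : SquareRelations t) {P : ℂ}
    (hP : P = t 3 * t 9 - t 5 * t 0 - t 1 * t 7) :
    (2 * t 7 * t 1 + P) ^ 2 - (P ^ 2 - 4 * t 7 * t 5 * t 0 * t 1) = 4 * t 7 * t 1 * t 3 * t 9 := by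
  rw [hP, h.r0, h.r1, h.r3]
  ring

/-- The trace term of the quadratic equation. -/
noncomputable def traceTerm (W : Mat) : ℂ :=
  theta 3 W ^ 2 * theta 9 W ^ 2 - theta 5 W ^ 2 * theta 0 W ^ 2 - theta 1 W ^ 2 * theta 7 W ^ 2

theorem traceTerm_expansion :
    (fun W => traceTerm W / rootProd W ^ 4 + 32) =o[cusp] cuspSize := by
  have h39 : (fun W => theta 3 W ^ 2 * theta 9 W ^ 2 / rootProd W ^ 4) =o[cusp] cuspSize := by
    have h := (thetaSq_three_tendsto.mul thetaSq_nine_tendsto).mul tendsto_q3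
    rw [mul_zero] at h
    refine (isLittleO_mul h q4_isBigO).congr_left fun W => ?_
    have h1 : q1 W ≠ 0 := Complex.exp_ne_zero _
    have h2 : q2 W ≠ 0 := Complex.exp_ne_zero _
    have h3 : q3 W ≠ 0 := Complex.exp_ne_zero _
    have h4 : q4 W ≠ 0 := Complex.exp_ne_zero _
    rw [rootProd_pow_four]
    field_simp
  have h0 := isLittleO_mul_of_tendsto
    (thetaSq_tendsto_of_expansion thetaSq_zero_expansion) (thetaSq_middle_sub_one (s := 5) rfl)
  have h1 := isLittleO_mul_of_tendsto
    (thetaSq_tendsto_of_expansion thetaSq_one_expansion) (thetaSq_middle_sub_one (s := 7) rfl)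
  refine ((((h39.sub h0).sub h1).sub thetaSq_zero_expansion).sub thetaSq_one_expansion).congr_left
    fun W => ?_
  rw [traceTerm]
  ring

theorem two_mul_wFormula_sub {W : Mat} (hW : W ∈ upperHalf) (h7 : theta 7 W ≠ 0) (x : ℂ) :
    2 * theta 7 W ^ 2 * (wFormula W x - theta 5 W ^ 2) = traceTerm W - x := by
  have h := (squareRelations hW).trace
  rw [wFormula, traceTerm]
  field_simp
  linear_combination h

/-- The leading terms of a solution of the master equation, where `p, q` are `q₃, q₄` in the order
that the sign of the square root determines. -/
structure SolutionLimits (p q : Mat → ℂ) (T : Mat → ℂ) : Prop where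
  first : Tendsto (fun W => zFormula W (wFormula W (T W)) 0 / q W) cusp (𝓝 (-4))
  second : Tendsto (fun W => zFormula W (wFormula W (T W)) 1 / p W) cusp (𝓝 4)
  third : Tendsto (fun W => zFormula W (wFormula W (T W)) 2 / flatCoord W 2) cusp (𝓝 1)
  fourth : Tendsto (fun W => zFormula W (wFormula W (T W)) 3 / flatCoord W 3) cusp (𝓝 1)

/-- The pair `p`, `q` is q₃, q₄ in either order, so that both signs of the square root are treated
at once. With R the product of the four roots, X = 2t₇(w - t₅)/R⁴ is -32 + 64(p - q), while A =
2t₇t₀/R⁴ and B = 2t₇t₁/R⁴ are 32 ∓ 64(p + q), all up to o(|p| + |q|). Hence A + X is -128q and B + X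
is 128p to that order, and z̃₁ = -(A + X)/X, z̃₂ = -(B + X)/X. -/
theorem solutionLimits {T p q : Mat → ℂ}
    (hT : ∀ W ∈ upperHalf,
      T W ^ 2 = 1 / 12 * ((∑ s, theta s W ^ 4) ^ 2 - 4 * ∑ s, theta s W ^ 8))
    (hp : ∀ W, p W ≠ 0) (hq : ∀ W, q W ≠ 0) (hpq : ∀ W, p W + q W = q3 W + q4 W)
    (hpq' : ∀ W, p W * q W = q3 W * q4 W) (hm : ∀ W, cuspSize W = ‖p W‖ + ‖q W‖)
    (hexp : (fun W => T W / rootProd W ^ 4 + 64 * (p W - q W)) =o[cusp] cuspSize) :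
    SolutionLimits p q T := by
  -- the expansions of `2 t₇ (w - t₅)`, `2 t₇ (w - t₅ + t₀)`, `2 t₇ (w - t₅ + t₁)`
  have hR : ∀ W, rootProd W ^ 4 ≠ 0 := fun W => pow_ne_zero 4 (rootProd_ne_zero W)
  have h1 : ∀ W, q1 W ≠ 0 := fun W => Complex.exp_ne_zero _
  have h2 : ∀ W, q2 W ≠ 0 := fun W => Complex.exp_ne_zero _
  have h3 : ∀ W, q3 W ≠ 0 := fun W => Complex.exp_ne_zero _
  have h4 : ∀ W, q4 W ≠ 0 := fun W => Complex.exp_ne_zero _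
  let X : Mat → ℂ := fun W => (traceTerm W - T W) / rootProd W ^ 4
  let X' : Mat → ℂ := fun W => (traceTerm W + T W) / rootProd W ^ 4
  let A : Mat → ℂ := fun W => 2 * theta 7 W ^ 2 * (theta 0 W ^ 2 / rootProd W ^ 4)
  let B : Mat → ℂ := fun W => 2 * theta 7 W ^ 2 * (theta 1 W ^ 2 / rootProd W ^ 4)
  have eX : (fun W => X W - (-32 + 64 * (p W - q W))) =o[cusp] cuspSize :=
    (traceTerm_expansion.sub hexp).congr_left fun W => by simp only [X]; ring
  have eX' : (fun W => X' W - (-32 - 64 * (p W - q W))) =o[cusp] cuspSize :=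
    (traceTerm_expansion.add hexp).congr_left fun W => by simp only [X']; ring
  have eA : (fun W => A W - 32 * (1 - 2 * (p W + q W))) =o[cusp] cuspSize := by
    refine (((isLittleO_mul_of_tendsto (thetaSq_tendsto_of_expansion thetaSq_zero_expansion)
      (thetaSq_middle_sub_one (s := 7) rfl)).add thetaSq_zero_expansion).const_mul_left 2).congr_left
      fun W => ?_
    rw [hpq]; simp only [A]; ring
  have eB : (fun W => B W - 32 * (1 + 2 * (p W + q W))) =o[cusp] cuspSize := by
    refine (((isLittleO_mul_of_tendsto (thetaSq_tendsto_of_expansion thetaSq_one_expansion)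
      (thetaSq_middle_sub_one (s := 7) rfl)).add thetaSq_one_expansion).const_mul_left 2).congr_left
      fun W => ?_
    rw [hpq]; simp only [B]; ring
  have t7 := thetaSq_middle_tendsto (s := 7) rfl
  have tpq : Tendsto (fun W => p W - q W) cusp (𝓝 0) := by
    rw [tendsto_zero_iff_norm_tendsto_zero]
    refine squeeze_zero (fun _ => norm_nonneg _) (fun W => ?_) tendsto_cuspSize
    rw [hm]
    exact norm_sub_le _ _
  have tX : Tendsto X cusp (𝓝 (-32)) := by
    refine tendsto_of_sub_isLittleO ?_ eX
    simpa using (tpq.const_mul 64).const_add (-32)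
  -- the relations at a point
  have hU := eventually_theta_ne_zero
  have disc : ∀ W ∈ upperHalf, T W ^ 2 = traceTerm W ^ 2 -
      4 * theta 7 W ^ 2 * theta 5 W ^ 2 * theta 0 W ^ 2 * theta 1 W ^ 2 := fun W hW => by
    have hd := (squareRelations hW).discriminant
    rw [(squareRelations hW).trace] at hd
    rw [hT W hW, traceTerm, ← hd]
    simp only [← pow_mul]
  -- the product of the two roots shifted by `t₀`, `t₁`
  have tF : Tendsto (fun W => -(A W + X W) / 128 / q W) cusp (𝓝 1) := by
    refine tendsto_div_of_mul hm hp hq (g := fun W => -(A W + X' W) / 128)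
      (((eA.add eX).const_mul_left (-(1 / 128))).congr_left fun W => by ring)
      (((eA.add eX').const_mul_left (-(1 / 128))).congr_left fun W => by ring) ?_
    have h := ((t7.mul (thetaSq_tendsto_of_expansion thetaSq_zero_expansion)).mul
      (thetaSq_two_tendsto.mul thetaSq_four_tendsto)).const_mul (4 / 128 ^ 2)
    norm_num at h
    refine h.congr' (hU.mono fun W hW => ?_)
    have e1 := (squareRelations hW.1).discriminant_first (P := traceTerm W) rfl
    rw [← disc W hW.1] at e1
    have e2 : (A W + X W) * (A W + X' W) * (rootProd W ^ 4 * rootProd W ^ 4) =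
      4 * theta 7 W ^ 2 * theta 0 W ^ 2 * theta 2 W ^ 2 * theta 4 W ^ 2 := by
      rw [← e1]; simp only [A, X, X']
      have := rootProd_ne_zero W
      field_simp
      ring
    have e3 : rootProd W ^ 4 * (p W * q W) = q1 W * q2 W := by
      rw [hpq', rootProd_pow_four, div_mul_cancel₀ _ (mul_ne_zero (h3 W) (h4 W))]
    have e4 : -(A W + X W) / 128 * (-(A W + X' W) / 128) / (p W * q W) =
      (A W + X W) * (A W + X' W) * (rootProd W ^ 4 * rootProd W ^ 4) /
        (128 ^ 2 * (rootProd W ^ 4 * (rootProd W ^ 4 * (p W * q W)))) := by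
      have := rootProd_ne_zero W
      have := hp W
      have := hq W
      field_simp
    beta_reduce
    rw [e4, e2, e3]
    have := h1 W
    have := h2 W
    have := rootProd_ne_zero W
    field_simp
    ring
  have tH : Tendsto (fun W => (B W + X W) / 128 / p W) cusp (𝓝 1) := by
    refine tendsto_div_of_mul (fun W => (hm W).trans (add_comm _ _)) hq hp
      (g := fun W => (B W + X' W) / 128)
      (((eB.add eX).const_mul_left (1 / 128)).congr_left fun W => by ring)
      (((eB.add eX').const_mul_left (1 / 128)).congr_left fun W => by ring) ?_
    have h := ((t7.mul (thetaSq_tendsto_of_expansion thetaSq_one_expansion)).mul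
      (thetaSq_three_tendsto.mul thetaSq_nine_tendsto)).const_mul (4 / 128 ^ 2)
    norm_num at h
    refine h.congr' (hU.mono fun W hW => ?_)
    have e1 := (squareRelations hW.1).discriminant_second (P := traceTerm W) rfl
    rw [← disc W hW.1] at e1
    have e2 : (B W + X W) * (B W + X' W) * (rootProd W ^ 4 * rootProd W ^ 4) =
      4 * theta 7 W ^ 2 * theta 1 W ^ 2 * theta 3 W ^ 2 * theta 9 W ^ 2 := by
      rw [← e1]; simp only [B, X, X']
      have := rootProd_ne_zero W
      field_simp
      ring
    have e3 : rootProd W ^ 4 * (p W * q W) = q1 W * q2 W := by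
      rw [hpq', rootProd_pow_four, div_mul_cancel₀ _ (mul_ne_zero (h3 W) (h4 W))]
    have e4 : (B W + X W) / 128 * ((B W + X' W) / 128) / (q W * p W) =
      (B W + X W) * (B W + X' W) * (rootProd W ^ 4 * rootProd W ^ 4) /
        (128 ^ 2 * (rootProd W ^ 4 * (rootProd W ^ 4 * (p W * q W)))) := by
      have := rootProd_ne_zero W
      have := hp W
      have := hq W
      field_simp
    beta_reduce
    rw [e4, e2, e3]
    have := h1 W
    have := h2 W
    have := rootProd_ne_zero W
    field_simp
    ring
  -- the expansions of `w` and `w - t₈`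
  let w : Mat → ℂ := fun W => wFormula W (T W)
  have tR : Tendsto (fun W => rootProd W ^ 4) cusp (𝓝 0) := by
    have := ((((tendsto_root 0).mul (tendsto_root 1)).mul (tendsto_root 2)).mul
      (tendsto_root 3)).pow 4
    simpa [rootProd] using this
  have tx : Tendsto (fun W => (w W - theta 5 W ^ 2) / rootProd W ^ 4) cusp (𝓝 (-16)) := by
    have h := tX.div (t7.const_mul 2) (by norm_num)
    norm_num at h
    refine h.congr' (hU.mono fun W hW => ?_)
    have hx := two_mul_wFormula_sub hW.1 (hW.2 7) (T W)
    have h7 := hW.2 7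
    have := rootProd_ne_zero W
    simp only [X, w, Pi.div_apply]
    rw [← hx]
    field_simp
  have tw : Tendsto w cusp (𝓝 1) := by
    have := (tx.mul tR).add (thetaSq_middle_tendsto (s := 5) rfl)
    rw [mul_zero, zero_add] at this
    refine this.congr fun W => ?_
    rw [div_mul_cancel₀ _ (hR W), sub_add_cancel]
  have hRq : ∀ W, rootProd W ^ 4 = root 3 W ^ 4 * q1 W := fun W => by
    rw [q1_eq_root_pow, rootProd]; ring
  -- Here w - t₈ = (w - t₅ + t₀) + t₂. The bracket is o(R⁴), which is negligible against q₁, so t₂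
  -- alone contributes.
  have t8 : Tendsto (fun W => (w W - theta 8 W ^ 2) / q1 W) cusp (𝓝 16) := by
    have h := ((tx.add (thetaSq_tendsto_of_expansion thetaSq_zero_expansion)).mul
      ((tendsto_root 3).pow 4)).add thetaSq_two_tendsto
    norm_num at h
    refine h.congr' (hU.mono fun W hW => ?_)
    have hs := squareRelations hW.1
    have e : w W - theta 8 W ^ 2 =
        (w W - theta 5 W ^ 2 + theta 0 W ^ 2) + theta 2 W ^ 2 := by
      have e1 := hs.r0
      have e2 := hs.r2
      linear_combination -e1 - e2
    have hr := root_ne_zero 3 W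
    have := h1 W
    beta_reduce
    rw [e, hRq]
    field_simp
  -- the four coordinates
  have hXx : ∀ᶠ W in cusp, zFormula W (w W) 0 / q W = 128 * (-(A W + X W) / 128 / q W) / X W ∧
      zFormula W (w W) 1 / p W = -128 * ((B W + X W) / 128 / p W) / X W ∧
      zFormula W (w W) 3 / flatCoord W 3 = X W ^ 2 * ((w W - theta 8 W ^ 2) / q1 W) /
        (128 ^ 2 * w W * (-(A W + X W) / 128 / q W) * ((B W + X W) / 128 / p W)) := by
    refine hU.mono fun W hW => ?_
    have hs := squareRelations hW.1
    have h7 := hW.2 7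
    have hR := hR W
    have hr := rootProd_ne_zero W
    have e1 := hs.r0
    have e2 := hs.r1
    have e3 := hs.r2
    have e4 := hs.r3
    have c : ∀ y z : ℂ, z = 2 * theta 7 W ^ 2 * y → y = z / rootProd W ^ 4 *
        (rootProd W ^ 4 / (2 * theta 7 W ^ 2)) := fun y z h => by
      rw [h]
      field_simp
    have hx := two_mul_wFormula_sub hW.1 h7 (T W)
    have k0 : w W - theta 5 W ^ 2 = X W * (rootProd W ^ 4 / (2 * theta 7 W ^ 2)) :=
      c _ _ hx.symm
    have k1 : theta 2 W ^ 2 + theta 8 W ^ 2 - w W =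
        -(A W + X W) * (rootProd W ^ 4 / (2 * theta 7 W ^ 2)) := by
      have := c (theta 2 W ^ 2 + theta 8 W ^ 2 - w W) _ rfl
      rw [this]
      simp only [A, X]
      field_simp
      linear_combination 2 * theta 7 W ^ 2 * (e1 + e3) - hx
    have k2 : theta 3 W ^ 2 + theta 8 W ^ 2 - w W =
        -(B W + X W) * (rootProd W ^ 4 / (2 * theta 7 W ^ 2)) := by
      have := c (theta 3 W ^ 2 + theta 8 W ^ 2 - w W) _ rfl
      rw [this]
      simp only [B, X]
      field_simp
      linear_combination 2 * theta 7 W ^ 2 * (e2 + e4) - hx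
    -- The common scale of w - t₅ and of both numerators; it cancels from all the quotients.
    have hκ : rootProd W ^ 4 / (2 * theta 7 W ^ 2) ≠ 0 :=
      div_ne_zero hR (mul_ne_zero two_ne_zero (pow_ne_zero 2 h7))
    refine ⟨?_, ?_, ?_⟩
    · change (theta 2 W ^ 2 + theta 8 W ^ 2 - w W) / (w W - theta 5 W ^ 2) / q W = _
      rw [k0, k1, mul_div_mul_right _ _ hκ]
      ring
    · change (theta 3 W ^ 2 + theta 8 W ^ 2 - w W) / (w W - theta 5 W ^ 2) / p W = _
      rw [k0, k2, mul_div_mul_right _ _ hκ]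
      ring
    · change (w W - theta 5 W ^ 2) ^ 2 * (w W - theta 8 W ^ 2) /
        (w W * (theta 2 W ^ 2 + theta 8 W ^ 2 - w W) * (theta 3 W ^ 2 + theta 8 W ^ 2 - w W)) /
        (-(q1 W / (q3 W * q4 W))) = _
      rw [k0, k1, k2, ← hpq']
      have hq1 := h1 W
      have hp := hp W
      have hq := hq W
      generalize rootProd W ^ 4 / (2 * theta 7 W ^ 2) = κ at hκ
      generalize A W + X W = F
      generalize B W + X W = H
      generalize w W - theta 8 W ^ 2 = D
      have e : (X W * κ) ^ 2 * D / (w W * (-F * κ) * (-H * κ)) =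
          κ ^ 2 * (X W ^ 2 * D) / (κ ^ 2 * (w W * F * H)) := by ring
      rw [e, mul_div_mul_left _ _ (pow_ne_zero 2 hκ)]
      field_simp
  refine ⟨?_, ?_, ?_, ?_⟩
  · have h := (tF.const_mul 128).div tX (by norm_num)
    rw [show (128 * 1 / -32 : ℂ) = -4 by norm_num] at h
    exact h.congr' (hXx.mono fun W hW => hW.1.symm)
  · have h := (tH.const_mul (-128)).div tX (by norm_num)
    rw [show (-128 * 1 / -32 : ℂ) = 4 by norm_num] at h
    exact h.congr' (hXx.mono fun W hW => hW.2.1.symm)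
  · have h := tx.div t8.neg (by norm_num)
    rw [show (-16 / -16 : ℂ) = 1 by norm_num] at h
    refine h.congr' (hU.mono fun W hW => ?_)
    change (w W - theta 5 W ^ 2) / rootProd W ^ 4 / (-((w W - theta 8 W ^ 2) / q1 W)) =
      (w W - theta 5 W ^ 2) / (w W - theta 8 W ^ 2) / (-(q2 W / (q3 W * q4 W)))
    rw [rootProd_pow_four]
    have := h1 W
    have := h2 W
    have := h3 W
    have := h4 W
    field_simp
  · have h := ((tX.pow 2).mul t8).div (((tw.const_mul (128 ^ 2)).mul tF).mul tH) (by norm_num)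
    rw [show ((-32) ^ 2 * 16 / (128 ^ 2 * 1 * 1 * 1) : ℂ) = 1 by norm_num] at h
    exact h.congr' (hXx.mono fun W hW => hW.2.2.symm)

/-! ### The neighbourhoods of the boundary point -/

theorem norm_root_pow_four (k : Fin 4) (W : Mat) :
    ‖root k W‖ ^ 4 = Real.exp (-(Real.pi * (cuspLin W k).im)) := by
  rw [← norm_pow, root_pow_four, Complex.norm_exp]
  congr 1
  simp [mul_re]

theorem forall_norm_flatCoord_lt {W : Mat} {ε : ℝ} :
    (∀ k, ‖flatCoord W k‖ < ε) ↔ ∀ k, Real.exp (-(Real.pi * (cuspLin W k).im)) < ε := by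
  have h4 : ∀ P : Fin 4 → Prop, (∀ k, P k) ↔ P 0 ∧ P 1 ∧ P 2 ∧ P 3 := fun P => by
    simp [Fin.forall_fin_succ]
  obtain ⟨h0, h1, h2, h3⟩ := norm_flatCoord W
  simp only [← norm_root_pow_four]
  rw [h4, h4, h0, h1, h2, h3]
  tauto

/-- For ε ≤ 1 membership in the upper half space is automatic, because all four roots have absolute
value less than 1. -/
theorem mem_cuspNhd_iff {W : Mat} {ε : ℝ} (hε : ε ≤ 1) :
    W ∈ cuspNhd ε ↔ ∀ k, Real.exp (-(Real.pi * (cuspLin W k).im)) < ε := by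
  refine ⟨fun h => forall_norm_flatCoord_lt.1 h.2, fun h => ⟨?_, forall_norm_flatCoord_lt.2 h⟩⟩
  refine mem_upperHalf_of_norm_root_lt fun k => lt_of_not_ge fun h1 => ?_
  refine ((h k).trans_le hε).not_ge ?_
  rw [← norm_root_pow_four]
  exact one_le_pow₀ h1

/-- `cuspLin` in the coordinate `k` as a linear form. -/
noncomputable def cuspForm (k : Fin 4) : (Fin 2 → Fin 2 → ℂ) →ₗ[ℂ] ℂ where
  toFun v := cuspLin (Matrix.of v) k
  map_add' u v := by
    fin_cases k <;> simp [cuspLin] <;> ring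
  map_smul' c v := by
    fin_cases k <;> simp [cuspLin] <;> ring

/-- Taking logarithms turns the conditions into four open half-spaces Im ℓₖ > -log ε / π for linear
forms ℓₖ. -/
theorem isOpen_convex_cuspNhd {ε : ℝ} (h0 : 0 < ε) (hε : ε ≤ 1) :
    IsOpen {v : Fin 2 → Fin 2 → ℂ | Matrix.of v ∈ cuspNhd ε} ∧
      Convex ℝ {v : Fin 2 → Fin 2 → ℂ | Matrix.of v ∈ cuspNhd ε} := by
  have hset : {v : Fin 2 → Fin 2 → ℂ | Matrix.of v ∈ cuspNhd ε} =
      ⋂ k, {v | -(Real.log ε) / Real.pi < (cuspForm k v).im} := by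
    ext v
    simp only [Set.mem_ofPred_eq, mem_cuspNhd_iff hε, Set.mem_iInter]
    refine forall_congr' fun k => ?_
    rw [← Real.lt_log_iff_exp_lt h0, div_lt_iff₀ Real.pi_pos, neg_lt, mul_comm]
    rfl
  rw [hset]
  refine ⟨isOpen_iInter_of_finite fun k => isOpen_lt continuous_const
    (Complex.continuous_im.comp (cuspForm k).continuous_of_finiteDimensional),
    convex_iInter fun k => convex_halfSpace_gt ?_ _⟩
  exact (Complex.imLm.comp ((cuspForm k).restrictScalars ℝ)).isLinear

theorem cuspNhd_mem_cusp {ε : ℝ} (h0 : 0 < ε) (hε : ε ≤ 1) : cuspNhd ε ∈ cusp := by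
  have h := tendsto_flatCoord.eventually (Metric.ball_mem_nhds 0 h0)
  refine h.mono fun W hW => ?_
  rw [dist_zero_right, pi_norm_lt_iff h0] at hW
  exact (mem_cuspNhd_iff hε).2 (forall_norm_flatCoord_lt.1 hW)

theorem exists_cuspNhd_subset {s : Set Mat} (hs : s ∈ cusp) :
    ∃ ε₀ : ℝ, 0 < ε₀ ∧ ε₀ ≤ 1 ∧ ∀ ε ≤ ε₀, cuspNhd ε ⊆ s := by
  obtain ⟨r, hr, h⟩ := (Metric.nhds_basis_ball.comap flatCoord).mem_iff.1 hs
  refine ⟨min r 1, lt_min hr one_pos, min_le_right _ _, fun ε hε W hW => h ?_⟩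
  rw [Set.mem_preimage, mem_ball_zero_iff, pi_norm_lt_iff hr]
  exact fun k => (hW.2 k).trans_le (hε.trans (min_le_left _ _))

/-- The matrix with given values of the linear forms `cuspLin`. -/
noncomputable def ofCuspLin (l : Fin 4 → ℂ) : Mat :=
  !![l 2 + l 0 + l 1, ((1 - I) * l 0 + (1 + I) * l 1) / 2;
     I * ((1 - I) * l 0 - (1 + I) * l 1) / 2, l 3 + l 0 + l 1]

theorem cuspLin_ofCuspLin (l : Fin 4 → ℂ) : cuspLin (ofCuspLin l) = l := by
  have h0 : cuspLin (ofCuspLin l) 0 = l 0 := by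
    rw [cuspLin_zero]
    simp only [ofCuspLin, Matrix.of_apply, Matrix.cons_val]
    linear_combination (-(1 + I) / 4 * ((1 - I) * l 0 - (1 + I) * l 1) - l 0 / 2) * Complex.I_sq
  have h1 : cuspLin (ofCuspLin l) 1 = l 1 := by
    rw [cuspLin_one]
    simp only [ofCuspLin, Matrix.of_apply, Matrix.cons_val]
    linear_combination ((1 - I) / 4 * ((1 - I) * l 0 - (1 + I) * l 1) - l 1 / 2) * Complex.I_sq
  funext k
  fin_cases k
  · exact h0
  · exact h1
  · change cuspLin (ofCuspLin l) 2 = l 2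
    rw [cuspLin_two, h0, h1]
    simp only [ofCuspLin, Matrix.of_apply, Matrix.cons_val]
    ring
  · change cuspLin (ofCuspLin l) 3 = l 3
    rw [cuspLin_three, h0, h1]
    simp only [ofCuspLin, Matrix.of_apply, Matrix.cons_val]
    ring

/-- Arbitrarily close to the boundary point there are matrices with `q₃ = -q₄`. -/
theorem neBot_cusp_opposite : (cusp ⊓ 𝓟 {W | q3 W = -q4 W}).NeBot := by
  -- The real shift by 1 in the second coordinate changes q₄ by exp(πi) = -1 and leaves all absolute
  -- values unchanged.
  let γ : ℝ → Mat := fun T => ofCuspLin ![T * I, T * I + 1, T * I, T * I]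
  have hl : ∀ T k, (cuspLin (γ T) k).im = T := fun T k => by
    rw [cuspLin_ofCuspLin]
    fin_cases k <;> simp
  have h1 : Tendsto γ atTop cusp := by
    rw [cusp, tendsto_comap_iff, tendsto_pi_nhds]
    intro k
    rw [Pi.zero_apply, Metric.tendsto_nhds]
    intro ε hε
    have : Tendsto (fun T : ℝ => Real.exp (-(Real.pi * T))) atTop (𝓝 0) :=
      Real.tendsto_exp_neg_atTop_nhds_zero.comp (tendsto_id.const_mul_atTop Real.pi_pos)
    filter_upwards [this.eventually (gt_mem_nhds hε)] with T hT
    rw [dist_zero_right]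
    exact forall_norm_flatCoord_lt.2 (fun k => by rwa [hl]) k
  have h2 : ∀ T, q3 (γ T) = -q4 (γ T) := fun T => by
    rw [← root_zero_pow, ← root_one_pow, root_pow_four, root_pow_four, cuspLin_ofCuspLin]
    simp only [Matrix.cons_val, mul_add, mul_one, Complex.exp_add, Complex.exp_pi_mul_I]
    ring
  exact NeBot.mono (map_neBot : (map γ atTop).NeBot)
    (le_inf h1 (le_principal_iff.2 (mem_map.2 (univ_mem' h2))))

/-! ### The identity theorem -/

/-- A product of holomorphic functions on a convex open set vanishes only if a factor does. -/
theorem eqOn_zero_or_eqOn_zero_of_mul {E : Type*} [NormedAddCommGroup E] [NormedSpace ℂ E]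
    {S : Set E} (ho : IsOpen S) (hc : Convex ℝ S) {f g : E → ℂ}
    (hf : DifferentiableOn ℂ f S) (hg : DifferentiableOn ℂ g S)
    (hfg : ∀ x ∈ S, f x * g x = 0) : (∀ x ∈ S, f x = 0) ∨ ∀ x ∈ S, g x = 0 := by
  by_contra! H
  obtain ⟨⟨x, hx, hfx⟩, y, hy, hgy⟩ := H
  -- The problem is restricted to the complex line through a point where f ≠ 0 and a point where g ≠
  -- 0. By convexity the preimage of S is connected, so the identity theorem in one variable
  -- applies.
  let γ : ℂ → E := fun t => x + t • (y - x)
  have hγ : Differentiable ℂ γ := by fun_prop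
  have hγ0 : γ 0 = x := by simp [γ]
  have hγ1 : γ 1 = y := by simp [γ]
  have hopen : IsOpen (γ ⁻¹' S) := ho.preimage hγ.continuous
  have hconv : Convex ℝ (γ ⁻¹' S) := by
    intro s hs t ht a b ha hb hab
    have h := hc hs ht ha hb hab
    have e : γ (a • s + b • t) = a • γ s + b • γ t := by
      obtain rfl : b = 1 - a := by linarith
      simp only [γ, ← Complex.coe_smul, smul_eq_mul, ofReal_sub, ofReal_one]
      module
    rwa [Set.mem_preimage, e]
  have han : AnalyticOnNhd ℂ (g ∘ γ) (γ ⁻¹' S) :=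
    (hg.comp hγ.differentiableOn fun t ht => ht).analyticOnNhd hopen
  have h0 : (0 : ℂ) ∈ γ ⁻¹' S := by rwa [Set.mem_preimage, hγ0]
  have hz : (g ∘ γ) =ᶠ[𝓝 0] 0 := by
    have hcont : ContinuousAt (f ∘ γ) 0 :=
      ((hf.comp hγ.differentiableOn fun t ht => ht).differentiableAt (hopen.mem_nhds h0)).continuousAt
    have hne : (f ∘ γ) 0 ≠ 0 := by rwa [Function.comp_apply, hγ0]
    filter_upwards [hcont.eventually_ne hne, hopen.mem_nhds h0] with t ht hS
    exact (mul_eq_zero.1 (hfg _ hS)).resolve_left ht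
  have h1 := han.eqOn_zero_of_preconnected_of_eventuallyEq_zero hconv.isPreconnected h0 hz
    (show (1 : ℂ) ∈ γ ⁻¹' S by rwa [Set.mem_preimage, hγ1])
  exact hgy (by simpa [hγ1] using h1)

/-! ### Holomorphy of the solution -/

theorem holomorphicOn_thetaSq {U : Set Mat} (hU : U ⊆ upperHalf) (s : Fin 10) :
    DifferentiableOn ℂ (fun v : Tab => theta s (Matrix.of v) ^ 2) {v | Matrix.of v ∈ U} :=
  DifferentiableOn.pow ((differentiableOn_hermTheta _ _).mono fun _ hv => hU hv) 2

theorem differentiableOn_div {f g : Tab → ℂ} {S : Set Tab} (hf : DifferentiableOn ℂ f S)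
    (hg : DifferentiableOn ℂ g S) (h0 : ∀ v ∈ S, g v ≠ 0) :
    DifferentiableOn ℂ (fun v => f v / g v) S := by
  simpa only [div_eq_mul_inv] using hf.fun_mul (hg.fun_inv h0)

theorem holomorphicOn_wFormula {U : Set Mat} (hU : U ⊆ upperHalf)
    (h7 : ∀ W ∈ U, theta 7 W ≠ 0) {T : Mat → ℂ} (hT : HolomorphicOn T U) :
    HolomorphicOn (fun W => wFormula W (T W)) U := by
  have t := holomorphicOn_thetaSq hU
  have h1 := differentiableOn_div (differentiableOn_const (1 : ℂ)) ((t 7).const_mul 2) fun (v : Tab) hv =>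
    mul_ne_zero two_ne_zero (pow_ne_zero 2 (h7 (Matrix.of v) hv))
  exact h1.mul ((((t 6).mul (t 7)).sub ((t 9).mul (t 4))).add ((t 5).mul (t 8)) |>.sub hT)

theorem holomorphicOn_zFormula {U : Set Mat} (hU : U ⊆ upperHalf) {w : Mat → ℂ}
    (hw : HolomorphicOn w U) (hd : ∀ W ∈ U, DenomsNeZero W (w W)) :
    HolomorphicOn (fun W => zFormula W (w W)) U := by
  have t := holomorphicOn_thetaSq hU
  have hw' : DifferentiableOn ℂ (fun v : Tab => w (Matrix.of v)) {v | Matrix.of v ∈ U} := hw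
  have w5 := hw'.fun_sub (t 5)
  have w8 := hw'.fun_sub (t 8)
  have w2 := ((t 2).fun_add (t 8)).fun_sub hw'
  have w3 := ((t 3).fun_add (t 8)).fun_sub hw'
  refine differentiableOn_pi.2 fun k => ?_
  fin_cases k
  · exact differentiableOn_div w2 w5 fun (v : Tab) hv => (hd (Matrix.of v) hv).2.1
  · exact differentiableOn_div w3 w5 fun (v : Tab) hv => (hd (Matrix.of v) hv).2.1
  · exact differentiableOn_div w5 w8 fun (v : Tab) hv => (hd (Matrix.of v) hv).2.2.1
  · exact differentiableOn_div ((w5.fun_pow 2).fun_mul w8) ((hw'.fun_mul w2).fun_mul w3) fun (v : Tab) hv =>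
      mul_ne_zero (mul_ne_zero (hd (Matrix.of v) hv).1 (hd (Matrix.of v) hv).2.2.2.1) (hd (Matrix.of v) hv).2.2.2.2

/-! ### The mirror map -/

variable {Th : Mat → ℂ}

theorem IsThetaTilde.solutionLimits (h : IsThetaTilde Th) : SolutionLimits q3 q4 Th :=
  LambdaK3.solutionLimits h.2.1 (fun _ => Complex.exp_ne_zero _) (fun _ => Complex.exp_ne_zero _)
    (fun _ => rfl) (fun _ => rfl) (fun _ => rfl)
    (h.2.2.congr_left fun W => by rw [rootProd_pow_four])

/-- Changing the sign of the square root is the same as interchanging q₃ and q₄. -/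
theorem IsThetaTilde.solutionLimits_neg (h : IsThetaTilde Th) :
    SolutionLimits q4 q3 fun W => -Th W :=
  LambdaK3.solutionLimits (fun W hW => by rw [neg_sq, h.2.1 W hW])
    (fun _ => Complex.exp_ne_zero _) (fun _ => Complex.exp_ne_zero _)
    (fun _ => add_comm _ _) (fun _ => mul_comm _ _) (fun _ => add_comm _ _)
    (h.2.2.neg_left.congr_left fun W => by rw [rootProd_pow_four]; ring)

theorem IsThetaTilde.isMirrorSolution (h : IsThetaTilde Th) {ε : ℝ}
    (ht : ∀ W ∈ cuspNhd ε, ∀ s, theta s W ≠ 0) :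
    IsMirrorSolution ε (fun W => zFormula W (wFormula W (Th W))) fun W => wFormula W (Th W) := by
  have hU : cuspNhd ε ⊆ upperHalf := fun W hW => hW.1
  have hsol := fun W (hW : W ∈ cuspNhd ε) =>
    masterEq_solutions (squareRelations hW.1) (ht W hW) (h.2.1 W hW.1)
  have hw : HolomorphicOn (fun W => wFormula W (Th W)) (cuspNhd ε) :=
    holomorphicOn_wFormula hU (fun W hW => ht W hW 7) (h.1.mono fun _ hv => hU hv)
  refine ⟨holomorphicOn_zFormula hU hw fun W hW =>
    (hsol W hW (zFormula W (wFormula W (Th W))) _).2 (Or.inl rfl), hw,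
    fun W hW => (hsol W hW _ _).1.2 ⟨rfl, Or.inl rfl⟩, fun k => ?_⟩
  have hl := h.solutionLimits
  fin_cases k
  · refine (neg_neg (4 : ℂ) ▸ hl.first.neg).congr fun W => ?_
    exact (div_neg _).symm
  · exact hl.second
  · exact hl.third
  · exact hl.fourth

/-- At each point `w` is one of the two roots, so the product of its differences to them vanishes,
and by the identity theorem it is the same root on the whole neighbourhood. The boundary behaviour
excludes the second one. -/
theorem IsThetaTilde.eq_of_isMirrorSolution (h : IsThetaTilde Th) {ε : ℝ} (h0 : 0 < ε)
    (hε : ε ≤ 1) (ht : ∀ W ∈ cuspNhd ε, ∀ s, theta s W ≠ 0) {z : Mat → Fin 4 → ℂ} {w : Mat → ℂ}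
    (hzw : IsMirrorSolution ε z w) {W : Mat} (hW : W ∈ cuspNhd ε) :
    w W = wFormula W (Th W) ∧ z W = zFormula W (w W) := by
  have hU : cuspNhd ε ⊆ upperHalf := fun W hW => hW.1
  have hsol := fun W (hW : W ∈ cuspNhd ε) =>
    (masterEq_solutions (squareRelations hW.1) (ht W hW) (h.2.1 W hW.1) _ _).1.1 (hzw.2.2.1 W hW)
  have hTh : HolomorphicOn Th (cuspNhd ε) := h.1.mono fun _ hv => hU hv
  have h7 := fun W (hW : W ∈ cuspNhd ε) => ht W hW 7
  obtain ⟨ho, hc⟩ := isOpen_convex_cuspNhd h0 hε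
  refine ⟨?_, (hsol W hW).1⟩
  rcases eqOn_zero_or_eqOn_zero_of_mul ho hc
    (DifferentiableOn.sub hzw.2.1 (holomorphicOn_wFormula hU h7 hTh))
    (DifferentiableOn.sub hzw.2.1 (holomorphicOn_wFormula hU h7 (T := fun W => -Th W)
      (DifferentiableOn.neg hTh)))
    (fun v hv => mul_eq_zero.2 ((hsol _ hv).2.imp sub_eq_zero.2 sub_eq_zero.2)) with H | H
  · exact sub_eq_zero.1 (H _ hW)
  -- For the wrong root z̃₁ ∼ -4q₃, while a mirror solution needs z̃₁ ∼ -4q₄. Along q₃ = -q₄ the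
  -- quotient z̃₁/Q̃₁ would tend to both 4 and -4.
  · exfalso
    have hz : ∀ᶠ W in cusp, z W = zFormula W (wFormula W (-Th W)) := by
      filter_upwards [cuspNhd_mem_cusp h0 hε] with W hW
      rw [(hsol W hW).1]
      congr 1
      exact sub_eq_zero.1 (H _ hW)
    have := neBot_cusp_opposite
    have l1 := (hzw.2.2.2 0).mono_left
      (inf_le_left : cusp ⊓ 𝓟 {W | q3 W = -q4 W} ≤ cusp)
    have l2 := h.solutionLimits_neg.first.mono_left
      (inf_le_left : cusp ⊓ 𝓟 {W | q3 W = -q4 W} ≤ cusp)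
    have heq : (fun W => z W 0 / flatCoord W 0) =ᶠ[cusp ⊓ 𝓟 {W | q3 W = -q4 W}]
        fun W => zFormula W (wFormula W (-Th W)) 0 / q3 W := by
      filter_upwards [hz.filter_mono inf_le_left, mem_inf_of_right (mem_principal_self _)]
        with W hW hq
      rw [hW, show q3 W = -q4 W from hq]
      rfl
    have h4 : (4 : ℂ) = -4 := tendsto_nhds_unique l1 (l2.congr' heq.symm)
    norm_num at h4

end LambdaK3

/-! ### The main theorem -/

theorem mainTheorem3 :
    (∃ Th : LambdaK3.Mat → ℂ, LambdaK3.IsThetaTilde Th) ∧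
    ∀ Th : LambdaK3.Mat → ℂ, LambdaK3.IsThetaTilde Th →
      -- the algebraic solution at each point where the ten theta functions do not vanish
      (∀ W ∈ LambdaK3.upperHalf, (∀ s, LambdaK3.theta s W ≠ 0) →
        ∀ (z : Fin 4 → ℂ) (w : ℂ),
          (LambdaK3.MasterEq W z w ↔
            z = LambdaK3.zFormula W w ∧
              (w = LambdaK3.wFormula W (Th W) ∨ w = LambdaK3.wFormula W (-Th W))) ∧
          (LambdaK3.MasterEq W z w → LambdaK3.DenomsNeZero W w)) ∧
      -- the unique solution near the boundary point
      (∃ ε₀ : ℝ, 0 < ε₀ ∧ ∀ ε : ℝ, 0 < ε → ε ≤ ε₀ →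
        (∀ W ∈ LambdaK3.cuspNhd ε, ∀ s, LambdaK3.theta s W ≠ 0) ∧
        LambdaK3.IsMirrorSolution ε
          (fun W => LambdaK3.zFormula W (LambdaK3.wFormula W (Th W)))
          (fun W => LambdaK3.wFormula W (Th W)) ∧
        ∀ (z : LambdaK3.Mat → Fin 4 → ℂ) (w : LambdaK3.Mat → ℂ),
          LambdaK3.IsMirrorSolution ε z w →
            ∀ W ∈ LambdaK3.cuspNhd ε,
              w W = LambdaK3.wFormula W (Th W) ∧ z W = LambdaK3.zFormula W (w W)) := by
  refine ⟨⟨_, LambdaK3.isThetaTilde_thetaTilde⟩, fun Th h => ⟨fun W hW ht z w => ?_, ?_⟩⟩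
  · obtain ⟨h1, h2⟩ :=
      LambdaK3.masterEq_solutions (LambdaK3.squareRelations hW) ht (h.2.1 W hW) z w
    exact ⟨h1, fun hM => h2 (h1.1 hM).2⟩
  · obtain ⟨ε₀, h0, h1, hsub⟩ :=
      LambdaK3.exists_cuspNhd_subset LambdaK3.eventually_theta_ne_zero
    refine ⟨ε₀, h0, fun ε hε hle => ?_⟩
    have ht : ∀ W ∈ LambdaK3.cuspNhd ε, ∀ s, LambdaK3.theta s W ≠ 0 := fun W hW =>
      (hsub ε hle hW).2
    exact ⟨ht, h.isMirrorSolution ht, fun z w hzw W hW =>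
      h.eq_of_isMirrorSolution hε (hle.trans h1) ht hzw hW⟩
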